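/- Let $d\ge 1$ and let $\mathbb T^d=(\mathbb R/2\pi\mathbb Z)^d$. For $1\le p<\infty$ let $L_p(\mathbb T^d)$ be the space of real-valued measurable functions on $\mathbb T^d$ with $\|f\|_p=\big(\int_{\mathbb T^d}|f(x)|^p\,dx\big)^{1/p}<\infty$, and let $L_\infty(\mathbb T^d)$ denote the space of real-valued continuous functions on $\mathbb T^d$ with the maximum norm. For $\beta,\delta>0$ and $n\in\mathbb N$ let $$\mathcal R_n^{\beta,\delta}(x)=\sum_{k\in\mathbb Z^d}\Big(1-\frac{|k|^\beta}{n^\beta}\Big)_+^\delta e^{i(k,x)},\qquad \mathcal S_n^{\beta,\delta}(f;x)=(2\pi)^{-d}\int_{\mathbb T^d}f(x+y)\,\mathcal R_n^{\beta,\delta}(y)\,dy,$$ where $|\cdot|$ is the Euclidean norm and $t_+=\max\{t,0\}$, and let $\mathcal S_n^{\delta}=\mathcal S_n^{2,\delta}$ be the classical Bochner–Riesz means. Operators $\mathcal L_n$ are said to converge in $L_p$ if $\lim_{n\to\infty}\|f-\mathcal L_n(f)\|_p=0$ for every $f\in L_p(\mathbb T^d)$, and to diverge in $L_p$ otherwise.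 Put $$\Sigma(d)=\Big\{(u,\delta)\in[0,\infty)^2:\ \delta>\max\Big\{\tfrac{d-1}2,\ d\big(u-\tfrac12\big)-\tfrac12\Big\}\Big\},\qquad \Gamma(d)=\Big\{(u,\delta)\in[0,\infty)^2:\ \delta\le d\,\big|u-\tfrac12\big|-\tfrac12\Big\}.$$ Let $1\le p\le\infty$ and $\beta,\delta>0$, with $1/p=0$ for $p=\infty$. Then the means $\mathcal S_n^{\beta,\delta}$ converge in $L_p$ if and only if the means $\mathcal S_n^{\delta}$ converge in $L_p$. In particular, the means $\mathcal S_n^{\beta,\delta}$ converge in $L_p$ if $(1/p,\delta)\in\Sigma(d)$, and they diverge in $L_p$ if $(1/p,\delta)\in\Gamma(d)$. -/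

import Mathlib

open MeasureTheory Filter Topology
open scoped ENNReal

noncomputable section

namespace BochnerRiesz

instance fact_two_pi_pos : Fact (0 < 2 * Real.pi) := ⟨Real.two_pi_pos⟩

/-- The `d`-dimensional torus `(ℝ / 2πℤ)^d`. Functions on it are the functions on `ℝ^d` that are
`2π`-periodic in each variable, and its `volume` is Lebesgue measure on `[0, 2π)^d`
(total mass `(2π)^d`). -/
abbrev Torus (d : ℕ) : Type := Fin d → AddCircle (2 * Real.pi)

/-- The Euclidean length `|k|` of `k ∈ ℤ^d`. -/
def eucl {d : ℕ} (k : Fin d → ℤ) : ℝ := Real.sqrt (∑ j, (k j : ℝ) ^ 2)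

/-- The character `x ↦ e^{i(k,x)} = ∏ⱼ e^{i kⱼ xⱼ}` of the torus. -/
def character {d : ℕ} (k : Fin d → ℤ) (x : Torus d) : ℂ := ∏ j, fourier (k j) (x j)

/-- The generalized Bochner–Riesz kernel `∑_{k ∈ ℤ^d} (1 - |k|^β / n^β)_+^δ e^{i(k,x)}`.
For `n ≥ 1` and `β, δ > 0` only finitely many terms are nonzero. -/
def kernel (d : ℕ) (β δ : ℝ) (n : ℕ) (x : Torus d) : ℂ :=
  ∑' k : Fin d → ℤ,
    (((max (1 - eucl k ^ β / (n : ℝ) ^ β) 0) ^ δ : ℝ) : ℂ) * character k x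

/-- The generalized Bochner–Riesz mean `(2π)^{-d} ∫_{𝕋^d} f(x + y) R_n^{β,δ}(y) dy`. -/
def mean (d : ℕ) (β δ : ℝ) (n : ℕ) (f : Torus d → ℝ) (x : Torus d) : ℂ :=
  (((2 * Real.pi) ^ d : ℝ) : ℂ)⁻¹ * ∫ y : Torus d, (f (x + y) : ℂ) * kernel d β δ n y

/-- The classical Bochner–Riesz mean, the case `β = 2`. -/
def classicalMean (d : ℕ) (δ : ℝ) (n : ℕ) (f : Torus d → ℝ) (x : Torus d) : ℂ :=
  mean d 2 δ n f x

/-- Membership in the space `L_p(𝕋^d)` of real-valued functions; for `p = ∞` this is, by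
convention, the space of continuous functions. -/
def InLp {d : ℕ} (p : ℝ≥0∞) (f : Torus d → ℝ) : Prop :=
  if p = ∞ then Continuous f else MemLp f p volume

/-- The operators `L n` converge in `L_p(𝕋^d)`: `‖f - L n f‖_p → 0` for every `f ∈ L_p(𝕋^d)`.
For `p = ∞` the functions involved are continuous, so the essential supremum is the maximum. -/
def ConvergesInLp {d : ℕ} (p : ℝ≥0∞) (L : ℕ → (Torus d → ℝ) → Torus d → ℂ) : Prop :=
  ∀ f : Torus d → ℝ, InLp p f →
    Tendsto (fun n => eLpNorm (fun x => (f x : ℂ) - L n f x) p volume) atTop (𝓝 0)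

/-- The region `Σ(d)` of pairs `(1/p, δ)`. -/
def SigmaRegion (d : ℕ) : Set (ℝ × ℝ) :=
  {q | 0 ≤ q.1 ∧ 0 ≤ q.2 ∧
    max (((d : ℝ) - 1) / 2) ((d : ℝ) * (q.1 - 1 / 2) - 1 / 2) < q.2}

/-- The region `Γ(d)` of pairs `(1/p, δ)`. -/
def GammaRegion (d : ℕ) : Set (ℝ × ℝ) :=
  {q | 0 ≤ q.1 ∧ 0 ≤ q.2 ∧ q.2 ≤ (d : ℝ) * |q.1 - 1 / 2| - 1 / 2}

end BochnerRiesz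

end

noncomputable section

namespace BochnerRiesz

variable {d : ℕ}

/-! ### Characters of the torus -/

/-! Convergence in `L_p` is a statement about multipliers. By Banach–Steinhaus in one direction and
density of trigonometric polynomials in the other, the means converge iff the multipliers `weight β
δ n`, `n ≥ 1`, are uniformly bounded on trigonometric polynomials (`convergesInLp_iff`). For `p = ∞`
the underlying Banach space is the closed span of the characters in `L_∞`, which consists of
continuous functions.

Independence of `β`. With `v = |k|²/n²` and `b = β/2` the weight is `(1 - v^b)_+^δ`. Two such
functions with exponents `b₁`, `b₂` vanish to the same order at `v = 1`, so on `[0, 1)` their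
quotient agrees with a function `comparison` assembled from compactly supported functions `G(v^b)`
with `G` smooth. The Taylor formula with integral remainder writes `G(v^b)` as a superposition, with
integrable density, of truncated powers `(1 - v/s)_+^N`. For `N` above the critical index, `(1 -
|ξ|²)_+^N` has an integrable Fourier transform, so its dilates act on `L_p` as averages of
translations, with a bound independent of the dilation. Hence `comparison` is a uniformly bounded
multiplier, and boundedness passes from `b₂` to `b₁`, and back by symmetry. The same integrability
gives convergence for `δ > (d-1)/2`; since `1/p ≤ 1`, this is all of `Σ(d)`.

Divergence. It suffices to treat `β = 2`. Testing bounded means on de la Vallée Poussin kernels and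
letting `n → ∞` bounds the pairing of the Fourier transform of `(1 - |ξ|²)_+^δ` with a radial
function by the `L_q'` norm of that function (`exists_abs_integral_rieszKernel_le`), where `q` is
`p` or its conjugate, chosen with `q ≤ 2`. This transform is a Bessel-type function of `r = |y|`, of
amplitude `r^{-δ-(d+1)/2}` and with nontrivial mean square, as an energy estimate for its
differential equation shows. Pairing it with itself times a power of `r`, cut off to `[1, A]`, gives
at least a multiple of `log A`. In the region `Γ(d)`, its boundary line included, the `L_q'` norm is
only `O((log A)^{1/q'})` with `1/q' < 1/2`: a contradiction for large `A`. -/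

theorem character_add_right (k : Fin d → ℤ) (x y : Torus d) :
    character k (x + y) = character k x * character k y := by
  simp only [character, ← Finset.prod_mul_distrib]
  refine Finset.prod_congr rfl fun j _ => ?_
  simp [fourier_apply, AddCircle.toCircle_add, smul_add]

theorem character_add (k l : Fin d → ℤ) (x : Torus d) :
    character (k + l) x = character k x * character l x := by
  simp only [character, ← Finset.prod_mul_distrib]
  exact Finset.prod_congr rfl fun j _ => by simp

theorem character_neg (k : Fin d → ℤ) (x : Torus d) :
    character (-k) x = starRingEnd ℂ (character k x) := by
  simp [character, map_prod]

theorem character_zero (x : Torus d) : character 0 x = 1 := by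
  simp [character]

theorem norm_character (k : Fin d → ℤ) (x : Torus d) : ‖character k x‖ = 1 := by
  simp only [character, norm_prod, fourier_apply]
  exact Finset.prod_eq_one fun j _ => Circle.norm_coe _

theorem continuous_character (k : Fin d → ℤ) : Continuous (character k : Torus d → ℂ) := by
  unfold character
  fun_prop

/-- The projection `ℝ^d → 𝕋^d`. -/
def toTorus (y : Fin d → ℝ) : Torus d := fun j => (y j : AddCircle (2 * Real.pi))

theorem character_toTorus (k : Fin d → ℤ) (y : Fin d → ℝ) :
    character k (toTorus y) = Complex.exp (Complex.I * ((∑ j, (k j : ℝ) * y j : ℝ) : ℂ)) := by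
  simp only [character, toTorus, fourier_coe_apply]
  rw [← Complex.exp_sum]
  congr 1
  push_cast
  rw [Finset.mul_sum]
  refine Finset.sum_congr rfl fun j _ => ?_
  have : (Real.pi : ℂ) ≠ 0 := by exact_mod_cast Real.pi_ne_zero
  field_simp

theorem integral_fourier_volume (n : ℤ) :
    ∫ t : AddCircle (2 * Real.pi), fourier n t = if n = 0 then ((2 * Real.pi : ℝ) : ℂ) else 0 := by
  split_ifs with h
  · subst h
    simp [measureReal_def, AddCircle.measure_univ, Real.pi_pos.le]
  -- Translation by half a period of `fourier n` changes its sign but not its integral.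
  · have h1 := integral_add_right_eq_self (μ := (volume : Measure (AddCircle (2 * Real.pi))))
      (fun t => (fourier n t : ℂ)) (((2 * Real.pi) / 2 / n : ℝ) : AddCircle (2 * Real.pi))
    have h2 : ∀ t : AddCircle (2 * Real.pi),
        (fourier n (t + (((2 * Real.pi) / 2 / n : ℝ) : AddCircle (2 * Real.pi))) : ℂ)
        = - fourier n t := fun t => fourier_add_half_inv_index h Real.two_pi_pos t
    simp only [h2, integral_neg] at h1
    exact self_eq_neg.mp h1.symm

theorem integral_character (k : Fin d → ℤ) :
    ∫ x : Torus d, character k x = if k = 0 then (((2 * Real.pi) ^ d : ℝ) : ℂ) else 0 := by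
  unfold character
  rw [integral_fintype_prod_volume_eq_prod (fun j => fun t : AddCircle (2 * Real.pi) =>
    (fourier (k j) t : ℂ))]
  simp only [integral_fourier_volume]
  split_ifs with h
  · subst h; simp
  · obtain ⟨j, hj⟩ : ∃ j, k j ≠ 0 := by
      by_contra! h'
      exact h (funext h')
    exact Finset.prod_eq_zero (Finset.mem_univ j) (by simp [hj])

/-- The characters as continuous maps. -/
def characterMap (k : Fin d → ℤ) : C(Torus d, ℂ) := ⟨character k, continuous_character k⟩

@[simp] theorem characterMap_apply (k : Fin d → ℤ) (x : Torus d) :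
    characterMap k x = character k x := rfl

/-- The star subalgebra of trigonometric polynomials. -/
def trigSubalgebra (d : ℕ) : StarSubalgebra ℂ C(Torus d, ℂ) where
  toSubalgebra := Algebra.adjoin ℂ (Set.range characterMap)
  star_mem' := by
    change Algebra.adjoin ℂ (Set.range characterMap) ≤
      star (Algebra.adjoin ℂ (Set.range characterMap))
    refine Algebra.adjoin_le ?_
    rintro _ ⟨n, rfl⟩
    refine Algebra.subset_adjoin ⟨-n, ?_⟩
    ext1 x
    simp [character_neg]

/-- The characters are closed under products and contain `1`, so the algebra they generate is
already their linear span; Stone–Weierstrass then applies to the span. -/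
theorem trigSubalgebra_coe :
    (trigSubalgebra d).toSubalgebra.toSubmodule = Submodule.span ℂ (Set.range characterMap) := by
  apply Algebra.adjoin_eq_span_of_subset
  refine .trans (fun x ↦ Submonoid.closure_induction (fun _ ↦ id) ⟨0, ?_⟩ ?_) Submodule.subset_span
  · ext z
    simp [character_zero]
  · rintro _ _ _ _ ⟨m, rfl⟩ ⟨n, rfl⟩
    refine ⟨m + n, ?_⟩
    ext z
    simp [character_add]

theorem character_single (z : Torus d) (i : Fin d) :
    character (Pi.single i 1) z = fourier 1 (z i) := by
  unfold character
  rw [Finset.prod_eq_single i]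
  · simp
  · intro j _ hj
    simp [Pi.single_eq_of_ne hj]
  · simp

theorem trigSubalgebra_separatesPoints : (trigSubalgebra d).SeparatesPoints := by
  intro x y hxy
  rw [Ne, funext_iff, not_forall] at hxy
  obtain ⟨i, hi⟩ := hxy
  refine ⟨_, ⟨characterMap (Pi.single i 1), Algebra.subset_adjoin ⟨Pi.single i 1, rfl⟩, rfl⟩, ?_⟩
  dsimp only
  rw [characterMap_apply, characterMap_apply, character_single, character_single, fourier_one,
    fourier_one]
  contrapose! hi
  exact AddCircle.injective_toCircle Real.two_pi_pos.ne' (Circle.coe_injective hi)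

theorem span_characterMap_closure_eq_top :
    (Submodule.span ℂ (Set.range (characterMap (d := d)))).topologicalClosure = ⊤ := by
  rw [← trigSubalgebra_coe]
  exact congr_arg (Subalgebra.toSubmodule <| StarSubalgebra.toSubalgebra ·)
    (ContinuousMap.starSubalgebra_topologicalClosure_eq_top_of_separatesPoints _
      trigSubalgebra_separatesPoints)

theorem exists_finset_sum_of_mem_span {X ι : Type*} [AddCommGroup X] [Module ℂ X] {e : ι → X}
    {x : X} (hx : x ∈ Submodule.span ℂ (Set.range e)) :
    ∃ (s : Finset ι) (c : ι → ℂ), x = ∑ k ∈ s, c k • e k := by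
  obtain ⟨c, rfl⟩ := (Finsupp.mem_span_range_iff_exists_finsupp).1 hx
  exact ⟨c.support, c, rfl⟩

end BochnerRiesz

end

noncomputable section

namespace BochnerRiesz

variable {d : ℕ}

/-! ### Multipliers of trigonometric polynomials -/

/-- The multiplier `m` has norm at most `C` on the linear combinations of the vectors `e k`. -/
def MultBdd {X ι : Type*} [NormedAddCommGroup X] [NormedSpace ℂ X] (e : ι → X) (C : ℝ)
    (m : ι → ℂ) : Prop :=
  ∀ (s : Finset ι) (c : ι → ℂ), ‖∑ k ∈ s, (m k * c k) • e k‖ ≤ C * ‖∑ k ∈ s, c k • e k‖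

/-- The weights of the generalized Bochner–Riesz means. -/
def weight (β δ : ℝ) (n : ℕ) (k : Fin d → ℤ) : ℝ :=
  (max (1 - eucl k ^ β / (n : ℝ) ^ β) 0) ^ δ

/-- The cube of lattice points with coordinates of modulus at most `n`. -/
def cube (d n : ℕ) : Finset (Fin d → ℤ) := Fintype.piFinset fun _ => Finset.Icc (-n : ℤ) n

theorem abs_le_eucl (k : Fin d → ℤ) (j : Fin d) : |(k j : ℝ)| ≤ eucl k := by
  unfold eucl
  rw [← Real.sqrt_sq_eq_abs]
  exact Real.sqrt_le_sqrt (Finset.single_le_sum (f := fun j => (k j : ℝ) ^ 2)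
    (fun i _ => sq_nonneg _) (Finset.mem_univ j))

theorem eucl_nonneg (k : Fin d → ℤ) : 0 ≤ eucl k := Real.sqrt_nonneg _

theorem eucl_neg (k : Fin d → ℤ) : eucl (-k) = eucl k := by simp [eucl]

theorem weight_neg (β δ : ℝ) (n : ℕ) (k : Fin d → ℤ) : weight β δ n (-k) = weight β δ n k := by
  simp [weight, eucl_neg]

theorem mem_cube_of_eucl_le {n : ℕ} {k : Fin d → ℤ} (h : eucl k ≤ n) : k ∈ cube d n := by
  simp only [cube, Fintype.mem_piFinset, Finset.mem_Icc]
  intro j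
  have := (abs_le_eucl k j).trans h
  rw [abs_le] at this
  exact ⟨by exact_mod_cast this.1, by exact_mod_cast this.2⟩

theorem weight_eq_zero {β δ : ℝ} (hβ : 0 < β) (hδ : 0 < δ) {n : ℕ} (hn : 1 ≤ n) {k : Fin d → ℤ}
    (hk : (n : ℝ) ≤ eucl k) : weight β δ n k = 0 := by
  have hn' : (0 : ℝ) < n := by exact_mod_cast hn
  have h1 : (1 : ℝ) ≤ eucl k ^ β / (n : ℝ) ^ β := by
    rw [one_le_div (by positivity)]
    exact Real.rpow_le_rpow hn'.le hk hβ.le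
  rw [weight, max_eq_right (by linarith), Real.zero_rpow hδ.ne']

theorem weight_eq_zero_of_notMem {β δ : ℝ} (hβ : 0 < β) (hδ : 0 < δ) {n : ℕ} (hn : 1 ≤ n)
    {k : Fin d → ℤ} (hk : k ∉ cube d n) : weight β δ n k = 0 :=
  weight_eq_zero hβ hδ hn (not_le.1 (mt mem_cube_of_eucl_le hk)).le

theorem tendsto_weight {β δ : ℝ} (hβ : 0 < β) (k : Fin d → ℤ) :
    Tendsto (fun n => weight β δ n k) atTop (𝓝 1) := by
  have h1 : Tendsto (fun n : ℕ => eucl k ^ β / (n : ℝ) ^ β) atTop (𝓝 0) :=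
    tendsto_const_nhds.div_atTop ((tendsto_rpow_atTop hβ).comp tendsto_natCast_atTop_atTop)
  have h2 := ((tendsto_const_nhds (x := (1 : ℝ))).sub h1).max (tendsto_const_nhds (x := (0 : ℝ)))
  have h3 := h2.rpow_const (p := δ) (Or.inl (by norm_num))
  simpa [weight] using h3

theorem kernel_eq_sum {β δ : ℝ} (hβ : 0 < β) (hδ : 0 < δ) {n : ℕ} (hn : 1 ≤ n) (x : Torus d) :
    kernel d β δ n x = ∑ k ∈ cube d n, (weight β δ n k : ℂ) * character k x := by
  unfold kernel
  refine tsum_eq_sum fun k hk => ?_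
  have := weight_eq_zero_of_notMem hβ hδ hn hk
  rw [weight] at this
  rw [this]
  simp

/-! ### Even multipliers of finite support as bounded operators on `L_p` -/

section Lp

variable (p : ℝ≥0∞) [hp : Fact (1 ≤ p)]

/-- The characters as elements of `L_p`. -/
def characterLp (k : Fin d → ℤ) : Lp ℂ p (volume : Measure (Torus d)) :=
  ContinuousMap.toLp (E := ℂ) p volume ℂ (characterMap k)

theorem coeFn_characterLp (k : Fin d → ℤ) : characterLp p k =ᵐ[volume] character k :=
  ContinuousMap.coeFn_toLp volume (characterMap k)

/-- Integration against the character `k`, as a functional on `L_p`. -/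
def pairing (k : Fin d → ℤ) : Lp ℂ p (volume : Measure (Torus d)) →L[ℂ] ℂ :=
  -- The exponent `(1 - p⁻¹)⁻¹` is conjugate to `p`, with values `∞` at `p = 1` and `1` at `p = ∞`.
  haveI := ENNReal.HolderConjugate.inv_one_sub_inv' hp.out
  haveI : Fact (1 ≤ (1 - p⁻¹)⁻¹) := by simp [fact_iff]
  ((ContinuousLinearMap.mul ℂ ℂ).lpPairing volume p (1 - p⁻¹)⁻¹).flip
    (characterLp (1 - p⁻¹)⁻¹ k)

theorem pairing_apply (k : Fin d → ℤ) (f : Lp ℂ p (volume : Measure (Torus d))) :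
    pairing p k f = ∫ x, f x * character k x := by
  have := ENNReal.HolderConjugate.inv_one_sub_inv' hp.out
  have : Fact (1 ≤ (1 - p⁻¹)⁻¹) := by simp [fact_iff]
  simp only [pairing, ContinuousLinearMap.flip_apply, ContinuousLinearMap.lpPairing_eq_integral]
  refine integral_congr_ae ?_
  filter_upwards [coeFn_characterLp (1 - p⁻¹)⁻¹ k] with x hx
  simp [hx]

/-- The operator with multiplier `m`, for `m` even and supported in `s`. -/
def multOp (s : Finset (Fin d → ℤ)) (m : (Fin d → ℤ) → ℂ) :
    Lp ℂ p (volume : Measure (Torus d)) →L[ℂ] Lp ℂ p (volume : Measure (Torus d)) :=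
  -- The output frequency is `-k` because the mean integrates `f (x + y)` against `character k y`,
  -- without conjugation. For even `m` this is the usual multiplier operator.
  ∑ k ∈ s, ((((2 * Real.pi) ^ d : ℝ) : ℂ)⁻¹ * m k) • (pairing p k).smulRight (characterLp p (-k))

theorem multOp_apply (s : Finset (Fin d → ℤ)) (m : (Fin d → ℤ) → ℂ)
    (f : Lp ℂ p (volume : Measure (Torus d))) :
    multOp p s m f = ∑ k ∈ s, ((((2 * Real.pi) ^ d : ℝ) : ℂ)⁻¹ * m k * pairing p k f) •
      characterLp p (-k) := by
  simp only [multOp, sum_apply, smul_apply,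
    ContinuousLinearMap.smulRight_apply, smul_smul]

theorem pairing_characterLp (k l : Fin d → ℤ) :
    pairing p k (characterLp p l) = if k = -l then (((2 * Real.pi) ^ d : ℝ) : ℂ) else 0 := by
  rw [pairing_apply]
  have : ∫ x, (characterLp p l) x * character k x = ∫ x : Torus d, character (k + l) x := by
    refine integral_congr_ae ?_
    filter_upwards [coeFn_characterLp p l] with x hx
    rw [hx, character_add, mul_comm]
  rw [this, integral_character]
  simp only [eq_neg_iff_add_eq_zero]

theorem multOp_characterLp {s : Finset (Fin d → ℤ)} {m : (Fin d → ℤ) → ℂ}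
    (hm : ∀ k ∉ s, m k = 0) (heven : ∀ k, m (-k) = m k) (l : Fin d → ℤ) :
    multOp p s m (characterLp p l) = m l • characterLp p l := by
  have h2 : ((((2 * Real.pi) ^ d : ℝ) : ℂ)) ≠ 0 := by
    exact_mod_cast (pow_pos Real.two_pi_pos d).ne'
  rw [multOp_apply, Finset.sum_eq_single (-l)]
  · rw [pairing_characterLp, if_pos rfl, heven, neg_neg, mul_right_comm, inv_mul_cancel₀ h2,
      one_mul]
  · intro k _ hk
    rw [pairing_characterLp, if_neg hk, mul_zero, zero_smul]
  · intro h
    rw [hm _ h]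
    simp

theorem multOp_sum {s : Finset (Fin d → ℤ)} {m : (Fin d → ℤ) → ℂ}
    (hm : ∀ k ∉ s, m k = 0) (heven : ∀ k, m (-k) = m k) (t : Finset (Fin d → ℤ))
    (c : (Fin d → ℤ) → ℂ) :
    multOp p s m (∑ k ∈ t, c k • characterLp p k) = ∑ k ∈ t, (m k * c k) • characterLp p k := by
  rw [map_sum]
  refine Finset.sum_congr rfl fun k _ => ?_
  rw [map_smul, multOp_characterLp p hm heven, smul_smul, mul_comm (c k)]

/-- The Bochner–Riesz means as bounded operators on `L_p`. -/
def meanOp (d : ℕ) (β δ : ℝ) (n : ℕ) :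
    Lp ℂ p (volume : Measure (Torus d)) →L[ℂ] Lp ℂ p (volume : Measure (Torus d)) :=
  multOp p (cube d n) fun k => (weight β δ n k : ℂ)

theorem meanOp_sum {β δ : ℝ} (hβ : 0 < β) (hδ : 0 < δ) {n : ℕ} (hn : 1 ≤ n)
    (t : Finset (Fin d → ℤ)) (c : (Fin d → ℤ) → ℂ) :
    meanOp p d β δ n (∑ k ∈ t, c k • characterLp p k) =
      ∑ k ∈ t, ((weight β δ n k : ℂ) * c k) • characterLp p k :=
  multOp_sum p (fun k hk => by rw [weight_eq_zero_of_notMem hβ hδ hn hk]; simp)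
    (fun k => by rw [weight_neg]) t c

theorem mean_ae_eq {β δ : ℝ} (hβ : 0 < β) (hδ : 0 < δ) {n : ℕ} (hn : 1 ≤ n) {f : Torus d → ℝ}
    (hf : MemLp (fun x => (f x : ℂ)) p volume) :
    mean d β δ n f =ᵐ[volume] meanOp p d β δ n (hf.toLp _) := by
  have hint : Integrable (fun x => (f x : ℂ)) volume := hf.integrable hp.out
  have h1 : ∀ x, mean d β δ n f x = ∑ k ∈ cube d n,
      ((((2 * Real.pi) ^ d : ℝ) : ℂ)⁻¹ * (weight β δ n k : ℂ) * pairing p k (hf.toLp _)) *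
        character (-k) x := by
    intro x
    have hk : ∀ k : Fin d → ℤ, ∫ y, (f (x + y) : ℂ) * character k y =
        pairing p k (hf.toLp _) * character (-k) x := by
      intro k
      -- Translation invariance: replacing `y` by `x + y` moves the dependence on `x` into the
      -- factor `character (-k) x`.
      have h2 := integral_add_left_eq_self (μ := (volume : Measure (Torus d)))
        (fun y => (f y : ℂ) * character k y * character (-k) x) x
      have h3 : ∫ y, (f y : ℂ) * character k y = pairing p k (hf.toLp _) := by
        rw [pairing_apply]
        refine integral_congr_ae ?_
        filter_upwards [hf.coeFn_toLp] with y hy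
        rw [hy]
      rw [← h3, ← integral_mul_const, ← h2]
      refine integral_congr_ae (ae_of_all _ fun y => ?_)
      have h4 : character k x * character (-k) x = 1 := by
        rw [← character_add, add_neg_cancel, character_zero]
      simp only [character_add_right]
      linear_combination (-(f (x + y) : ℂ) * character k y) * h4
    unfold mean
    simp_rw [kernel_eq_sum hβ hδ hn, Finset.mul_sum]
    rw [integral_finsetSum]
    · rw [Finset.mul_sum]
      refine Finset.sum_congr rfl fun k _ => ?_
      simp_rw [mul_left_comm _ (weight β δ n k : ℂ)]
      rw [integral_const_mul, hk]
      ring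
    · intro k _
      simp_rw [mul_left_comm _ (weight β δ n k : ℂ)]
      refine Integrable.const_mul ?_ _
      refine (hint.comp_add_left x).mul_bdd (c := 1) (continuous_character k).aestronglyMeasurable
        (ae_of_all _ fun y => (norm_character k y).le)
  rw [meanOp, multOp_apply]
  have h5 : ∀ k : Fin d → ℤ, ∀ a : ℂ, (a • characterLp p (-k) : Lp ℂ p volume) =ᵐ[volume]
      fun x : Torus d => a * character (-k) x := by
    intro k a
    filter_upwards [Lp.coeFn_smul a (characterLp p (-k)), coeFn_characterLp p (-k)] with x h h'
    rw [h, Pi.smul_apply, h', smul_eq_mul]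
  have h6 := (eventually_countable_forall (ι := Fin d → ℤ)).2 fun k =>
    h5 k ((((2 * Real.pi) ^ d : ℝ) : ℂ)⁻¹ * (weight β δ n k : ℂ) * pairing p k (hf.toLp _))
  filter_upwards [h6, Lp.coeFn_finsetSum (cube d n) fun k => ((((2 * Real.pi) ^ d : ℝ) : ℂ)⁻¹ *
    (weight β δ n k : ℂ) * pairing p k (hf.toLp _)) • characterLp p (-k)] with x hx hx'
  rw [h1, hx', Finset.sum_apply]
  exact Finset.sum_congr rfl fun k _ => (hx k).symm

end Lp

end BochnerRiesz

end

noncomputable section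

namespace BochnerRiesz

variable {d : ℕ}

/-! ### Convergence is equivalent to uniform boundedness of the multipliers -/

/-- The inequality is a closed condition on `g`, so it passes from the span to its closure. Only the
closure is claimed, since for `p = ∞` the span is not dense in `L_∞`. -/
theorem MultBdd.norm_le_of_mem_closure {X ι : Type*} [NormedAddCommGroup X] [NormedSpace ℂ X]
    {e : ι → X} {C : ℝ} {m : ι → ℂ} (h : MultBdd e C m) (S : X →L[ℂ] X)
    (hS : ∀ (s : Finset ι) (c : ι → ℂ), S (∑ k ∈ s, c k • e k) = ∑ k ∈ s, (m k * c k) • e k)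
    {g : X} (hg : g ∈ (Submodule.span ℂ (Set.range e)).topologicalClosure) :
    ‖S g‖ ≤ C * ‖g‖ := by
  have hclosed : IsClosed {g : X | ‖S g‖ ≤ C * ‖g‖} :=
    isClosed_le (by fun_prop) (by fun_prop)
  refine closure_minimal ?_ hclosed hg
  intro x hx
  obtain ⟨s, c, rfl⟩ := exists_finset_sum_of_mem_span hx
  rw [Set.mem_ofPred_eq, hS]
  exact h s c

theorem tendsto_of_norm_le_of_tendsto_dense {X : Type*} [NormedAddCommGroup X] [NormedSpace ℂ X]
    {S : ℕ → X →L[ℂ] X} {C : ℝ} {D : Submodule ℂ X}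
    (hS : ∀ n, 1 ≤ n → ∀ g ∈ D.topologicalClosure, ‖S n g‖ ≤ C * ‖g‖)
    (hD : ∀ g ∈ D, Tendsto (fun n => S n g) atTop (𝓝 g)) {g : X}
    (hg : g ∈ D.topologicalClosure) : Tendsto (fun n => S n g) atTop (𝓝 g) := by
  rw [Metric.tendsto_atTop]
  intro ε hε
  -- Three-term estimate: `S n (g - T)` contributes `|C|` units and `S n T - T` and `g - T` one unit
  -- each. The absolute value is there because `C` carries no sign.
  have hC : 0 < |C| + 3 := by positivity
  obtain ⟨T, hT, hgT⟩ := Metric.mem_closure_iff.1 hg (ε / (|C| + 3)) (by positivity)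
  obtain ⟨N, hN⟩ := Metric.tendsto_atTop.1 (hD T hT) (ε / (|C| + 3)) (by positivity)
  refine ⟨max N 1, fun n hn => ?_⟩
  have hn1 := hN n (le_of_max_le_left hn)
  have hn2 := hS n (le_of_max_le_right hn) (g - T)
    (Submodule.sub_mem _ hg (Submodule.le_topologicalClosure _ hT))
  rw [dist_eq_norm] at *
  have h3 : S n g - g = S n (g - T) + (S n T - T) - (g - T) := by rw [map_sub]; abel
  have h4 : C * ‖g - T‖ ≤ |C| * ‖g - T‖ := by gcongr; exact le_abs_self C
  have h5 : |C| * ‖g - T‖ ≤ |C| * (ε / (|C| + 3)) := by gcongr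
  have h6 : (|C| + 3) * (ε / (|C| + 3)) = ε := by field_simp
  have h7 := norm_sub_le (S n (g - T) + (S n T - T)) (g - T)
  have h8 := norm_add_le (S n (g - T)) (S n T - T)
  have h9 : 0 < ε / (|C| + 3) := by positivity
  rw [h3]
  nlinarith

/-- Volume charges every nonempty open set, so an almost everywhere bound on a continuous function
holds everywhere. The isometry makes the continuous functions closed in `L_∞`, which identifies the
elements of `trigClosure ∞ d` as continuous functions. -/
theorem norm_toLp_top (h : C(Torus d, ℂ)) :
    ‖(ContinuousMap.toLp (E := ℂ) ∞ (volume : Measure (Torus d)) ℂ h)‖ = ‖h‖ := by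
  refine le_antisymm ?_ ?_
  · have := (ContinuousMap.toLp (E := ℂ) ∞ (volume : Measure (Torus d)) ℂ).le_opNorm h
    refine this.trans ?_
    have h2 := ContinuousMap.toLp_norm_le (p := ∞) (μ := (volume : Measure (Torus d))) (E := ℂ)
      (𝕜 := ℂ)
    refine (mul_le_mul_of_nonneg_right h2 (norm_nonneg _)).trans ?_
    simp
  · rw [ContinuousMap.norm_le _ (norm_nonneg _)]
    set M := ‖(ContinuousMap.toLp (E := ℂ) ∞ (volume : Measure (Torus d)) ℂ h)‖ with hM
    have h1 : ∀ᵐ x ∂(volume : Measure (Torus d)), ‖h x‖ ≤ M := by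
      have h3 := ae_le_eLpNormEssSup (f := ContinuousMap.toLp (E := ℂ) ∞
        (volume : Measure (Torus d)) ℂ h) (μ := volume)
      filter_upwards [h3, ContinuousMap.coeFn_toLp (p := ∞) (𝕜 := ℂ)
        (volume : Measure (Torus d)) h] with x hx hx'
      rw [hM, Lp.norm_def, eLpNorm_exponent_top]
      rw [hx'] at hx
      have h4 : eLpNormEssSup (ContinuousMap.toLp (E := ℂ) ∞
          (volume : Measure (Torus d)) ℂ h) volume ≠ ∞ := by
        have := (Lp.memLp (ContinuousMap.toLp (E := ℂ) ∞ (volume : Measure (Torus d)) ℂ h)).2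
        rw [eLpNorm_exponent_top] at this
        exact this.ne
      have := ENNReal.toReal_mono h4 hx
      simpa using this
    have h5 : (fun x => max (‖h x‖ - M) 0) =ᵐ[(volume : Measure (Torus d))] fun _ => (0 : ℝ) := by
      filter_upwards [h1] with x hx
      exact max_eq_right (by linarith)
    have h6 := (Continuous.ae_eq_iff_eq (volume : Measure (Torus d)) (by fun_prop)
      (by fun_prop)).1 h5
    intro x
    have := congrFun h6 x
    have h7 := le_max_left (‖h x‖ - M) 0
    linarith

section

variable (p : ℝ≥0∞) [hp : Fact (1 ≤ p)]

/-- The closed span of the characters in `L_p`. -/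
def trigClosure (d : ℕ) : Submodule ℂ (Lp ℂ p (volume : Measure (Torus d))) :=
  (Submodule.span ℂ (Set.range (characterLp p))).topologicalClosure

theorem map_span_characterMap :
    (Submodule.span ℂ (Set.range (characterMap (d := d)))).map
      (ContinuousMap.toLp (E := ℂ) p (volume : Measure (Torus d)) ℂ).toLinearMap =
      Submodule.span ℂ (Set.range (characterLp p)) := by
  rw [Submodule.map_span, ← Set.range_comp]
  rfl

theorem toLp_mem_trigClosure (h : C(Torus d, ℂ)) :
    ContinuousMap.toLp (E := ℂ) p (volume : Measure (Torus d)) ℂ h ∈ trigClosure p d := by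
  have h1 : h ∈ (Submodule.span ℂ (Set.range (characterMap (d := d)))).topologicalClosure := by
    rw [span_characterMap_closure_eq_top]; trivial
  have h2 := image_closure_subset_closure_image
    (ContinuousMap.toLp (E := ℂ) p (volume : Measure (Torus d)) ℂ).continuous
    (Set.mem_image_of_mem _ h1)
  unfold trigClosure
  rw [← map_span_characterMap]
  exact h2

theorem trigClosure_eq_top (h : p ≠ ∞) : trigClosure p d = ⊤ := by
  have := (ContinuousMap.toLp_denseRange ℂ (volume : Measure (Torus d)) ℂ
    h).topologicalClosure_map_submodule span_characterMap_closure_eq_top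
  unfold trigClosure
  rw [← map_span_characterMap]
  exact this

theorem memLp_ofReal_of_inLp {f : Torus d → ℝ} (hf : InLp p f) :
    MemLp (fun x => (f x : ℂ)) p volume := by
  unfold InLp at hf
  split_ifs at hf with h
  · exact ContinuousMap.memLp volume ℂ (⟨fun x => (f x : ℂ), by fun_prop⟩ : C(Torus d, ℂ))
  · exact hf.ofReal

theorem toLp_mem_of_inLp {f : Torus d → ℝ} (hf : InLp p f) :
    (memLp_ofReal_of_inLp p hf).toLp _ ∈ trigClosure p d := by
  by_cases h : p = ∞
  · have hc : Continuous f := by simpa [InLp, h] using hf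
    have := toLp_mem_trigClosure p (⟨fun x => (f x : ℂ), by fun_prop⟩ : C(Torus d, ℂ))
    convert this using 1
    refine Lp.ext ?_
    refine (MemLp.coeFn_toLp _).trans (ContinuousMap.coeFn_toLp (p := p) (𝕜 := ℂ)
        (volume : Measure (Torus d)) (⟨fun x => (f x : ℂ), by fun_prop⟩ : C(Torus d, ℂ))).symm
  · rw [trigClosure_eq_top p h]
    trivial

/-- `ConvergesInLp` speaks of real functions only, while uniform boundedness is used on a complex
Banach space; real and imaginary parts connect the two. -/
theorem exists_inLp_of_mem {g : Lp ℂ p (volume : Measure (Torus d))} (hg : g ∈ trigClosure p d) :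
    ∃ f₁ f₂ : Torus d → ℝ, ∃ (h₁ : InLp p f₁) (h₂ : InLp p f₂),
      g = (memLp_ofReal_of_inLp p h₁).toLp _ +
        Complex.I • (memLp_ofReal_of_inLp p h₂).toLp _ := by
  suffices h : ∃ f : Torus d → ℂ, f =ᵐ[volume] g ∧ InLp p (fun x => (f x).re) ∧
      InLp p (fun x => (f x).im) by
    obtain ⟨f, hfg, h₁, h₂⟩ := h
    refine ⟨_, _, h₁, h₂, Lp.ext ?_⟩
    filter_upwards [hfg, (memLp_ofReal_of_inLp p h₁).coeFn_toLp,
      (memLp_ofReal_of_inLp p h₂).coeFn_toLp, Lp.coeFn_add ((memLp_ofReal_of_inLp p h₁).toLp _)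
        (Complex.I • (memLp_ofReal_of_inLp p h₂).toLp _),
      Lp.coeFn_smul Complex.I ((memLp_ofReal_of_inLp p h₂).toLp _)] with x h1 h2 h3 h4 h5
    rw [h4, Pi.add_apply, h5, Pi.smul_apply, h2, h3, ← h1, smul_eq_mul, mul_comm]
    exact (Complex.re_add_im _).symm
  by_cases h : p = ∞
  · subst h
    have hiso : Isometry (ContinuousMap.toLp (E := ℂ) ∞ (volume : Measure (Torus d)) ℂ) :=
      AddMonoidHomClass.isometry_of_norm _ norm_toLp_top
    have hcl : IsClosed (Set.range
        (ContinuousMap.toLp (E := ℂ) ∞ (volume : Measure (Torus d)) ℂ)) :=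
      hiso.isClosedEmbedding.isClosed_range
    have hsub : (trigClosure ∞ d : Set (Lp ℂ ∞ (volume : Measure (Torus d)))) ⊆ Set.range
        (ContinuousMap.toLp (E := ℂ) ∞ (volume : Measure (Torus d)) ℂ) := by
      refine closure_minimal ?_ hcl
      rw [← map_span_characterMap]
      rintro _ ⟨x, _, rfl⟩
      exact ⟨x, rfl⟩
    obtain ⟨f, rfl⟩ := hsub hg
    refine ⟨f, (ContinuousMap.coeFn_toLp _ f).symm, ?_, ?_⟩
    · simp only [InLp, if_true]; fun_prop
    · simp only [InLp, if_true]; fun_prop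
  · refine ⟨g, ae_eq_refl _, ?_, ?_⟩
    · simpa only [InLp, if_neg h] using! (Lp.memLp g).re
    · simpa only [InLp, if_neg h] using! (Lp.memLp g).im

theorem tendsto_eLpNorm_iff {β δ : ℝ} (hβ : 0 < β) (hδ : 0 < δ) {f : Torus d → ℝ}
    (hf : MemLp (fun x => (f x : ℂ)) p volume) :
    Tendsto (fun n => eLpNorm (fun x => (f x : ℂ) - mean d β δ n f x) p volume) atTop (𝓝 0) ↔
      Tendsto (fun n => meanOp p d β δ n (hf.toLp _)) atTop (𝓝 (hf.toLp _)) := by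
  rw [tendsto_iff_edist_tendsto_0]
  refine tendsto_congr' ?_
  -- The index `n = 0` is discarded: division by `0 ^ β = 0` makes every weight equal to `1` there.
  filter_upwards [eventually_ge_atTop 1] with n hn
  rw [edist_comm, Lp.edist_def]
  refine eLpNorm_congr_ae ?_
  filter_upwards [mean_ae_eq p hβ hδ hn hf, hf.coeFn_toLp] with x h1 h2
  simp [h1, h2]

/-- The means converge in `L_p` iff their multipliers are uniformly bounded. -/
theorem convergesInLp_iff {β δ : ℝ} (hβ : 0 < β) (hδ : 0 < δ) :
    ConvergesInLp p (mean d β δ) ↔ ∃ C, ∀ n, 1 ≤ n →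
      MultBdd (characterLp p (d := d)) C (fun k => (weight β δ n k : ℂ)) := by
  constructor
  · intro h
    -- Banach–Steinhaus needs a complete space on which the means converge pointwise; for `p = ∞`
    -- this is not all of `L_∞`.
    let E := trigClosure p d
    have hE : IsClosed (E : Set (Lp ℂ p (volume : Measure (Torus d)))) :=
      Submodule.isClosed_topologicalClosure _
    have : CompleteSpace E := hE.completeSpace_coe
    have hconv : ∀ g ∈ E, Tendsto (fun n => meanOp p d β δ n g) atTop (𝓝 g) := by
      intro g hg
      obtain ⟨f₁, f₂, h₁, h₂, rfl⟩ := exists_inLp_of_mem p hg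
      simp only [map_add, map_smul]
      exact ((tendsto_eLpNorm_iff p hβ hδ _).1 (h f₁ h₁)).add
        (((tendsto_eLpNorm_iff p hβ hδ _).1 (h f₂ h₂)).const_smul _)
    obtain ⟨C, hC⟩ := banach_steinhaus (g := fun n => (meanOp p d β δ n).comp E.subtypeL) (by
      intro x
      obtain ⟨C, hC⟩ := (hconv x x.2).norm.bddAbove_range
      exact ⟨C, fun n => hC ⟨n, rfl⟩⟩)
    refine ⟨C, fun n hn s c => ?_⟩
    rw [← meanOp_sum p hβ hδ hn]
    have hmem : ∑ k ∈ s, c k • characterLp p k ∈ E :=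
      Submodule.le_topologicalClosure _ (Submodule.sum_mem _ fun k _ =>
        Submodule.smul_mem _ _ (Submodule.subset_span ⟨k, rfl⟩))
    have := ((meanOp p d β δ n).comp E.subtypeL).le_opNorm ⟨_, hmem⟩
    refine this.trans ?_
    exact mul_le_mul_of_nonneg_right (hC n) (norm_nonneg _)
  · rintro ⟨C, hC⟩ f hf
    refine (tendsto_eLpNorm_iff p hβ hδ (memLp_ofReal_of_inLp p hf)).2 ?_
    refine tendsto_of_norm_le_of_tendsto_dense (C := C)
      (D := Submodule.span ℂ (Set.range (characterLp p))) ?_ ?_ (toLp_mem_of_inLp p hf)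
    · intro n hn g hg
      exact (hC n hn).norm_le_of_mem_closure _ (meanOp_sum p hβ hδ hn) hg
    · intro g hg
      obtain ⟨s, c, rfl⟩ := exists_finset_sum_of_mem_span hg
      have h1 : Tendsto (fun n => ∑ k ∈ s, ((weight β δ n k : ℂ) * c k) • characterLp p k) atTop
          (𝓝 (∑ k ∈ s, c k • characterLp p k)) := by
        refine tendsto_finsetSum _ fun k _ => ?_
        have h2 : Tendsto (fun n => (weight β δ n k : ℂ)) atTop (𝓝 1) := by
          exact_mod_cast (Complex.continuous_ofReal.tendsto _).comp (tendsto_weight (δ := δ) hβ k)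
        simpa using (h2.mul_const (c k)).smul_const (characterLp p k)
      refine h1.congr' ?_
      filter_upwards [eventually_ge_atTop 1] with n hn
      rw [meanOp_sum p hβ hδ hn]

/-! ### Norms of trigonometric polynomials under translation -/

theorem eLpNorm_comp_add_right (p : ℝ≥0∞) (f : Torus d → ℂ) (hf : AEStronglyMeasurable f volume)
    (y : Torus d) : eLpNorm (fun x => f (x + y)) p volume = eLpNorm f p volume :=
  eLpNorm_comp_measurePreserving (g := f) hf (measurePreserving_add_right volume y)

theorem toLp_sum (s : Finset (Fin d → ℤ)) (c : (Fin d → ℤ) → ℂ) :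
    ∑ k ∈ s, c k • characterLp p k = ContinuousMap.toLp (E := ℂ) p (volume : Measure (Torus d)) ℂ
      (∑ k ∈ s, c k • characterMap k) := by
  simp [characterLp]

theorem norm_sum_characterLp (s : Finset (Fin d → ℤ)) (c : (Fin d → ℤ) → ℂ) :
    ‖∑ k ∈ s, c k • characterLp p k‖ =
      (eLpNorm (fun x : Torus d => ∑ k ∈ s, c k * character k x) p volume).toReal := by
  rw [toLp_sum, Lp.norm_def]
  congr 1
  refine eLpNorm_congr_ae ((ContinuousMap.coeFn_toLp _ _).trans (ae_of_all _ fun x => ?_))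
  simp

/-- The `L_p` norm of trigonometric polynomials is invariant under translations. -/
theorem norm_translate (y : Torus d) (s : Finset (Fin d → ℤ)) (c : (Fin d → ℤ) → ℂ) :
    ‖∑ k ∈ s, (character k y * c k) • characterLp p k‖ = ‖∑ k ∈ s, c k • characterLp p k‖ := by
  rw [norm_sum_characterLp, norm_sum_characterLp,
    ← eLpNorm_comp_add_right p (fun x : Torus d => ∑ k ∈ s, c k * character k x) _ y]
  · congr 2
    ext x
    refine Finset.sum_congr rfl fun k _ => ?_
    rw [character_add_right]
    ring
  · refine Continuous.aestronglyMeasurable ?_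
    exact continuous_finsetSum _ fun k _ => continuous_const.mul (continuous_character k)

end

end BochnerRiesz

end

noncomputable section

namespace BochnerRiesz

/-! ### A Bessel-type function on the half line -/

theorem hasDerivAt_integral_mul_cos {φ : ℝ → ℝ} (hφ : Continuous φ) (r : ℝ) :
    HasDerivAt (fun r => ∫ u in (-1 : ℝ)..1, φ u * Real.cos (r * u))
      (∫ u in (-1 : ℝ)..1, -(φ u * u) * Real.sin (r * u)) r := by
  refine (intervalIntegral.hasDerivAt_integral_of_dominated_loc_of_deriv_le
    (F := fun r u => φ u * Real.cos (r * u)) (F' := fun r u => -(φ u * u) * Real.sin (r * u))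
    (bound := fun u => |φ u * u|) (s := Set.univ) Filter.univ_mem
    (.of_forall fun x => (by fun_prop : Continuous _).aestronglyMeasurable)
    ((by fun_prop : Continuous _).intervalIntegrable _ _)
    (by fun_prop : Continuous _).aestronglyMeasurable ?_
    ((by fun_prop : Continuous _).intervalIntegrable _ _) ?_).2
  · refine ae_of_all _ fun u _ x _ => ?_
    rw [norm_mul, norm_neg, Real.norm_eq_abs, Real.norm_eq_abs]
    exact mul_le_of_le_one_right (abs_nonneg _) (Real.abs_sin_le_one _)
  · refine ae_of_all _ fun u _ x _ => ?_
    have h : HasDerivAt (fun x : ℝ => x * u) u x := by simpa using (hasDerivAt_id x).mul_const u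
    exact (h.cos.const_mul (φ u)).congr_deriv (by ring)

theorem hasDerivAt_integral_mul_sin {φ : ℝ → ℝ} (hφ : Continuous φ) (r : ℝ) :
    HasDerivAt (fun r => ∫ u in (-1 : ℝ)..1, φ u * Real.sin (r * u))
      (∫ u in (-1 : ℝ)..1, (φ u * u) * Real.cos (r * u)) r := by
  refine (intervalIntegral.hasDerivAt_integral_of_dominated_loc_of_deriv_le
    (F := fun r u => φ u * Real.sin (r * u)) (F' := fun r u => (φ u * u) * Real.cos (r * u))
    (bound := fun u => |φ u * u|) (s := Set.univ) Filter.univ_mem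
    (.of_forall fun x => (by fun_prop : Continuous _).aestronglyMeasurable)
    ((by fun_prop : Continuous _).intervalIntegrable _ _)
    (by fun_prop : Continuous _).aestronglyMeasurable ?_
    ((by fun_prop : Continuous _).intervalIntegrable _ _) ?_).2
  · refine ae_of_all _ fun u _ x _ => ?_
    rw [norm_mul, Real.norm_eq_abs, Real.norm_eq_abs]
    exact mul_le_of_le_one_right (abs_nonneg _) (Real.abs_cos_le_one _)
  · refine ae_of_all _ fun u _ x _ => ?_
    have h : HasDerivAt (fun x : ℝ => x * u) u x := by simpa using (hasDerivAt_id x).mul_const u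
    exact (h.sin.const_mul (φ u)).congr_deriv (by ring)

/-- `∫_{-1}^1 (1 - u²)^ν cos(ru) du`, a multiple of `r^{-ν-1/2} J_{ν+1/2}(r)`. -/
def bessel (ν r : ℝ) : ℝ := ∫ u in (-1 : ℝ)..1, (1 - u ^ 2) ^ ν * Real.cos (r * u)

/-- The derivative of `bessel`. -/
def besselDeriv (ν r : ℝ) : ℝ := ∫ u in (-1 : ℝ)..1, -((1 - u ^ 2) ^ ν * u) * Real.sin (r * u)

theorem continuous_one_sub_sq_rpow {ν : ℝ} (hν : 0 ≤ ν) :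
    Continuous fun u : ℝ => (1 - u ^ 2) ^ ν :=
  (by fun_prop : Continuous fun u : ℝ => 1 - u ^ 2).rpow_const fun _ => Or.inr hν

theorem hasDerivAt_bessel {ν : ℝ} (hν : 0 ≤ ν) (r : ℝ) :
    HasDerivAt (bessel ν) (besselDeriv ν r) r :=
  hasDerivAt_integral_mul_cos (continuous_one_sub_sq_rpow hν) r

theorem continuous_bessel {ν : ℝ} (hν : 0 ≤ ν) : Continuous (bessel ν) :=
  continuous_iff_continuousAt.2 fun r => (hasDerivAt_bessel hν r).continuousAt

/-- Bessel's equation. It comes from integrating the `u`-derivative of `(1 - u²)^(ν+1) sin(ru)` over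
`[-1, 1]`, where the boundary terms vanish, and from writing `(1 - u²)^(ν+1)` as `(1 - u²)^ν - u² (1
- u²)^ν`. -/
theorem hasDerivAt_besselDeriv {ν : ℝ} (hν : 0 ≤ ν) {r : ℝ} (hr : 0 < r) :
    HasDerivAt (besselDeriv ν) (-bessel ν r - 2 * (ν + 1) / r * besselDeriv ν r) r := by
  have hc := continuous_one_sub_sq_rpow hν
  have h1 := hasDerivAt_integral_mul_sin (φ := fun u => -((1 - u ^ 2) ^ ν * u)) (by fun_prop) r
  convert! h1 using 1
  have h2 : ∀ u : ℝ, HasDerivAt (fun u : ℝ => (1 - u ^ 2) ^ (ν + 1) * Real.sin (r * u))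
      (2 * (ν + 1) * (-((1 - u ^ 2) ^ ν * u) * Real.sin (r * u)) +
        r * ((1 - u ^ 2) ^ (ν + 1) * Real.cos (r * u))) u := by
    intro u
    have h3 : HasDerivAt (fun u : ℝ => 1 - u ^ 2) (-(2 * u)) u := by
      simpa using (hasDerivAt_pow 2 u).const_sub 1
    have h4 := h3.rpow_const (p := ν + 1) (Or.inr (by linarith))
    have h5 : HasDerivAt (fun u : ℝ => r * u) r u := by simpa using (hasDerivAt_id u).const_mul r
    convert! h4.mul h5.sin using 1
    rw [add_sub_cancel_right]
    ring
  have hc' := continuous_one_sub_sq_rpow (ν := ν + 1) (by linarith)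
  have h6 := intervalIntegral.integral_eq_sub_of_hasDerivAt (a := -1) (b := 1) (fun u _ => h2 u)
    ((by fun_prop : Continuous _).intervalIntegrable _ _)
  have h7 : (0 : ℝ) ^ (ν + 1) = 0 := Real.zero_rpow (by linarith)
  beta_reduce at h6
  rw [show (1 : ℝ) - (-1) ^ 2 = 0 by norm_num, show (1 : ℝ) - 1 ^ 2 = 0 by norm_num, h7, zero_mul,
    zero_mul, sub_zero] at h6
  rw [intervalIntegral.integral_add ((by fun_prop : Continuous _).intervalIntegrable _ _)
    ((by fun_prop : Continuous _).intervalIntegrable _ _)] at h6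
  have h8 : ∫ u in (-1 : ℝ)..1, r * ((1 - u ^ 2) ^ (ν + 1) * Real.cos (r * u)) =
      r * (bessel ν r + ∫ u in (-1 : ℝ)..1, -((1 - u ^ 2) ^ ν * u) * u * Real.cos (r * u)) := by
    rw [intervalIntegral.integral_const_mul, bessel, ← intervalIntegral.integral_add
      ((by fun_prop : Continuous _).intervalIntegrable _ _)
      ((by fun_prop : Continuous _).intervalIntegrable _ _)]
    congr 1
    refine intervalIntegral.integral_congr fun u hu => ?_
    rw [Set.uIcc_of_le (by norm_num)] at hu
    have : 0 ≤ 1 - u ^ 2 := by nlinarith [hu.1, hu.2]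
    rw [Real.rpow_add_one' this (by linarith)]
    ring
  have h9 : ∫ u in (-1 : ℝ)..1, 2 * (ν + 1) * (-((1 - u ^ 2) ^ ν * u) * Real.sin (r * u)) =
      2 * (ν + 1) * besselDeriv ν r := by
    rw [intervalIntegral.integral_const_mul]; rfl
  rw [h8, h9] at h6
  generalize ∫ u in (-1 : ℝ)..1, -((1 - u ^ 2) ^ ν * u) * u * Real.cos (r * u) = D at h6 ⊢
  field_simp
  linarith

theorem abs_bessel_le {ν : ℝ} (hν : 0 ≤ ν) (r : ℝ) : |bessel ν r| ≤ 2 := by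
  have := intervalIntegral.norm_integral_le_of_norm_le_const (a := -1) (b := 1) (C := 1)
    (f := fun u : ℝ => (1 - u ^ 2) ^ ν * Real.cos (r * u)) (by
    intro u hu
    rw [Set.uIoc_of_le (by norm_num)] at hu
    have h0 : 0 ≤ 1 - u ^ 2 := by nlinarith [hu.1, hu.2]
    rw [norm_mul, Real.norm_of_nonneg (Real.rpow_nonneg h0 _)]
    exact mul_le_one₀ (Real.rpow_le_one h0 (by nlinarith) hν) (norm_nonneg _)
      (Real.abs_cos_le_one _))
  norm_num at this
  exact this

/-- Since `1 < π/2`, the cosine is positive on the whole range of integration. This makes the energy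
at `r = 1` nonzero. -/
theorem bessel_one_pos {ν : ℝ} (hν : 0 ≤ ν) : 0 < bessel ν 1 := by
  have hc := continuous_one_sub_sq_rpow hν
  refine intervalIntegral.intervalIntegral_pos_of_pos_on
    ((by fun_prop : Continuous _).intervalIntegrable _ _) (fun u hu => ?_) (by norm_num)
  refine mul_pos (Real.rpow_pos_of_pos (by nlinarith [hu.1, hu.2]) _) (Real.cos_pos_of_mem_Ioo ?_)
  have := Real.pi_gt_three
  constructor <;> linarith [hu.1, hu.2]

/-! ### Energy estimates for `w'' = (c / r² - 1) w` -/

section Energy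

variable {w w' : ℝ → ℝ} {c : ℝ}

theorem hasDerivAt_energy (hw : ∀ r, 1 ≤ r → HasDerivAt w (w' r) r)
    (hw' : ∀ r, 1 ≤ r → HasDerivAt w' ((c / r ^ 2 - 1) * w r) r) {r : ℝ} (hr : 1 ≤ r) :
    HasDerivAt (fun r => w r ^ 2 + w' r ^ 2) (2 * (c / r ^ 2) * (w r * w' r)) r := by
  convert! ((hw r hr).pow 2).add ((hw' r hr).pow 2) using 1
  ring

theorem hasDerivAt_exp_div {r : ℝ} (hr : 1 ≤ r) (c : ℝ) :
    HasDerivAt (fun r => Real.exp (c / r)) (Real.exp (c / r) * (-c / r ^ 2)) r := by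
  have h := ((hasDerivAt_inv (by linarith : r ≠ 0)).const_mul c).exp
  simp only [← div_eq_mul_inv] at h
  convert! h using 2
  ring

/-- Grönwall with `2 |w w'| ≤ w² + w'²`: the logarithmic derivative of the energy is at most `c /
r²`, whose integral over `[1, ∞)` is `c`. The integrating factor is `exp (c / r)`. -/
theorem energy_le (hc : 0 ≤ c) (hw : ∀ r, 1 ≤ r → HasDerivAt w (w' r) r)
    (hw' : ∀ r, 1 ≤ r → HasDerivAt w' ((c / r ^ 2 - 1) * w r) r) {r : ℝ} (hr : 1 ≤ r) :
    w r ^ 2 + w' r ^ 2 ≤ (w 1 ^ 2 + w' 1 ^ 2) * Real.exp c := by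
  have hd : ∀ r, 1 ≤ r → HasDerivAt (fun r => (w r ^ 2 + w' r ^ 2) * Real.exp (c / r)) _ r :=
    fun r hr => (hasDerivAt_energy hw hw' hr).mul (hasDerivAt_exp_div hr c)
  have hanti : AntitoneOn (fun r => (w r ^ 2 + w' r ^ 2) * Real.exp (c / r)) (Set.Ici 1) := by
    refine antitoneOn_of_deriv_nonpos (convex_Ici 1)
      (fun r hr => (hd r hr).continuousAt.continuousWithinAt)
      (fun r hr => (hd r (interior_subset hr)).differentiableAt.differentiableWithinAt)
      fun r hr => ?_
    rw [(hd r (interior_subset hr)).deriv]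
    have h1 : 0 ≤ c / r ^ 2 := by positivity
    have h2 : 0 ≤ (c / r ^ 2) * (w r - w' r) ^ 2 * Real.exp (c / r) := by positivity
    rw [neg_div]
    nlinarith
  have := hanti (Set.mem_Ici.2 le_rfl) (Set.mem_Ici.2 hr) hr
  simp only [div_one] at this
  refine le_trans ?_ this
  refine le_mul_of_one_le_right (by positivity) (Real.one_le_exp (by positivity))

/-- The same argument with the opposite integrating factor: the energy cannot decay to zero. -/
theorem le_energy (hc : 0 ≤ c) (hw : ∀ r, 1 ≤ r → HasDerivAt w (w' r) r)
    (hw' : ∀ r, 1 ≤ r → HasDerivAt w' ((c / r ^ 2 - 1) * w r) r) {r : ℝ} (hr : 1 ≤ r) :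
    (w 1 ^ 2 + w' 1 ^ 2) * Real.exp (-c) ≤ w r ^ 2 + w' r ^ 2 := by
  have hd : ∀ r, 1 ≤ r → HasDerivAt (fun r => (w r ^ 2 + w' r ^ 2) * Real.exp (-c / r)) _ r :=
    fun r hr => (hasDerivAt_energy hw hw' hr).mul (hasDerivAt_exp_div hr (-c))
  have hmono : MonotoneOn (fun r => (w r ^ 2 + w' r ^ 2) * Real.exp (-c / r)) (Set.Ici 1) := by
    refine monotoneOn_of_deriv_nonneg (convex_Ici 1)
      (fun r hr => (hd r hr).continuousAt.continuousWithinAt)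
      (fun r hr => (hd r (interior_subset hr)).differentiableAt.differentiableWithinAt)
      fun r hr => ?_
    rw [(hd r (interior_subset hr)).deriv]
    have h1 : 0 ≤ c / r ^ 2 := by positivity
    have h2 : 0 ≤ (c / r ^ 2) * (w r + w' r) ^ 2 * Real.exp (-c / r) := by positivity
    rw [neg_neg]
    nlinarith
  have := hmono (Set.mem_Ici.2 le_rfl) (Set.mem_Ici.2 hr) hr
  simp only [div_one] at this
  refine this.trans ?_
  refine mul_le_of_le_one_right (by positivity) (Real.exp_le_one_iff.2 ?_)
  rw [neg_div]
  have : 0 ≤ c / r := by positivity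
  linarith

/-- Equipartition of energy: up to integrable terms `(w'² - w²) / r` is the derivative of `w w' /
r`, so its integral stays bounded. Hence `w²` carries half of the total `∫ (w² + w'²) / r ≥ a log
A`. -/
theorem log_le_integral_sq_div {a b : ℝ} (hc : 0 ≤ c) (hw : ∀ r, 1 ≤ r → HasDerivAt w (w' r) r)
    (hw' : ∀ r, 1 ≤ r → HasDerivAt w' ((c / r ^ 2 - 1) * w r) r)
    (ha : ∀ r, 1 ≤ r → a ≤ w r ^ 2 + w' r ^ 2) (hb : ∀ r, 1 ≤ r → w r ^ 2 + w' r ^ 2 ≤ b)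
    {A : ℝ} (hA : 1 ≤ A) :
    a / 2 * Real.log A - b ≤ ∫ r in (1 : ℝ)..A, w r ^ 2 / r := by
  have hcw : ContinuousOn w (Set.uIcc 1 A) := fun r hr => by
    rw [Set.uIcc_of_le hA] at hr
    exact (hw r hr.1).continuousAt.continuousWithinAt
  have hcw' : ContinuousOn w' (Set.uIcc 1 A) := fun r hr => by
    rw [Set.uIcc_of_le hA] at hr
    exact (hw' r hr.1).continuousAt.continuousWithinAt
  have hne : ∀ r ∈ Set.uIcc 1 A, r ≠ 0 := fun r hr => by
    rw [Set.uIcc_of_le hA] at hr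
    linarith [hr.1]
  have hne2 : ∀ r ∈ Set.uIcc 1 A, r ^ 2 ≠ 0 := fun r hr => pow_ne_zero 2 (hne r hr)
  -- the function whose derivative dominates `a / r - 2 w² / r`
  have hder : ∀ r ∈ Set.uIcc 1 A, HasDerivAt (fun r => w r * w' r / r - b * r⁻¹)
      ((w' r ^ 2 - w r ^ 2 + c / r ^ 2 * w r ^ 2) / r - w r * w' r / r ^ 2 + b / r ^ 2) r := by
    intro r hr
    have h0 := hne r hr
    rw [Set.uIcc_of_le hA] at hr
    have h1 := (((hw r hr.1).mul (hw' r hr.1)).div (hasDerivAt_id r) h0).sub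
      ((hasDerivAt_inv h0).const_mul b)
    convert! h1 using 1
    simp only [id, Pi.mul_apply]
    field_simp
    ring
  have hi1 : IntervalIntegrable (fun r => (w' r ^ 2 - w r ^ 2 + c / r ^ 2 * w r ^ 2) / r -
      w r * w' r / r ^ 2 + b / r ^ 2) volume 1 A := by
    refine ContinuousOn.intervalIntegrable ?_
    fun_prop (disch := assumption)
  have hi2 : IntervalIntegrable (fun r => w r ^ 2 / r) volume 1 A := by
    refine ContinuousOn.intervalIntegrable ?_
    fun_prop (disch := assumption)
  have hi3 : IntervalIntegrable (fun r : ℝ => a * r⁻¹) volume 1 A := by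
    refine ContinuousOn.intervalIntegrable ?_
    fun_prop (disch := assumption)
  have h2 := intervalIntegral.integral_eq_sub_of_hasDerivAt hder hi1
  have h3 : ∫ r in (1 : ℝ)..A, a * r⁻¹ ≤ ∫ r in (1 : ℝ)..A,
      (((w' r ^ 2 - w r ^ 2 + c / r ^ 2 * w r ^ 2) / r - w r * w' r / r ^ 2 + b / r ^ 2) +
        2 * (w r ^ 2 / r)) := by
    refine intervalIntegral.integral_mono_on hA hi3 (hi1.add (hi2.const_mul 2)) fun r hr => ?_
    have hr0 : 0 < r := by linarith [hr.1]
    have h4 := ha r hr.1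
    have h5 := hb r hr.1
    have h6 : a * r⁻¹ ≤ (w r ^ 2 + w' r ^ 2) * r⁻¹ := by gcongr
    have h7 : 0 ≤ c / r ^ 2 * w r ^ 2 / r := by positivity
    have h8 : 0 ≤ (b - w r * w' r) / r ^ 2 := by
      refine div_nonneg ?_ (by positivity)
      nlinarith [sq_nonneg (w r - w' r), sq_nonneg (w r), sq_nonneg (w' r)]
    have h9 : ((w' r ^ 2 - w r ^ 2 + c / r ^ 2 * w r ^ 2) / r - w r * w' r / r ^ 2 + b / r ^ 2) +
        2 * (w r ^ 2 / r) = (w r ^ 2 + w' r ^ 2) * r⁻¹ + c / r ^ 2 * w r ^ 2 / r +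
          (b - w r * w' r) / r ^ 2 := by
      field_simp
      ring
    rw [h9]
    linarith
  rw [intervalIntegral.integral_add hi1 (hi2.const_mul 2), h2, intervalIntegral.integral_const_mul,
    intervalIntegral.integral_const_mul, integral_inv_of_pos one_pos (by linarith), div_one] at h3
  have hA0 : 0 < A := by linarith
  have h10 : w A * w' A / A ≤ b / 2 := by
    rw [div_le_iff₀ hA0]
    have := hb A hA
    have hb0 : 0 ≤ b := le_trans (by positivity) this
    nlinarith [sq_nonneg (w A - w' A), mul_nonneg hb0 (sub_nonneg.2 hA)]
  have h11 : -(w 1 * w' 1) ≤ b / 2 := by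
    have := hb 1 le_rfl
    nlinarith [sq_nonneg (w 1 + w' 1)]
  have h12 : 0 ≤ b * A⁻¹ := by
    have := le_trans (by positivity) (hb A hA)
    positivity
  simp only [div_one, inv_one, mul_one] at h3
  linarith

end Energy

/-! ### Size of the Bessel-type function -/

section

variable {ν : ℝ}

/-- Multiplication by `r ^ (ν + 1)` removes the first-order term of Bessel's equation and leaves
`w'' = (ν (ν + 1) / r² - 1) w`, to which the energy estimates apply. -/
theorem hasDerivAt_rpow_mul_bessel (hν : 0 ≤ ν) {r : ℝ} (hr : 1 ≤ r) :
    HasDerivAt (fun r => r ^ (ν + 1) * bessel ν r)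
      (r ^ (ν + 1) * besselDeriv ν r + (ν + 1) * r ^ ν * bessel ν r) r := by
  have h := (Real.hasDerivAt_rpow_const (p := ν + 1) (Or.inl (by linarith : r ≠ 0))).mul
    (hasDerivAt_bessel hν r)
  convert! h using 1
  rw [add_sub_cancel_right]
  ring

theorem hasDerivAt_rpow_mul_bessel_deriv (hν : 0 ≤ ν) {r : ℝ} (hr : 1 ≤ r) :
    HasDerivAt (fun r => r ^ (ν + 1) * besselDeriv ν r + (ν + 1) * r ^ ν * bessel ν r)
      ((ν * (ν + 1) / r ^ 2 - 1) * (r ^ (ν + 1) * bessel ν r)) r := by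
  have hr0 : 0 < r := by linarith
  have h := ((Real.hasDerivAt_rpow_const (p := ν + 1) (Or.inl hr0.ne')).mul
    (hasDerivAt_besselDeriv hν hr0)).add
    (((Real.hasDerivAt_rpow_const (p := ν) (Or.inl hr0.ne')).const_mul (ν + 1)).mul
      (hasDerivAt_bessel hν r))
  convert! h using 1
  rw [add_sub_cancel_right, Real.rpow_sub_one hr0.ne', Real.rpow_add_one hr0.ne']
  field_simp
  ring

theorem bessel_energy_pos (hν : 0 ≤ ν) :
    0 < ((1 : ℝ) ^ (ν + 1) * bessel ν 1) ^ 2 +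
      ((1 : ℝ) ^ (ν + 1) * besselDeriv ν 1 + (ν + 1) * (1 : ℝ) ^ ν * bessel ν 1) ^ 2 := by
  have := bessel_one_pos hν
  simp only [Real.one_rpow, one_mul]
  positivity

theorem exists_abs_bessel_le (hν : 0 ≤ ν) :
    ∃ C, ∀ r, 1 ≤ r → |r ^ (ν + 1) * bessel ν r| ≤ C := by
  refine ⟨_, fun r hr => Real.abs_le_sqrt (le_trans ?_ (energy_le (by positivity)
    (fun r hr => hasDerivAt_rpow_mul_bessel hν hr)
    (fun r hr => hasDerivAt_rpow_mul_bessel_deriv hν hr) hr))⟩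
  exact le_add_of_nonneg_right (sq_nonneg _)

theorem exists_log_le_integral_bessel (hν : 0 ≤ ν) :
    ∃ a C, 0 < a ∧ ∀ A, 1 ≤ A →
      a * Real.log A - C ≤ ∫ r in (1 : ℝ)..A, (r ^ (ν + 1) * bessel ν r) ^ 2 / r := by
  have hc : 0 ≤ ν * (ν + 1) := by positivity
  refine ⟨_, _, ?_, fun A hA => log_le_integral_sq_div hc
    (fun r hr => hasDerivAt_rpow_mul_bessel hν hr)
    (fun r hr => hasDerivAt_rpow_mul_bessel_deriv hν hr)
    (fun r hr => le_energy hc (fun r hr => hasDerivAt_rpow_mul_bessel hν hr)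
      (fun r hr => hasDerivAt_rpow_mul_bessel_deriv hν hr) hr)
    (fun r hr => energy_le hc (fun r hr => hasDerivAt_rpow_mul_bessel hν hr)
      (fun r hr => hasDerivAt_rpow_mul_bessel_deriv hν hr) hr) hA⟩
  have := bessel_energy_pos hν
  positivity

end

end BochnerRiesz

end

noncomputable section

namespace BochnerRiesz

open scoped RealInnerProductSpace FourierTransform

variable {d : ℕ}

/-! ### The Bochner–Riesz kernel on `ℝ^d` -/

/-- The function `(1 - ∑ xⱼ²)_+^δ` on `ℝ^d`. -/
def ballPow (δ : ℝ) (x : Fin d → ℝ) : ℝ := (max (1 - ∑ j, x j ^ 2) 0) ^ δ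

theorem continuous_ballPow {δ : ℝ} (hδ : 0 < δ) : Continuous (ballPow δ : (Fin d → ℝ) → ℝ) :=
  (by fun_prop : Continuous fun x : Fin d → ℝ => max (1 - ∑ j, x j ^ 2) 0).rpow_const
    fun _ => Or.inr hδ.le

theorem ballPow_nonneg (δ : ℝ) (x : Fin d → ℝ) : 0 ≤ ballPow δ x :=
  Real.rpow_nonneg (le_max_right _ _) _

theorem ballPow_le_one {δ : ℝ} (hδ : 0 < δ) (x : Fin d → ℝ) : ballPow δ x ≤ 1 := by
  refine Real.rpow_le_one (le_max_right _ _) (max_le ?_ zero_le_one) hδ.le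
  have : 0 ≤ ∑ j, x j ^ 2 := Finset.sum_nonneg fun j _ => sq_nonneg _
  linarith

theorem ballPow_eq_zero {δ : ℝ} (hδ : 0 < δ) {x : Fin d → ℝ} (hx : 1 ≤ ∑ j, x j ^ 2) :
    ballPow δ x = 0 := by
  rw [ballPow, max_eq_right (by linarith), Real.zero_rpow hδ.ne']

theorem ballPow_eq_zero_of_one_lt_norm {δ : ℝ} (hδ : 0 < δ) {x : Fin d → ℝ} (hx : 1 < ‖x‖) :
    ballPow δ x = 0 := by
  refine ballPow_eq_zero hδ ?_
  by_contra! h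
  refine hx.not_ge ((pi_norm_le_iff_of_nonneg zero_le_one).2 fun j => ?_)
  have := Finset.single_le_sum (f := fun j => x j ^ 2) (fun i _ => sq_nonneg _) (Finset.mem_univ j)
  rw [Real.norm_eq_abs]
  exact (sq_le_one_iff_abs_le_one _).1 (this.trans h.le)

theorem hasCompactSupport_ballPow {δ : ℝ} (hδ : 0 < δ) :
    HasCompactSupport (ballPow δ : (Fin d → ℝ) → ℝ) :=
  HasCompactSupport.intro (isCompact_closedBall 0 1) fun x hx =>
    ballPow_eq_zero_of_one_lt_norm hδ (by simpa using hx)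

theorem integral_ballPow_pos {δ : ℝ} (hδ : 0 < δ) : 0 < ∫ x : Fin d → ℝ, ballPow δ x := by
  refine (continuous_ballPow hδ).integral_pos_of_hasCompactSupport_nonneg_nonzero
    (hasCompactSupport_ballPow hδ) (ballPow_nonneg δ) (x := 0) ?_
  simp [ballPow]

/-- The integral of `(t - |η|²)_+^δ` over `ℝ^d`. -/
theorem integral_max_sub_rpow {δ : ℝ} (hδ : 0 < δ) (t : ℝ) :
    ∫ x : Fin d → ℝ, (max (t - ∑ j, x j ^ 2) 0) ^ δ =
      (max t 0) ^ (δ + d / 2) * ∫ x : Fin d → ℝ, ballPow δ x := by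
  have hexp : 0 < δ + d / 2 := by positivity
  rcases le_or_gt t 0 with ht | ht
  · rw [max_eq_right ht, Real.zero_rpow hexp.ne', zero_mul]
    refine integral_eq_zero_of_ae (ae_of_all _ fun x => ?_)
    have : 0 ≤ ∑ j, x j ^ 2 := Finset.sum_nonneg fun j _ => sq_nonneg _
    simp only [Pi.zero_apply]
    rw [max_eq_right (by linarith), Real.zero_rpow hδ.ne']
  · have h1 := Measure.integral_comp_smul (volume : Measure (Fin d → ℝ))
      (fun x => (max (t - ∑ j, x j ^ 2) 0) ^ δ) (Real.sqrt t)
    have h2 : ∀ x : Fin d → ℝ, (max (t - ∑ j, (Real.sqrt t • x) j ^ 2) 0) ^ δ =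
        t ^ δ * ballPow δ x := by
      intro x
      have h3 : t - ∑ j, (Real.sqrt t • x) j ^ 2 = t * (1 - ∑ j, x j ^ 2) := by
        simp only [Pi.smul_apply, smul_eq_mul, mul_pow, Real.sq_sqrt ht.le]
        rw [← Finset.mul_sum]
        ring
      rw [h3, ← mul_zero t, ← mul_max_of_nonneg _ _ ht.le,
        Real.mul_rpow ht.le (le_max_right _ _)]
      rfl
    simp only [h2, integral_const_mul, Module.finrank_fin_fun, smul_eq_mul] at h1
    have hs : 0 < Real.sqrt t := Real.sqrt_pos.2 ht
    rw [abs_of_pos (by positivity), inv_mul_eq_div, eq_div_iff (by positivity)] at h1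
    rw [← h1, max_eq_left ht.le, Real.rpow_add ht, Real.sqrt_eq_rpow, ← Real.rpow_natCast,
      ← Real.rpow_mul ht.le]
    have : 1 / 2 * (d : ℝ) = d / 2 := by ring
    rw [this]
    ring

theorem sum_sq_insertNth (u : ℝ) (x : Fin d → ℝ) :
    ∑ j, ((Fin.insertNth 0 u x : Fin (d + 1) → ℝ) j) ^ 2 = u ^ 2 + ∑ j, x j ^ 2 := by
  rw [Fin.sum_univ_succ]
  simp

theorem integrable_ballPow_mul {δ : ℝ} (hδ : 0 < δ) {g : (Fin d → ℝ) → ℝ} (hg : Continuous g) :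
    Integrable fun x => ballPow δ x * g x :=
  ((continuous_ballPow hδ).mul hg).integrable_of_hasCompactSupport
    (hasCompactSupport_ballPow hδ).mul_right

/-- Slicing orthogonally to the first axis: the slice at height `u` integrates to a constant times
`(1 - u²)_+^(δ + d/2)`. The ambient dimension is `d + 1`, which is why `d / 2` appears. -/
theorem integral_ballPow_mul_cos {δ : ℝ} (hδ : 0 < δ) (r : ℝ) :
    ∫ x : Fin (d + 1) → ℝ, ballPow δ x * Real.cos (r * x 0) =
      (∫ x : Fin d → ℝ, ballPow δ x) * bessel (δ + d / 2) r := by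
  have hν : 0 < δ + d / 2 := by positivity
  have hmp := (volume_preserving_piFinSuccAbove (fun _ : Fin (d + 1) => ℝ) 0).symm
  have hint : Integrable fun x : Fin (d + 1) → ℝ => ballPow δ x * Real.cos (r * x 0) :=
    integrable_ballPow_mul hδ (by fun_prop)
  rw [← hmp.integral_comp' (fun x : Fin (d + 1) → ℝ => ballPow δ x * Real.cos (r * x 0))]
  rw [← hmp.integrable_comp_emb (MeasurableEquiv.measurableEmbedding _)] at hint
  have h1 : ∀ z : ℝ × (Fin d → ℝ), ballPow δ ((MeasurableEquiv.piFinSuccAbove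
      (fun _ : Fin (d + 1) => ℝ) 0).symm z) * Real.cos (r * (MeasurableEquiv.piFinSuccAbove
      (fun _ : Fin (d + 1) => ℝ) 0).symm z 0) =
      (max (1 - z.1 ^ 2 - ∑ j, z.2 j ^ 2) 0) ^ δ * Real.cos (r * z.1) := by
    intro z
    have h2 : (MeasurableEquiv.piFinSuccAbove (fun _ : Fin (d + 1) => ℝ) 0).symm z =
      (Fin.insertNth 0 z.1 z.2 : Fin (d + 1) → ℝ) := rfl
    rw [h2, ballPow, sum_sq_insertNth, sub_sub]
    simp
  have hint' : Integrable (fun z : ℝ × (Fin d → ℝ) =>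
      (max (1 - z.1 ^ 2 - ∑ j, z.2 j ^ 2) 0) ^ δ * Real.cos (r * z.1)) (volume.prod volume) :=
    hint.congr (ae_of_all _ h1)
  rw [integral_congr_ae (ae_of_all _ h1)]
  refine (integral_prod _ hint').trans ?_
  simp only [integral_mul_const, integral_max_sub_rpow hδ]
  rw [bessel, ← intervalIntegral.integral_const_mul,
    intervalIntegral.integral_of_le (by norm_num : (-1 : ℝ) ≤ 1),
    ← integral_indicator measurableSet_Ioc]
  refine integral_congr_ae (ae_of_all _ fun u => ?_)
  simp only
  by_cases hu : u ∈ Set.Ioc (-1 : ℝ) 1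
  · rw [Set.indicator_of_mem hu, max_eq_left (by nlinarith [hu.1, hu.2])]
    ring
  · rw [Set.indicator_of_notMem hu, max_eq_right, Real.zero_rpow hν.ne']
    · ring
    · simp only [Set.mem_Ioc, not_and_or, not_lt, not_le] at hu
      rcases hu with h | h <;> nlinarith

/-- The Fourier transform of `(1 - |ξ|²)_+^δ`, up to normalization. -/
def rieszKernel (δ : ℝ) (y : EuclideanSpace ℝ (Fin d)) : ℝ :=
  ∫ ξ : EuclideanSpace ℝ (Fin d), ballPow δ ξ * Real.cos ⟪ξ, y⟫

theorem ballPow_eq_norm (δ : ℝ) (ξ : EuclideanSpace ℝ (Fin d)) :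
    ballPow δ ξ = (max (1 - ‖ξ‖ ^ 2) 0) ^ δ := by
  rw [EuclideanSpace.norm_sq_eq]
  simp [ballPow]

/-- The reflection carrying `y` to `z` preserves both volume and the radial weight. -/
theorem rieszKernel_eq_of_norm_eq (δ : ℝ) {y z : EuclideanSpace ℝ (Fin d)} (h : ‖y‖ = ‖z‖) :
    rieszKernel δ y = rieszKernel δ z := by
  have hA := Submodule.reflection_sub h
  set A := Submodule.reflection (ℝ ∙ (y - z))ᗮ
  have h1 := A.measurePreserving.integral_comp A.toHomeomorph.measurableEmbedding
    (fun ξ : EuclideanSpace ℝ (Fin d) => ballPow δ ξ * Real.cos ⟪ξ, z⟫)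
  rw [rieszKernel, rieszKernel, ← h1]
  refine integral_congr_ae (ae_of_all _ fun ξ => ?_)
  simp only
  rw [ballPow_eq_norm, ballPow_eq_norm, A.norm_map, ← hA, A.inner_map_map]

theorem rieszKernel_eq_bessel {δ : ℝ} (hδ : 0 < δ) (y : EuclideanSpace ℝ (Fin (d + 1))) :
    rieszKernel δ y = (∫ x : Fin d → ℝ, ballPow δ x) * bessel (δ + d / 2) ‖y‖ := by
  rw [rieszKernel_eq_of_norm_eq δ (z := EuclideanSpace.single 0 ‖y‖) (by simp),
    ← integral_ballPow_mul_cos hδ, rieszKernel,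
    ← (PiLp.volume_preserving_toLp (Fin (d + 1))).integral_comp
      (MeasurableEquiv.toLp 2 _).measurableEmbedding]
  refine integral_congr_ae (ae_of_all _ fun x => ?_)
  simp [EuclideanSpace.inner_single_right]

theorem continuous_rieszKernel {δ : ℝ} (hδ : 0 < δ) :
    Continuous (rieszKernel δ : EuclideanSpace ℝ (Fin (d + 1)) → ℝ) := by
  have h : (rieszKernel δ : EuclideanSpace ℝ (Fin (d + 1)) → ℝ) =
    fun y => (∫ x : Fin d → ℝ, ballPow δ x) * bessel (δ + d / 2) ‖y‖ :=
    funext (rieszKernel_eq_bessel hδ)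
  rw [h]
  exact continuous_const.mul ((continuous_bessel (by positivity)).comp continuous_norm)

/-- The kernel decays like `|y|^(-(δ + d/2 + 1))`, and this exponent exceeds the dimension `d + 1`
exactly when `δ > d / 2`. -/
theorem integrable_rieszKernel {δ : ℝ} (hδ : 0 < δ) (hd : (d : ℝ) / 2 < δ) :
    Integrable (rieszKernel δ : EuclideanSpace ℝ (Fin (d + 1)) → ℝ) := by
  have hν : 0 ≤ δ + (d : ℝ) / 2 := by positivity
  obtain ⟨C, hC⟩ := exists_abs_bessel_le hν
  set ν := δ + (d : ℝ) / 2 with hνdef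
  set I := ∫ x : Fin d → ℝ, ballPow δ x with hI
  have hI0 : 0 < I := integral_ballPow_pos hδ
  have hfin : (Module.finrank ℝ (EuclideanSpace ℝ (Fin (d + 1))) : ℝ) < ν + 1 := by
    rw [finrank_euclideanSpace_fin]
    push_cast
    linarith
  have h1 := (integrable_one_add_norm (μ := (volume : Measure (EuclideanSpace ℝ (Fin (d + 1)))))
    hfin).const_mul (I * ((|C| + 2) * 2 ^ (ν + 1)))
  refine h1.mono' (continuous_rieszKernel hδ).aestronglyMeasurable (ae_of_all _ fun y => ?_)
  rw [rieszKernel_eq_bessel hδ, norm_mul, Real.norm_of_nonneg hI0.le, mul_assoc]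
  refine mul_le_mul_of_nonneg_left ?_ hI0.le
  have hy : 0 < 1 + ‖y‖ := by positivity
  rw [Real.rpow_neg hy.le, ← div_eq_mul_inv, le_div_iff₀ (by positivity), Real.norm_eq_abs]
  rcases le_or_gt ‖y‖ 1 with h | h
  · have h2 := abs_bessel_le hν ‖y‖
    have h3 : (1 + ‖y‖) ^ (ν + 1) ≤ 2 ^ (ν + 1) :=
      Real.rpow_le_rpow hy.le (by linarith) (by linarith)
    refine mul_le_mul (h2.trans ?_) h3 (by positivity) (by positivity)
    linarith [abs_nonneg C]
  · have h2 := hC ‖y‖ h.le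
    have h3 : (1 + ‖y‖) ^ (ν + 1) ≤ 2 ^ (ν + 1) * ‖y‖ ^ (ν + 1) := by
      rw [← Real.mul_rpow (by norm_num) (norm_nonneg _)]
      exact Real.rpow_le_rpow hy.le (by linarith) (by linarith)
    rw [abs_mul, abs_of_nonneg (by positivity)] at h2
    calc |bessel ν ‖y‖| * (1 + ‖y‖) ^ (ν + 1)
        ≤ |bessel ν ‖y‖| * (2 ^ (ν + 1) * ‖y‖ ^ (ν + 1)) := by gcongr
      _ = (‖y‖ ^ (ν + 1) * |bessel ν ‖y‖|) * 2 ^ (ν + 1) := by ring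
      _ ≤ (|C| + 2) * 2 ^ (ν + 1) := by
          gcongr
          linarith [le_abs_self C]

theorem fourier_ballPow {δ : ℝ} (hδ : 0 < δ) (y : EuclideanSpace ℝ (Fin d)) :
    𝓕 (fun ξ : EuclideanSpace ℝ (Fin d) => (ballPow δ ξ : ℂ)) y =
      (rieszKernel δ ((2 * Real.pi) • y) : ℂ) := by
  have hci : Continuous fun ξ : EuclideanSpace ℝ (Fin d) => (ξ : Fin d → ℝ) := by fun_prop
  have hsupp : HasCompactSupport fun ξ : EuclideanSpace ℝ (Fin d) => ballPow δ ξ :=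
    HasCompactSupport.intro (isCompact_closedBall 0 1) fun x hx => by
      rw [ballPow_eq_norm, max_eq_right, Real.zero_rpow hδ.ne']
      have : 1 < ‖x‖ := by simpa using hx
      nlinarith
  have hi : ∀ g : EuclideanSpace ℝ (Fin d) → ℝ, Continuous g →
      Integrable fun ξ : EuclideanSpace ℝ (Fin d) => ballPow δ ξ * g ξ := fun g hg =>
    (((continuous_ballPow hδ).comp hci).mul hg).integrable_of_hasCompactSupport hsupp.mul_right
  -- The weight is even, so the sine part integrates to zero and the transform is real.
  have hsin : ∫ ξ : EuclideanSpace ℝ (Fin d), ballPow δ ξ * Real.sin ⟪ξ, (2 * Real.pi) • y⟫ = 0 := by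
    have h1 := integral_neg_eq_self (fun ξ : EuclideanSpace ℝ (Fin d) =>
      ballPow δ ξ * Real.sin ⟪ξ, (2 * Real.pi) • y⟫) volume
    have h2 : ∀ ξ : EuclideanSpace ℝ (Fin d), ballPow δ (-ξ) *
        Real.sin ⟪-ξ, (2 * Real.pi) • y⟫ = -(ballPow δ ξ * Real.sin ⟪ξ, (2 * Real.pi) • y⟫) := by
      intro ξ
      rw [inner_neg_left, Real.sin_neg]
      simp [ballPow]
    have h3 : ∀ ξ : EuclideanSpace ℝ (Fin d), ballPow δ ((-ξ : EuclideanSpace ℝ (Fin d))) *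
        Real.sin ⟪-ξ, (2 * Real.pi) • y⟫ = -(ballPow δ ξ * Real.sin ⟪ξ, (2 * Real.pi) • y⟫) := h2
    simp only [h3, integral_neg] at h1
    linarith
  rw [Real.fourier_eq']
  have h4 : ∀ ξ : EuclideanSpace ℝ (Fin d),
      Complex.exp ((-2 * Real.pi * ⟪ξ, y⟫ : ℝ) * Complex.I) • (ballPow δ ξ : ℂ) =
      ((ballPow δ ξ * Real.cos ⟪ξ, (2 * Real.pi) • y⟫ : ℝ) : ℂ) -
        ((ballPow δ ξ * Real.sin ⟪ξ, (2 * Real.pi) • y⟫ : ℝ) : ℂ) * Complex.I := by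
    intro ξ
    rw [Complex.exp_mul_I, inner_smul_right, ← Complex.ofReal_cos, ← Complex.ofReal_sin,
      show -2 * Real.pi * ⟪ξ, y⟫ = -(2 * Real.pi * ⟪ξ, y⟫) by ring, Real.cos_neg, Real.sin_neg]
    push_cast
    rw [smul_eq_mul]
    ring
  rw [integral_congr_ae (ae_of_all _ h4), integral_sub (hi _ (by fun_prop)).ofReal
    ((hi _ (by fun_prop)).ofReal.mul_const _), integral_mul_const]
  simp only [integral_complex_ofReal, hsin]
  simp [rieszKernel]

/-- Fourier inversion, valid pointwise because the function is continuous and both it and its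
transform are integrable. -/
theorem exists_integral_eq_ballPow {δ : ℝ} (hδ : 0 < δ) (hd : (d : ℝ) / 2 < δ) :
    ∃ K : EuclideanSpace ℝ (Fin (d + 1)) → ℂ, Integrable K ∧
      ∀ x : EuclideanSpace ℝ (Fin (d + 1)),
        (ballPow δ x : ℂ) = ∫ y, K y * Complex.exp (Complex.I * (2 * Real.pi * ⟪y, x⟫ : ℝ)) := by
  set m : EuclideanSpace ℝ (Fin (d + 1)) → ℂ := fun ξ => (ballPow δ ξ : ℂ) with hm
  have hci : Continuous fun ξ : EuclideanSpace ℝ (Fin (d + 1)) => (ξ : Fin (d + 1) → ℝ) := by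
    fun_prop
  have hcont : Continuous m := Complex.continuous_ofReal.comp ((continuous_ballPow hδ).comp hci)
  have hsupp : HasCompactSupport m :=
    HasCompactSupport.intro (isCompact_closedBall 0 1) fun x hx => by
      rw [hm]
      simp only
      rw [ballPow_eq_norm, max_eq_right, Real.zero_rpow hδ.ne', Complex.ofReal_zero]
      have : 1 < ‖x‖ := by simpa using hx
      nlinarith
  have hK : Integrable (𝓕 m) := by
    have h1 : 𝓕 m = fun y => (rieszKernel δ ((2 * Real.pi) • y) : ℂ) :=
      funext fun y => fourier_ballPow hδ y
    rw [h1]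
    exact ((integrable_rieszKernel hδ hd).comp_smul Real.two_pi_pos.ne').ofReal
  refine ⟨𝓕 m, hK, fun x => ?_⟩
  have h2 := congrFun (hcont.fourierInv_fourier_eq (hcont.integrable_of_hasCompactSupport hsupp)
    hK) x
  rw [Real.fourierInv_eq'] at h2
  change m x = _
  rw [← h2]
  refine integral_congr_ae (ae_of_all _ fun y => ?_)
  simp only [smul_eq_mul]
  rw [mul_comm, mul_comm Complex.I]

/-- The operator with multiplier `m` is the average of those with multipliers `g t`, weighted by `f
t`, and the norm passes under the integral. -/
theorem MultBdd.integral {X ι S : Type*} [NormedAddCommGroup X] [NormedSpace ℂ X]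
    [CompleteSpace X] [MeasurableSpace S] {μ : Measure S} {e : ι → X} {C : ℝ} {m : ι → ℂ}
    {f : S → ℂ} {g : S → ι → ℂ} (hf : Integrable f μ) (hg : ∀ᵐ t ∂μ, MultBdd e C (g t))
    (hfg : ∀ k, Integrable (fun t => f t * g t k) μ) (hm : ∀ k, m k = ∫ t, f t * g t k ∂μ) :
    MultBdd e ((∫ t, ‖f t‖ ∂μ) * C) m := by
  intro s c
  have h1 : ∑ k ∈ s, (m k * c k) • e k = ∫ t, ∑ k ∈ s, ((f t * g t k) * c k) • e k ∂μ := by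
    rw [integral_finsetSum _ fun k _ => ((hfg k).mul_const (c k)).smul_const _]
    refine Finset.sum_congr rfl fun k _ => ?_
    rw [integral_smul_const, integral_mul_const, hm]
  rw [h1, mul_assoc, ← integral_mul_const]
  refine norm_integral_le_of_norm_le (hf.norm.mul_const _) ?_
  filter_upwards [hg] with t ht
  have h2 : ∑ k ∈ s, ((f t * g t k) * c k) • e k = f t • ∑ k ∈ s, (g t k * c k) • e k := by
    rw [Finset.smul_sum]
    refine Finset.sum_congr rfl fun k _ => ?_
    rw [smul_smul, mul_assoc]
  rw [h2, norm_smul]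
  exact mul_le_mul_of_nonneg_left (ht s c) (norm_nonneg _)

/-- Above the critical index the Riesz multipliers are uniformly bounded on `L_p`. -/
theorem exists_multBdd_riesz (p : ℝ≥0∞) [Fact (1 ≤ p)] {δ : ℝ} (hδ : 0 < δ)
    (hd : (d : ℝ) / 2 < δ) :
    ∃ C, 0 ≤ C ∧ ∀ ρ : ℝ, 0 < ρ → MultBdd (characterLp p (d := d + 1)) C
      (fun k => (((max (1 - eucl k ^ 2 / ρ) 0) ^ δ : ℝ) : ℂ)) := by
  obtain ⟨K, hK, hrep⟩ := exists_integral_eq_ballPow hδ hd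
  refine ⟨(∫ y, ‖K y‖) * 1, mul_nonneg (integral_nonneg fun y => norm_nonneg _) zero_le_one,
    fun ρ hρ => ?_⟩
  -- By Fourier inversion the multiplier is an average of `k ↦ character k y'`, the multipliers of
  -- translations, which are isometries of `L_p`. The scale `ρ` only moves the points `y'`, so the
  -- bound does not depend on it.
  have h1 : ∀ k : Fin (d + 1) → ℤ, (((max (1 - eucl k ^ 2 / ρ) 0) ^ δ : ℝ) : ℂ) =
      ∫ y : EuclideanSpace ℝ (Fin (d + 1)),
        K y * character k (toTorus ((2 * Real.pi / Real.sqrt ρ) • (y : Fin (d + 1) → ℝ))) := by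
    intro k
    have h2 := hrep (WithLp.toLp 2 fun j => (k j : ℝ) / Real.sqrt ρ)
    have h3 : ballPow δ (fun j => (k j : ℝ) / Real.sqrt ρ) =
        (max (1 - eucl k ^ 2 / ρ) 0) ^ δ := by
      rw [ballPow, eucl, Real.sq_sqrt (Finset.sum_nonneg fun j _ => sq_nonneg _)]
      simp only [div_pow, Real.sq_sqrt hρ.le, Finset.sum_div]
    rw [← h3]
    refine h2.trans (integral_congr_ae (ae_of_all _ fun y => ?_))
    simp only
    rw [character_toTorus]
    congr 4
    simp only [PiLp.inner_apply, Pi.smul_apply, smul_eq_mul, Finset.mul_sum]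
    refine Finset.sum_congr rfl fun j _ => ?_
    simp
    ring
  have hmeas : ∀ k : Fin (d + 1) → ℤ, Integrable fun y : EuclideanSpace ℝ (Fin (d + 1)) =>
      K y * character k (toTorus ((2 * Real.pi / Real.sqrt ρ) • (y : Fin (d + 1) → ℝ))) := by
    intro k
    refine hK.mul_bdd (c := 1) ?_ (ae_of_all _ fun y => (norm_character _ _).le)
    refine Continuous.aestronglyMeasurable ?_
    simp only [character_toTorus]
    fun_prop
  exact MultBdd.integral hK (g := fun y k =>
    character k (toTorus ((2 * Real.pi / Real.sqrt ρ) • (y : Fin (d + 1) → ℝ))))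
    (ae_of_all _ fun y s c => by rw [norm_translate, one_mul]) hmeas h1

end BochnerRiesz

end

noncomputable section

namespace BochnerRiesz

open scoped ContDiff

variable {d : ℕ}

/-! ### Subordination to the Riesz multipliers -/

/-- The functions `Hⱼ` with `(d/ds)^{j+1} G(s^b) = s^{b-j-1} Hⱼ(s^b)`. -/
def powSymbol (b : ℝ) (G : ℝ → ℝ) : ℕ → ℝ → ℝ
  | 0 => fun w => b * deriv G w
  | j + 1 => fun w => (b - (j + 1)) * powSymbol b G j w + b * w * deriv (powSymbol b G j) w

/-- The `j`-th derivative of `s ↦ G(s^b)` on the half line. -/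
def powDeriv (b : ℝ) (G : ℝ → ℝ) : ℕ → ℝ → ℝ
  | 0 => fun s => G (s ^ b)
  | j + 1 => fun s => s ^ (b - (j + 1)) * powSymbol b G j (s ^ b)

section

variable {b R : ℝ} {G : ℝ → ℝ}

theorem contDiff_powSymbol (hG : ContDiff ℝ ∞ G) (j : ℕ) : ContDiff ℝ ∞ (powSymbol b G j) := by
  induction j with
  | zero => exact contDiff_const.mul (contDiff_infty_iff_deriv.1 hG).2
  | succ j ih =>
    have := (contDiff_infty_iff_deriv.1 ih).2
    unfold powSymbol
    fun_prop

theorem powSymbol_eq_zero (hR : ∀ w, R < w → G w = 0) (j : ℕ) :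
    ∀ w, R < w → powSymbol b G j w = 0 := by
  have key : ∀ f : ℝ → ℝ, (∀ w, R < w → f w = 0) → ∀ w, R < w → deriv f w = 0 := by
    intro f hf w hw
    have : f =ᶠ[𝓝 w] fun _ => 0 := by
      filter_upwards [Ioi_mem_nhds hw] with x hx using hf x hx
    rw [this.deriv_eq, deriv_const]
  induction j with
  | zero => intro w hw; simp [powSymbol, key G hR w hw]
  | succ j ih => intro w hw; simp [powSymbol, ih w hw, key _ ih w hw]

theorem hasDerivAt_powDeriv (hG : ContDiff ℝ ∞ G) (j : ℕ) {s : ℝ} (hs : 0 < s) :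
    HasDerivAt (powDeriv b G j) (powDeriv b G (j + 1) s) s := by
  have h1 : HasDerivAt (fun s : ℝ => s ^ b) (b * s ^ (b - 1)) s :=
    Real.hasDerivAt_rpow_const (Or.inl hs.ne')
  cases j with
  | zero =>
    have h2 : HasDerivAt G (deriv G (s ^ b)) (s ^ b) :=
      (hG.differentiable (by simp) _).hasDerivAt
    convert! h2.comp s h1 using 1
    simp only [powDeriv, powSymbol, CharP.cast_eq_zero, zero_add]
    ring
  | succ j =>
    have h2 : HasDerivAt (powSymbol b G j) (deriv (powSymbol b G j) (s ^ b)) (s ^ b) :=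
      ((contDiff_powSymbol hG j).differentiable (by simp) _).hasDerivAt
    have h3 := (Real.hasDerivAt_rpow_const (p := b - (j + 1)) (Or.inl hs.ne')).mul (h2.comp s h1)
    convert! h3 using 1
    simp only [powDeriv, powSymbol, Function.comp_apply]
    have e1 : s ^ (b - ((j + 1 : ℕ) + 1)) = s ^ (b - (j + 1) - 1) := by
      congr 1; push_cast; ring
    have e2 : s ^ (b - (j + 1)) * s ^ (b - 1) = s ^ (b - (j + 1) - 1) * s ^ b := by
      rw [← Real.rpow_add hs, ← Real.rpow_add hs]; congr 1; ring
    rw [e1]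
    linear_combination (-(b * deriv (powSymbol b G j) (s ^ b))) * e2

/-- The derivatives of `s ↦ G(s^b)` may be singular at `0`; multiplied by the matching power of `s`
they extend continuously to `0`. -/
theorem pow_mul_powDeriv (hb : 0 < b) (j : ℕ) {s : ℝ} (hs : 0 ≤ s) :
    s ^ (j + 1) * powDeriv b G (j + 1) s = s ^ b * powSymbol b G j (s ^ b) := by
  rcases hs.eq_or_lt with rfl | hs
  · rw [Real.zero_rpow hb.ne']; simp
  · simp only [powDeriv]
    rw [← mul_assoc, ← Real.rpow_natCast, ← Real.rpow_add hs]
    congr 2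
    push_cast
    ring

/-- The Taylor sum at `v` based at the point `s`. -/
def taylorSum (b : ℝ) (G : ℝ → ℝ) (v : ℝ) (N : ℕ) (s : ℝ) : ℝ :=
  ∑ j ∈ Finset.range (N + 1), (-1) ^ j / (j.factorial : ℝ) * ((s - v) ^ j * powDeriv b G j s)

/-- Differentiating in the base point telescopes, and only the integrand of the remainder survives.
-/
theorem hasDerivAt_taylorSum (hG : ContDiff ℝ ∞ G) (v : ℝ) (N : ℕ) {s : ℝ} (hs : 0 < s) :
    HasDerivAt (taylorSum b G v N)
      ((-1) ^ N / (N.factorial : ℝ) * ((s - v) ^ N * powDeriv b G (N + 1) s)) s := by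
  induction N with
  | zero =>
    have h := hasDerivAt_powDeriv (b := b) hG 0 hs
    have : taylorSum b G v 0 = powDeriv b G 0 := by
      ext s; simp [taylorSum]
    rw [this]
    simpa using h
  | succ N ih =>
    have h1 : taylorSum b G v (N + 1) = fun s => taylorSum b G v N s +
        (-1) ^ (N + 1) / ((N + 1).factorial : ℝ) * ((s - v) ^ (N + 1) * powDeriv b G (N + 1) s) := by
      ext s
      rw [taylorSum, Finset.sum_range_succ, taylorSum]
    have h2 : HasDerivAt (fun s : ℝ => (s - v) ^ (N + 1)) ((N + 1 : ℕ) * (s - v) ^ N) s := by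
      exact (((hasDerivAt_id s).sub_const v).pow (N + 1)).congr_deriv (by simp)
    rw [h1]
    convert! ih.add ((h2.mul (hasDerivAt_powDeriv (b := b) hG (N + 1) hs)).const_mul
      ((-1) ^ (N + 1) / ((N + 1).factorial : ℝ))) using 1
    have h3 : (N.factorial : ℝ) ≠ 0 := by exact_mod_cast N.factorial_ne_zero
    have h4 : ((N : ℝ) + 1) ≠ 0 := by positivity
    rw [Nat.factorial_succ]
    push_cast
    field_simp
    ring

/-- Only `v = 0` is delicate: there the powers of `s - v = s` compensate the singular derivatives.
-/
theorem continuousWithinAt_taylorSum (hb : 0 < b) (hG : ContDiff ℝ ∞ G) {v : ℝ} (hv : 0 ≤ v)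
    (N : ℕ) : ContinuousWithinAt (taylorSum b G v N) (Set.Ici v) v := by
  rcases hv.eq_or_lt with rfl | hv
  · have hc : Continuous fun s : ℝ => s ^ b := Real.continuous_rpow_const hb.le
    have h1 : ∀ s ∈ Set.Ici (0 : ℝ), taylorSum b G 0 N s = G (s ^ b) + ∑ j ∈ Finset.range N,
        (-1) ^ (j + 1) / ((j + 1).factorial : ℝ) * (s ^ b * powSymbol b G j (s ^ b)) := by
      intro s hs
      rw [taylorSum, Finset.sum_range_succ']
      simp only [sub_zero]
      rw [add_comm]
      congr 1
      · simp [powDeriv]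
      · refine Finset.sum_congr rfl fun j _ => ?_
        rw [pow_mul_powDeriv hb j hs]
    have h2 : Continuous fun s : ℝ => G (s ^ b) + ∑ j ∈ Finset.range N,
        (-1) ^ (j + 1) / ((j + 1).factorial : ℝ) * (s ^ b * powSymbol b G j (s ^ b)) := by
      refine (hG.continuous.comp hc).add (continuous_finsetSum _ fun j _ => ?_)
      exact continuous_const.mul (hc.mul ((contDiff_powSymbol hG j).continuous.comp hc))
    exact h2.continuousWithinAt.congr h1 (h1 0 (Set.mem_Ici.2 le_rfl))
  · exact (hasDerivAt_taylorSum hG v N hv).continuousAt.continuousWithinAt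

theorem eventually_powDeriv_eq_zero (hb : 0 < b) (hR : ∀ w, R < w → G w = 0) (j : ℕ) :
    ∀ᶠ s in atTop, powDeriv b G j s = 0 := by
  filter_upwards [(tendsto_rpow_atTop hb).eventually_gt_atTop R] with s hs
  cases j with
  | zero => exact hR _ hs
  | succ j => simp [powDeriv, powSymbol_eq_zero hR j _ hs]

/-- The integrand equals `s^(b-1)` times a continuous function that vanishes for large `s`, and
`s^(b-1)` is integrable at `0` because `b > 0`. -/
theorem integrableOn_pow_mul_powDeriv (hb : 0 < b) (hG : ContDiff ℝ ∞ G)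
    (hR : ∀ w, R < w → G w = 0) (N : ℕ) :
    IntegrableOn (fun s => s ^ N * powDeriv b G (N + 1) s) (Set.Ioi 0) := by
  have hc : Continuous fun s : ℝ => s ^ b := Real.continuous_rpow_const hb.le
  have hH := (contDiff_powSymbol (b := b) hG N).continuous
  have h1 : ∀ s ∈ Set.Ioi (0 : ℝ), s ^ N * powDeriv b G (N + 1) s =
      s ^ (b - 1) * powSymbol b G N (s ^ b) := by
    intro s hs
    rw [Set.mem_Ioi] at hs
    simp only [powDeriv]
    rw [← mul_assoc, ← Real.rpow_natCast, ← Real.rpow_add hs]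
    congr 2
    ring
  refine IntegrableOn.congr_fun ?_ (fun s hs => (h1 s hs).symm) measurableSet_Ioi
  obtain ⟨A, hA⟩ := eventually_atTop.1 ((tendsto_rpow_atTop hb).eventually_gt_atTop R)
  set B := max A 1
  have hint : IntegrableOn (fun s : ℝ => s ^ (b - 1) * powSymbol b G N (s ^ b)) (Set.Ioc 0 B) := by
    have h2 : IntegrableOn (fun s : ℝ => s ^ (b - 1)) (Set.Ioc 0 B) :=
      (intervalIntegral.intervalIntegrable_rpow' (by linarith)).1
    obtain ⟨C, hC⟩ := (isCompact_Icc (a := 0) (b := B)).exists_bound_of_continuousOn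
      (hH.comp hc).continuousOn
    refine Integrable.mul_bdd (c := C) h2 (hH.comp hc).aestronglyMeasurable ?_
    filter_upwards [ae_restrict_mem measurableSet_Ioc] with s hs
    exact hC s ⟨hs.1.le, hs.2⟩
  refine hint.of_forall_sdiff_eq_zero measurableSet_Ioi fun s hs => ?_
  have hsB : B < s := by
    by_contra! h
    exact hs.2 ⟨hs.1, h⟩
  rw [powSymbol_eq_zero hR N _ (hA s ((le_max_left _ _).trans hsB.le)), mul_zero]

/-- Representation of `G(v^b)` as a superposition of truncated powers. -/
theorem eq_integral_truncated_pow (hb : 0 < b) (hG : ContDiff ℝ ∞ G)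
    (hR : ∀ w, R < w → G w = 0) {N : ℕ} (hN : 1 ≤ N) {v : ℝ} (hv : 0 ≤ v) :
    G (v ^ b) = ∫ s in Set.Ioi (0 : ℝ),
      ((-1) ^ (N + 1) / (N.factorial : ℝ) * (s ^ N * powDeriv b G (N + 1) s)) *
        (max (1 - v / s) 0) ^ N := by
  set c : ℝ := (-1) ^ N / (N.factorial : ℝ) with hc
  have hint := integrableOn_pow_mul_powDeriv hb hG hR N
  have h1 : ∀ s ∈ Set.Ioi v, c * ((s - v) ^ N * powDeriv b G (N + 1) s) =
      c * (s ^ N * powDeriv b G (N + 1) s) * (max (1 - v / s) 0) ^ N := by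
    intro s hs
    have hs0 : 0 < s := hv.trans_lt hs
    have h2 : 0 ≤ 1 - v / s := by
      rw [sub_nonneg, div_le_one hs0]; exact (Set.mem_Ioi.1 hs).le
    have h3 : s - v = s * (1 - v / s) := by field_simp
    rw [max_eq_left h2, h3, mul_pow]
    ring
  have hbd : IntegrableOn (fun s => c * (s ^ N * powDeriv b G (N + 1) s) *
      (max (1 - v / s) 0) ^ N) (Set.Ioi 0) := by
    refine Integrable.mul_bdd (c := 1) (hint.const_mul c) ?_ ?_
    · exact (by fun_prop : Measurable fun s : ℝ => (max (1 - v / s) 0) ^ N).aestronglyMeasurable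
    · filter_upwards [ae_restrict_mem measurableSet_Ioi] with s hs
      have : 0 ≤ v / s := div_nonneg hv (le_of_lt hs)
      rw [norm_pow, Real.norm_of_nonneg (le_max_right _ _)]
      exact pow_le_one₀ (le_max_right _ _) (max_le (by linarith) zero_le_one)
  have hv' : Set.Ioi v ⊆ Set.Ioi 0 := Set.Ioi_subset_Ioi hv
  have h4 : IntegrableOn (fun s => c * ((s - v) ^ N * powDeriv b G (N + 1) s)) (Set.Ioi v) :=
    (hbd.mono_set hv').congr_fun (fun s hs => (h1 s hs).symm) measurableSet_Ioi
  have h5 : Tendsto (taylorSum b G v N) atTop (𝓝 0) := by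
    refine tendsto_const_nhds.congr' ?_
    have : ∀ᶠ s in atTop, ∀ j ∈ Finset.range (N + 1), powDeriv b G j s = 0 :=
      (Finset.eventually_all _).2 fun j _ => eventually_powDeriv_eq_zero hb hR j
    filter_upwards [this] with s hs
    rw [taylorSum, Finset.sum_eq_zero]
    intro j hj
    rw [hs j hj, mul_zero, mul_zero]
  -- Fundamental theorem of calculus on `(v, ∞)`: the Taylor sum is `G (v ^ b)` at the base point
  -- `v` and `0` far out.
  have h6 := integral_Ioi_of_hasDerivAt_of_tendsto (continuousWithinAt_taylorSum hb hG hv N)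
    (fun s hs => hasDerivAt_taylorSum hG v N (hv.trans_lt hs)) h4 h5
  have h7 : taylorSum b G v N v = G (v ^ b) := by
    rw [taylorSum, Finset.sum_range_succ', Finset.sum_eq_zero]
    · simp [powDeriv]
    · intro j _; simp
  rw [h7, zero_sub] at h6
  rw [← neg_neg (G (v ^ b)), ← h6, setIntegral_congr_fun measurableSet_Ioi h1, ← integral_neg,
    ← setIntegral_eq_of_subset_of_forall_sdiff_eq_zero measurableSet_Ioi hv']
  · refine integral_congr_ae (ae_of_all _ fun s => ?_)
    simp only [hc, pow_succ]
    ring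
  · intro s hs
    have hs0 : 0 < s := hs.1
    have hsv : s ≤ v := by
      by_contra! h
      exact hs.2 h
    have : 1 - v / s ≤ 0 := by
      rw [sub_nonpos, le_div_iff₀ hs0]; linarith
    -- For `s ≤ v` the truncated power vanishes; this is where `N ≥ 1` matters.
    rw [max_eq_right this, zero_pow (by omega), mul_zero, neg_zero]

end

/-! ### Products, sums and superpositions of bounded radial multipliers -/

theorem MultBdd.mul {X ι : Type*} [NormedAddCommGroup X] [NormedSpace ℂ X] {e : ι → X}
    {C₁ C₂ : ℝ} {m₁ m₂ : ι → ℂ} (h₁ : MultBdd e C₁ m₁) (h₂ : MultBdd e C₂ m₂) (hC : 0 ≤ C₁) :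
    MultBdd e (C₁ * C₂) (fun k => m₁ k * m₂ k) := by
  intro s c
  have h3 := h₁ s fun k => m₂ k * c k
  simp only [mul_assoc]
  exact h3.trans (mul_le_mul_of_nonneg_left (h₂ s c) hC)

theorem MultBdd.add {X ι : Type*} [NormedAddCommGroup X] [NormedSpace ℂ X] {e : ι → X}
    {C₁ C₂ : ℝ} {m₁ m₂ : ι → ℂ} (h₁ : MultBdd e C₁ m₁) (h₂ : MultBdd e C₂ m₂) :
    MultBdd e (C₁ + C₂) (fun k => m₁ k + m₂ k) := by
  intro s c
  simp only [add_mul, add_smul, Finset.sum_add_distrib]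
  exact (norm_add_le _ _).trans (add_le_add (h₁ s c) (h₂ s c))

/-- The dilated radial multipliers `φ(|k|²/ρ)` are uniformly bounded on `L_p`. -/
def RadialMult (d : ℕ) (p : ℝ≥0∞) [Fact (1 ≤ p)] (φ : ℝ → ℝ) : Prop :=
  ∃ C, 0 ≤ C ∧ ∀ ρ : ℝ, 0 < ρ →
    MultBdd (characterLp p (d := d)) C fun k => (φ (eucl k ^ 2 / ρ) : ℂ)

section

variable {p : ℝ≥0∞} [Fact (1 ≤ p)]

theorem RadialMult.mul {φ ψ : ℝ → ℝ} (hφ : RadialMult d p φ) (hψ : RadialMult d p ψ) :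
    RadialMult d p fun v => φ v * ψ v := by
  obtain ⟨C₁, h1, h1'⟩ := hφ
  obtain ⟨C₂, h2, h2'⟩ := hψ
  refine ⟨C₁ * C₂, by positivity, fun ρ hρ => ?_⟩
  simpa using (h1' ρ hρ).mul (h2' ρ hρ) h1

theorem RadialMult.add {φ ψ : ℝ → ℝ} (hφ : RadialMult d p φ) (hψ : RadialMult d p ψ) :
    RadialMult d p fun v => φ v + ψ v := by
  obtain ⟨C₁, h1, h1'⟩ := hφ
  obtain ⟨C₂, h2, h2'⟩ := hψ
  refine ⟨C₁ + C₂, by positivity, fun ρ hρ => ?_⟩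
  simpa using (h1' ρ hρ).add (h2' ρ hρ)

/-- `G(v^b)` is a superposition of Riesz multipliers of integer order `N = d + 1`, which lies above
the critical index `d / 2` of dimension `d + 1`. The dilation `ρ` merely rescales the parameter `s`
to `ρ s`, so the uniform Riesz bound applies. -/
theorem radialMult_comp_rpow {b R : ℝ} {G : ℝ → ℝ} (hb : 0 < b) (hG : ContDiff ℝ ∞ G)
    (hR : ∀ w, R < w → G w = 0) : RadialMult (d + 1) p fun v => G (v ^ b) := by
  obtain ⟨N, hN, hNd⟩ : ∃ N : ℕ, 1 ≤ N ∧ (d : ℝ) / 2 < (N : ℝ) :=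
    ⟨d + 1, by omega, by push_cast; linarith [(Nat.cast_nonneg d : (0 : ℝ) ≤ d)]⟩
  obtain ⟨C, hC, hbdd⟩ := exists_multBdd_riesz p (d := d) (δ := N) (by exact_mod_cast hN) hNd
  set f : ℝ → ℝ := fun s => (-1) ^ (N + 1) / (N.factorial : ℝ) * (s ^ N * powDeriv b G (N + 1) s)
  have hf : Integrable f (volume.restrict (Set.Ioi 0)) :=
    (integrableOn_pow_mul_powDeriv hb hG hR N).const_mul _
  refine ⟨(∫ s in Set.Ioi (0 : ℝ), ‖(f s : ℂ)‖) * C,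
    mul_nonneg (integral_nonneg fun _ => norm_nonneg _) hC, fun ρ hρ => ?_⟩
  refine MultBdd.integral (μ := volume.restrict (Set.Ioi 0)) (f := fun s => (f s : ℂ))
    (g := fun s k => (((max (1 - eucl k ^ 2 / (ρ * s)) 0) ^ (N : ℝ) : ℝ) : ℂ)) hf.ofReal ?_ ?_ ?_
  · filter_upwards [ae_restrict_mem measurableSet_Ioi] with s hs
    exact hbdd (ρ * s) (mul_pos hρ hs)
  · intro k
    refine Integrable.mul_bdd (c := 1) hf.ofReal ?_ ?_
    · exact (by fun_prop : Measurable fun s : ℝ =>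
        (((max (1 - eucl k ^ 2 / (ρ * s)) 0) ^ (N : ℝ) : ℝ) : ℂ)).aestronglyMeasurable
    · filter_upwards [ae_restrict_mem measurableSet_Ioi] with s hs
      have hs : 0 < s := hs
      have : 0 ≤ eucl k ^ 2 / (ρ * s) := by positivity
      rw [Complex.norm_real, Real.norm_of_nonneg (Real.rpow_nonneg (le_max_right _ _) _)]
      exact Real.rpow_le_one (le_max_right _ _) (max_le (by linarith) zero_le_one) (by positivity)
  · intro k
    have hv : 0 ≤ eucl k ^ 2 / ρ := by positivity
    beta_reduce
    rw [eq_integral_truncated_pow hb hG hR hN hv, ← integral_complex_ofReal]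
    refine integral_congr_ae (ae_of_all _ fun s => ?_)
    simp only [f, Real.rpow_natCast, div_div]
    push_cast
    rfl

end

end BochnerRiesz

end

noncomputable section

namespace BochnerRiesz

open scoped ContDiff

variable {d : ℕ}

/-! ### Comparison of the means for different exponents -/

/-- A smooth function equal to `1` on `(-∞, a]` and to `0` on `[a', ∞)`. -/
def cutoff (a a' v : ℝ) : ℝ := 1 - Real.smoothTransition ((v - a) / (a' - a))

section

variable {a a' v : ℝ}

theorem contDiff_cutoff : ContDiff ℝ ∞ (cutoff a a') := by
  unfold cutoff
  exact contDiff_const.sub (Real.smoothTransition.contDiff.comp (by fun_prop))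

theorem cutoff_eq_one (h : a < a') (hv : v ≤ a) : cutoff a a' v = 1 := by
  rw [cutoff, Real.smoothTransition.zero_of_nonpos, sub_zero]
  exact div_nonpos_of_nonpos_of_nonneg (by linarith) (by linarith)

theorem cutoff_eq_zero (h : a < a') (hv : a' ≤ v) : cutoff a a' v = 0 := by
  rw [cutoff, Real.smoothTransition.one_of_one_le, sub_self]
  rw [one_le_div (by linarith)]
  linarith

end

/-- `(1 - w)^q` cut off before `w = 1`. -/
theorem contDiff_one_sub_rpow_mul_cutoff {a : ℝ} (ha : a < 1) (q : ℝ) :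
    ContDiff ℝ ∞ fun w : ℝ => (1 - w) ^ q * cutoff a ((1 + a) / 2) w := by
  rw [contDiff_iff_contDiffAt]
  intro w
  rcases lt_or_ge w 1 with hw | hw
  · have h1 : ContDiffAt ℝ ∞ (fun w : ℝ => (1 - w) ^ q) w :=
      (contDiffAt_const.sub contDiffAt_id).rpow_const_of_ne (by simp; linarith)
    exact h1.mul contDiff_cutoff.contDiffAt
  · have h2 : (fun w : ℝ => (1 - w) ^ q * cutoff a ((1 + a) / 2) w) =ᶠ[𝓝 w] fun _ => 0 := by
      filter_upwards [Ioi_mem_nhds (show (1 + a) / 2 < w by linarith)] with x hx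
      rw [cutoff_eq_zero (by linarith) (le_of_lt hx), mul_zero]
    exact contDiffAt_const.congr_of_eventuallyEq h2

/-- The quotient `(v^b - 1) / (v - 1)`, with value `b` at `v = 1`. -/
def powSlope (b : ℝ) : ℝ → ℝ := dslope (fun v : ℝ => v ^ b) 1

theorem powSlope_of_ne {b v : ℝ} (hv : v ≠ 1) : powSlope b v = (v ^ b - 1) / (v - 1) := by
  rw [powSlope, dslope_of_ne _ hv, slope_def_field, Real.one_rpow]

theorem powSlope_pos {b v : ℝ} (hb : 0 < b) (hv : 0 < v) : 0 < powSlope b v := by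
  rcases lt_trichotomy v 1 with h | rfl | h
  · rw [powSlope_of_ne h.ne]
    exact div_pos_of_neg_of_neg (sub_neg.2 (Real.rpow_lt_one hv.le h hb)) (sub_neg.2 h)
  · rw [powSlope, dslope_same, (Real.hasDerivAt_rpow_const (Or.inl one_ne_zero)).deriv]
    simpa using hb
  · rw [powSlope_of_ne h.ne']
    exact div_pos (sub_pos.2 (Real.one_lt_rpow h hb)) (sub_pos.2 h)

/-- At `v = 1` the divided difference of the analytic function `v ^ b` is again analytic; elsewhere
on `(0, ∞)` it is a quotient of smooth functions. -/
theorem contDiffAt_powSlope {b v : ℝ} (hv : 0 < v) : ContDiffAt ℝ ∞ (powSlope b) v := by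
  rcases eq_or_ne v 1 with rfl | h
  · have h1 : AnalyticAt ℝ (fun v : ℝ => v ^ b) 1 := by
      have h2 : AnalyticAt ℝ (fun v : ℝ => Real.exp (Real.log v * b)) 1 := by
        refine AnalyticAt.rexp (AnalyticAt.mul ?_ analyticAt_const)
        exact analyticAt_id.log one_pos
      refine h2.congr ?_
      filter_upwards [Ioi_mem_nhds (zero_lt_one' ℝ)] with x hx
      rw [Real.rpow_def_of_pos hx]
    obtain ⟨q, hq⟩ := h1
    have h3 : AnalyticAt ℝ (powSlope b) 1 := ⟨_, hq.has_fpower_series_dslope_fslope⟩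
    exact h3.contDiffAt
  · have h1 : ContDiffAt ℝ ∞ (fun v : ℝ => (v ^ b - 1) / (v - 1)) v := by
      refine ContDiffAt.div ?_ (contDiffAt_id.sub contDiffAt_const) (sub_ne_zero.2 h)
      exact (contDiffAt_id.rpow_const_of_ne hv.ne').sub contDiffAt_const
    refine h1.congr_of_eventuallyEq ?_
    filter_upwards [isOpen_ne.mem_nhds h] with x hx
    exact powSlope_of_ne hx

/-- The first factor vanishes near `(-∞, 0]`, where the powers may fail to be smooth. On `(0, ∞)`
both slopes are smooth and positive, so their quotient has a smooth `δ`-th power. -/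
theorem contDiff_slope_quotient {b₁ b₂ : ℝ} (hb₁ : 0 < b₁) (hb₂ : 0 < b₂) (δ : ℝ) :
    ContDiff ℝ ∞ fun v : ℝ => (1 - cutoff (1 / 4) (1 / 2) v) *
      ((powSlope b₁ v / powSlope b₂ v) ^ δ * cutoff 1 2 v) := by
  rw [contDiff_iff_contDiffAt]
  intro v
  rcases lt_or_ge 0 v with hv | hv
  · have h1 : ContDiffAt ℝ ∞ (fun v : ℝ => (powSlope b₁ v / powSlope b₂ v) ^ δ) v :=
      ((contDiffAt_powSlope hv).div (contDiffAt_powSlope hv)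
        (powSlope_pos hb₂ hv).ne').rpow_const_of_ne
        (div_pos (powSlope_pos hb₁ hv) (powSlope_pos hb₂ hv)).ne'
    exact (contDiffAt_const.sub contDiff_cutoff.contDiffAt).mul
      (h1.mul contDiff_cutoff.contDiffAt)
  · have h2 : (fun v : ℝ => (1 - cutoff (1 / 4) (1 / 2) v) *
        ((powSlope b₁ v / powSlope b₂ v) ^ δ * cutoff 1 2 v)) =ᶠ[𝓝 v] fun _ => 0 := by
      filter_upwards [Iio_mem_nhds (show v < 1 / 4 by linarith)] with x hx
      rw [cutoff_eq_one (by norm_num) (le_of_lt hx), sub_self, zero_mul]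
    exact contDiffAt_const.congr_of_eventuallyEq h2

/-- The multiplier carrying the weights of exponent `2 b₂` to those of exponent `2 b₁`. -/
def comparison (b₁ b₂ δ v : ℝ) : ℝ :=
  cutoff (1 / 4) (1 / 2) v *
    (((1 - v ^ b₁) ^ δ * cutoff ((1 / 2) ^ b₁) ((1 + (1 / 2) ^ b₁) / 2) (v ^ b₁)) *
      ((1 - v ^ b₂) ^ (-δ) * cutoff ((1 / 2) ^ b₂) ((1 + (1 / 2) ^ b₂) / 2) (v ^ b₂))) +
    (1 - cutoff (1 / 4) (1 / 2) v) * ((powSlope b₁ v / powSlope b₂ v) ^ δ * cutoff 1 2 v)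

theorem radialMult_one_sub_rpow (p : ℝ≥0∞) [Fact (1 ≤ p)] {b : ℝ} (hb : 0 < b) (q : ℝ) :
    RadialMult (d + 1) p fun v =>
      (1 - v ^ b) ^ q * cutoff ((1 / 2) ^ b) ((1 + (1 / 2) ^ b) / 2) (v ^ b) := by
  have ha : (1 / 2 : ℝ) ^ b < 1 := Real.rpow_lt_one (by norm_num) (by norm_num) hb
  exact radialMult_comp_rpow
    (G := fun w => (1 - w) ^ q * cutoff ((1 / 2) ^ b) ((1 + (1 / 2) ^ b) / 2) w) hb
    (contDiff_one_sub_rpow_mul_cutoff ha q) (R := (1 + (1 / 2) ^ b) / 2)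
    fun w hw => by rw [cutoff_eq_zero (by linarith) hw.le, mul_zero]

theorem radialMult_of_contDiff (p : ℝ≥0∞) [Fact (1 ≤ p)] {G : ℝ → ℝ} (hG : ContDiff ℝ ∞ G) {R : ℝ}
    (hR : ∀ w, R < w → G w = 0) : RadialMult (d + 1) p G := by
  simpa only [Real.rpow_one] using radialMult_comp_rpow (d := d) (p := p) one_pos hG hR

/-- Near `v = 0` the quotient of weights is smooth only in `v^b₁` and `v^b₂` separately, so it is
handled as a product of a function of each. Near `v = 1` it is a smooth function of `v`, because the
common factor `1 - v` cancels. -/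
theorem radialMult_comparison (p : ℝ≥0∞) [Fact (1 ≤ p)] {b₁ b₂ : ℝ} (hb₁ : 0 < b₁)
    (hb₂ : 0 < b₂) (δ : ℝ) : RadialMult (d + 1) p (comparison b₁ b₂ δ) := by
  have h3 : RadialMult (d + 1) p (cutoff (1 / 4) (1 / 2)) :=
    radialMult_of_contDiff p contDiff_cutoff (R := 1 / 2)
      fun w hw => cutoff_eq_zero (by norm_num) hw.le
  have h4 := radialMult_of_contDiff (d := d) p (contDiff_slope_quotient hb₁ hb₂ δ) (R := 2)
    fun w hw => by rw [cutoff_eq_zero (by norm_num) hw.le, mul_zero, mul_zero]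
  exact (h3.mul ((radialMult_one_sub_rpow p hb₁ δ).mul (radialMult_one_sub_rpow p hb₂ (-δ)))).add h4

/-- On `[0, 1)` the cutoffs in `v^b₁` and `v^b₂` equal `1` for `v ≤ 1/2`, beyond which the outer
cutoff is zero. The two pieces therefore add up to the exact quotient. For `v ≥ 1` both sides
vanish. -/
theorem comparison_mul {b₁ b₂ δ : ℝ} (hb₁ : 0 < b₁) (hb₂ : 0 < b₂) (hδ : 0 < δ) {v : ℝ}
    (hv : 0 ≤ v) :
    (max (1 - v ^ b₁) 0) ^ δ = comparison b₁ b₂ δ v * (max (1 - v ^ b₂) 0) ^ δ := by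
  rcases lt_or_ge v 1 with hv1 | hv1
  · have e1 : 0 < 1 - v ^ b₁ := sub_pos.2 (Real.rpow_lt_one hv hv1 hb₁)
    have e2 : 0 < 1 - v ^ b₂ := sub_pos.2 (Real.rpow_lt_one hv hv1 hb₂)
    have e3 : powSlope b₁ v / powSlope b₂ v = (1 - v ^ b₁) / (1 - v ^ b₂) := by
      rw [powSlope_of_ne hv1.ne, powSlope_of_ne hv1.ne, div_div_div_cancel_right₀
        (sub_ne_zero.2 hv1.ne), ← neg_div_neg_eq, neg_sub, neg_sub]
    have e4 : ∀ b : ℝ, 0 < b → v ≤ 1 / 2 →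
        cutoff ((1 / 2) ^ b) ((1 + (1 / 2) ^ b) / 2) (v ^ b) = 1 := by
      intro b hb h
      have ha : (1 / 2 : ℝ) ^ b < 1 := Real.rpow_lt_one (by norm_num) (by norm_num) hb
      exact cutoff_eq_one (by linarith) (Real.rpow_le_rpow hv h hb.le)
    have e5 : comparison b₁ b₂ δ v = (1 - v ^ b₁) ^ δ * ((1 - v ^ b₂) ^ δ)⁻¹ := by
      rw [comparison, e3, Real.div_rpow e1.le e2.le, Real.rpow_neg e2.le,
        cutoff_eq_one (by norm_num : (1 : ℝ) < 2) hv1.le]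
      rcases le_or_gt v (1 / 2) with h | h
      · rw [e4 b₁ hb₁ h, e4 b₂ hb₂ h]
        ring
      · rw [cutoff_eq_zero (by norm_num) h.le]
        ring
    have e6 : (1 - v ^ b₂) ^ δ ≠ 0 := (Real.rpow_pos_of_pos e2 _).ne'
    rw [max_eq_left e1.le, max_eq_left e2.le, e5, inv_mul_cancel_right₀ e6]
  · have e1 : 1 - v ^ b₁ ≤ 0 := sub_nonpos.2 (Real.one_le_rpow hv1 hb₁.le)
    have e2 : 1 - v ^ b₂ ≤ 0 := sub_nonpos.2 (Real.one_le_rpow hv1 hb₂.le)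
    rw [max_eq_right e1, max_eq_right e2, Real.zero_rpow hδ.ne', mul_zero]

theorem weight_eq (β δ : ℝ) {n : ℕ} (hn : 1 ≤ n) (k : Fin d → ℤ) :
    weight β δ n k = (max (1 - (eucl k ^ 2 / (n : ℝ) ^ 2) ^ (β / 2)) 0) ^ δ := by
  have hpos : (0 : ℝ) < n := by exact_mod_cast hn
  have h : ∀ x : ℝ, 0 ≤ x → (x ^ 2) ^ (β / 2) = x ^ β := by
    intro x hx
    rw [← Real.rpow_natCast, ← Real.rpow_mul hx]
    congr 1
    push_cast
    ring
  rw [weight, Real.div_rpow (by positivity) (by positivity), h _ (eucl_nonneg k), h _ hpos.le]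

/-- Convergence in `L_p` does not depend on the exponent `β`. -/
theorem ConvergesInLp.of_exponent (p : ℝ≥0∞) [Fact (1 ≤ p)] {β β' δ : ℝ} (hβ : 0 < β)
    (hβ' : 0 < β') (hδ : 0 < δ) (h : ConvergesInLp p (mean (d + 1) β' δ)) :
    ConvergesInLp p (mean (d + 1) β δ) := by
  rw [convergesInLp_iff p hβ hδ]
  rw [convergesInLp_iff p hβ' hδ] at h
  obtain ⟨C, hC⟩ := h
  obtain ⟨C', hC', hΨ⟩ := radialMult_comparison (d := d) p (half_pos hβ) (half_pos hβ') δ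
  refine ⟨C' * C, fun n hn => ?_⟩
  have hn' : (0 : ℝ) < n := by exact_mod_cast hn
  have h1 := (hΨ ((n : ℝ) ^ 2) (by positivity)).mul (hC n hn) hC'
  convert h1 using 2 with k
  rw [weight_eq β δ hn, weight_eq β' δ hn, comparison_mul (half_pos hβ) (half_pos hβ') hδ (by positivity)]
  push_cast
  rfl

/-- The means converge in `L_p` above the critical index. -/
theorem convergesInLp_of_critical_lt (p : ℝ≥0∞) [Fact (1 ≤ p)] {β δ : ℝ} (hβ : 0 < β)
    (hδ : 0 < δ) (hd : (d : ℝ) / 2 < δ) : ConvergesInLp p (mean (d + 1) β δ) := by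
  refine ConvergesInLp.of_exponent p hβ two_pos hδ ?_
  rw [convergesInLp_iff p two_pos hδ]
  obtain ⟨C, _, hC⟩ := exists_multBdd_riesz p hδ hd
  refine ⟨C, fun n hn => ?_⟩
  have hn' : (0 : ℝ) < n := by exact_mod_cast hn
  convert hC ((n : ℝ) ^ 2) (by positivity) using 2 with k
  rw [weight_eq 2 δ hn]
  simp

end BochnerRiesz

end

noncomputable section

namespace BochnerRiesz

variable {d : ℕ}

/-! ### A de la Vallée Poussin kernel -/

theorem card_cube (d n : ℕ) : (cube d n).card = (2 * n + 1) ^ d := by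
  simp only [cube, Fintype.card_piFinset, Int.card_Icc, Finset.prod_const, Finset.card_univ,
    Fintype.card_fin]
  congr 1
  omega

theorem mem_cube {n : ℕ} {k : Fin d → ℤ} : k ∈ cube d n ↔ ∀ j, -(n : ℤ) ≤ k j ∧ k j ≤ n := by
  simp [cube, Fintype.mem_piFinset]

theorem neg_mem_cube {n : ℕ} {k : Fin d → ℤ} : -k ∈ cube d n ↔ k ∈ cube d n := by
  simp only [mem_cube, Pi.neg_apply]
  exact forall_congr' fun j => by omega

theorem sum_cube_neg {M : Type*} [AddCommMonoid M] (n : ℕ) (f : (Fin d → ℤ) → M) :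
    ∑ k ∈ cube d n, f (-k) = ∑ k ∈ cube d n, f k :=
  Finset.sum_equiv (Equiv.neg _) (fun k => by simpa using neg_mem_cube.symm) fun k _ => rfl

/-- The cubic Dirichlet kernel. -/
def dirichlet (d n : ℕ) (x : Torus d) : ℂ := ∑ k ∈ cube d n, character k x

theorem continuous_dirichlet (n : ℕ) : Continuous (dirichlet d n) :=
  continuous_finsetSum _ fun k _ => continuous_character k

theorem norm_dirichlet_le (n : ℕ) (x : Torus d) : ‖dirichlet d n x‖ ≤ (2 * n + 1) ^ d := by
  refine (norm_sum_le _ _).trans ?_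
  simp [norm_character, card_cube]

/-- A de la Vallée Poussin kernel: its Fourier coefficients are `1` on the cube of size `n`. -/
def vallee (d n : ℕ) (x : Torus d) : ℂ :=
  ((2 * n + 1 : ℂ) ^ d)⁻¹ * (dirichlet d (2 * n) x * dirichlet d n x)

theorem continuous_vallee (n : ℕ) : Continuous (vallee d n) :=
  continuous_const.mul ((continuous_dirichlet _).mul (continuous_dirichlet _))

theorem integrable_of_continuous {E : Type*} [NormedAddCommGroup E] {f : Torus d → E}
    (hf : Continuous f) : Integrable f volume :=
  hf.integrable_of_hasCompactSupport (HasCompactSupport.of_compactSpace f)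

theorem memLp_of_continuous {E : Type*} [NormedAddCommGroup E] {f : Torus d → E}
    (hf : Continuous f) (q : ℝ≥0∞) : MemLp f q volume := by
  obtain ⟨C, hC⟩ := isCompact_univ.exists_bound_of_continuousOn hf.continuousOn
  exact MemLp.of_bound (integrable_of_continuous hf).aestronglyMeasurable C
    (ae_of_all _ fun x => hC x (Set.mem_univ x))

theorem integral_sum_mul_character {f : Torus d → ℂ} (hf : Continuous f)
    (s : Finset (Fin d → ℤ)) (c : (Fin d → ℤ) → ℂ) :
    ∫ x, ∑ k ∈ s, c k * (f x * character k x) = ∑ k ∈ s, c k * ∫ x, f x * character k x := by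
  have h : ∀ k ∈ s, Integrable (fun x => c k * (f x * character k x)) volume := fun k _ =>
    integrable_of_continuous (continuous_const.mul (hf.mul (continuous_character k)))
  rw [integral_finsetSum _ h]
  exact Finset.sum_congr rfl fun k _ => integral_const_mul _ _

/-- For `k` and `b` in the cube of size `n`, the frequency `-(b + k)` lies in the cube of size `2n`,
so each `b` contributes exactly one nonzero term. -/
theorem integral_vallee_mul_character {n : ℕ} {k : Fin d → ℤ} (hk : k ∈ cube d n) :
    ∫ x, vallee d n x * character k x = (((2 * Real.pi) ^ d : ℝ) : ℂ) := by
  have h1 : ∀ x : Torus d, vallee d n x * character k x = ((2 * n + 1 : ℂ) ^ d)⁻¹ *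
      ∑ b ∈ cube d n, ∑ a ∈ cube d (2 * n), character (a + (b + k)) x := by
    intro x
    simp only [vallee, dirichlet, character_add, ← Finset.sum_mul, ← Finset.mul_sum, mul_assoc]
  simp only [h1]
  rw [integral_const_mul, integral_finsetSum _ fun b _ => integrable_of_continuous
    (continuous_finsetSum _ fun a _ => continuous_character _)]
  have h2 : ∀ b ∈ cube d n, ∫ x : Torus d, ∑ a ∈ cube d (2 * n), character (a + (b + k)) x =
      (((2 * Real.pi) ^ d : ℝ) : ℂ) := by
    intro b hb
    rw [integral_finsetSum _ fun a _ => integrable_of_continuous (continuous_character _)]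
    simp only [integral_character]
    rw [Finset.sum_eq_single (-(b + k))]
    · simp
    · intro a _ ha
      rw [if_neg]
      rwa [← eq_neg_iff_add_eq_zero]
    · intro h
      exfalso
      apply h
      rw [mem_cube] at *
      intro j
      have := hk j
      have := hb j
      simp only [Pi.neg_apply, Pi.add_apply]
      push_cast
      omega
  rw [Finset.sum_congr rfl h2, Finset.sum_const, card_cube, nsmul_eq_mul]
  have h3 : (2 * n + 1 : ℂ) ^ d ≠ 0 := by
    have : (2 * n + 1 : ℂ) ≠ 0 := by exact_mod_cast (Nat.succ_ne_zero (2 * n))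
    exact pow_ne_zero _ this
  push_cast
  rw [inv_mul_cancel_left₀ h3]

theorem integral_norm_sq_dirichlet (n : ℕ) :
    ∫ x, ‖dirichlet d n x‖ ^ 2 = (2 * n + 1) ^ d * (2 * Real.pi) ^ d := by
  have h1 : ∀ x : Torus d, ((‖dirichlet d n x‖ ^ 2 : ℝ) : ℂ) =
      ∑ b ∈ cube d n, ∑ a ∈ cube d n, character (a + -b) x := by
    intro x
    push_cast
    rw [← Complex.mul_conj']
    simp only [dirichlet, character_add, character_neg, map_sum, ← Finset.sum_mul,
      ← Finset.mul_sum]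
  have h2 : ((∫ x, ‖dirichlet d n x‖ ^ 2 : ℝ) : ℂ) = (2 * n + 1) ^ d * (2 * Real.pi) ^ d := by
    rw [← integral_complex_ofReal]
    simp only [h1]
    rw [integral_finsetSum _ fun b _ => integrable_of_continuous
      (continuous_finsetSum _ fun a _ => continuous_character _)]
    have h3 : ∀ b ∈ cube d n, ∫ x : Torus d, ∑ a ∈ cube d n, character (a + -b) x =
        (((2 * Real.pi) ^ d : ℝ) : ℂ) := by
      intro b hb
      rw [integral_finsetSum _ fun a _ => integrable_of_continuous (continuous_character _)]
      simp only [integral_character]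
      rw [Finset.sum_eq_single b]
      · simp
      · intro a _ ha
        rw [if_neg]
        rwa [← sub_eq_add_neg, sub_eq_zero]
      · exact fun h => absurd hb h
    rw [Finset.sum_congr rfl h3, Finset.sum_const, card_cube, nsmul_eq_mul]
    push_cast
    rfl
  exact_mod_cast h2

theorem norm_vallee (n : ℕ) (x : Torus d) :
    ‖vallee d n x‖ = ((2 * n + 1 : ℝ) ^ d)⁻¹ * (‖dirichlet d (2 * n) x‖ * ‖dirichlet d n x‖) := by
  have : ‖(2 * n + 1 : ℂ)‖ = 2 * n + 1 := by
    have := Complex.norm_natCast (2 * n + 1)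
    push_cast at this
    exact this
  rw [vallee, norm_mul, norm_mul, norm_inv, norm_pow, this]

theorem norm_vallee_le (n : ℕ) (x : Torus d) : ‖vallee d n x‖ ≤ (4 * n + 1) ^ d := by
  rw [norm_vallee, inv_mul_le_iff₀ (by positivity), mul_comm]
  have h1 := norm_dirichlet_le n x
  have h2 := norm_dirichlet_le (2 * n) x
  push_cast at h2
  refine mul_le_mul h1 (h2.trans (le_of_eq ?_)) (norm_nonneg _) (by positivity)
  ring

/-- Parseval and `2xy ≤ x² + y²`: the squared `L_2` norm of the larger Dirichlet kernel is at most
`2^d` times that bound for the smaller, and the normalizing factor cancels the growth in `n`. -/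
theorem integral_norm_vallee_le (n : ℕ) : ∫ x, ‖vallee d n x‖ ≤ (4 * Real.pi) ^ d := by
  have hD : ∀ m, Continuous fun x => ‖dirichlet d m x‖ ^ 2 :=
    fun m => (continuous_dirichlet (d := d) m).norm.pow 2
  have h1 : ∫ x, ‖vallee d n x‖ ≤ ∫ x, ((2 * n + 1 : ℝ) ^ d)⁻¹ *
      ((‖dirichlet d (2 * n) x‖ ^ 2 + ‖dirichlet d n x‖ ^ 2) / 2) := by
    refine integral_mono (integrable_of_continuous (continuous_vallee n).norm)
      (integrable_of_continuous ?_) fun x => ?_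
    · exact continuous_const.mul (((hD _).add (hD _)).div_const 2)
    · simp only [norm_vallee]
      gcongr
      nlinarith [sq_nonneg (‖dirichlet d (2 * n) x‖ - ‖dirichlet d n x‖)]
  refine h1.trans ?_
  rw [integral_const_mul, integral_div, integral_add (integrable_of_continuous (hD _))
    (integrable_of_continuous (hD _)), integral_norm_sq_dirichlet,
    integral_norm_sq_dirichlet, inv_mul_le_iff₀ (by positivity)]
  push_cast
  have h2 : (2 * (2 * n) + 1 : ℝ) ^ d ≤ 2 ^ d * (2 * n + 1) ^ d := by
    rw [← mul_pow]
    gcongr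
    linarith
  have h3 : (2 * n + 1 : ℝ) ^ d ≤ 2 ^ d * (2 * n + 1) ^ d :=
    le_mul_of_one_le_left (by positivity) (one_le_pow₀ (by norm_num))
  have h4 : (4 * Real.pi) ^ d = 2 ^ d * (2 * Real.pi) ^ d := by
    rw [← mul_pow]; congr 1; ring
  have h5 : 0 < (2 * Real.pi) ^ d := by positivity
  rw [h4]
  nlinarith

/-- The `L_q` norms of the de la Vallée Poussin kernels. -/
theorem eLpNorm_vallee_le {q : ℝ≥0∞} (hq : 1 ≤ q) (hq' : q ≠ ∞) (n : ℕ) :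
    (eLpNorm (vallee d n) q volume).toReal ≤
      (4 * Real.pi) ^ d * ((4 * n + 1 : ℝ) ^ d) ^ (1 - (q⁻¹).toReal) := by
  have hq0 : q ≠ 0 := (zero_lt_one.trans_le hq).ne'
  have hr : 1 ≤ q.toReal := by
    rw [← ENNReal.toReal_one]
    exact ENNReal.toReal_mono hq' hq
  set r := q.toReal with hrdef
  have hr0 : 0 < r := by linarith
  set M : ℝ := (4 * n + 1 : ℝ) ^ d with hM
  have hM1 : 0 < M := by positivity
  have hmem : MemLp (vallee d n) q volume := memLp_of_continuous (continuous_vallee n) q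
  rw [hmem.eLpNorm_eq_integral_rpow_norm hq0 hq', ENNReal.toReal_ofReal (by positivity),
    ENNReal.toReal_inv]
  -- Interpolation between the uniform `L_1` bound and the sup bound `M`.
  have h1 : ∫ x, ‖vallee d n x‖ ^ r ≤ M ^ (r - 1) * (4 * Real.pi) ^ d := by
    have h2 : ∫ x, ‖vallee d n x‖ ^ r ≤ ∫ x, M ^ (r - 1) * ‖vallee d n x‖ := by
      refine integral_mono (integrable_of_continuous
        ((continuous_vallee n).norm.rpow_const fun _ => Or.inr hr0.le))
        (integrable_of_continuous (continuous_const.mul (continuous_vallee n).norm)) fun x => ?_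
      have h3 : ‖vallee d n x‖ ^ r = ‖vallee d n x‖ ^ (r - 1) * ‖vallee d n x‖ := by
        rw [← Real.rpow_add_one' (norm_nonneg _) (by linarith), sub_add_cancel]
      simp only
      rw [h3]
      exact mul_le_mul_of_nonneg_right (Real.rpow_le_rpow (norm_nonneg _) (norm_vallee_le n x)
        (by linarith)) (norm_nonneg _)
    rw [integral_const_mul] at h2
    refine h2.trans ?_
    gcongr
    exact integral_norm_vallee_le n
  have h4 : (1 : ℝ) ≤ (4 * Real.pi) ^ d := one_le_pow₀ (by linarith [Real.pi_gt_three])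
  calc (∫ x, ‖vallee d n x‖ ^ r) ^ r⁻¹ ≤ (M ^ (r - 1) * (4 * Real.pi) ^ d) ^ r⁻¹ :=
        Real.rpow_le_rpow (by positivity) h1 (by positivity)
    _ = M ^ (1 - r⁻¹) * ((4 * Real.pi) ^ d) ^ r⁻¹ := by
        rw [Real.mul_rpow (by positivity) (by positivity), ← Real.rpow_mul hM1.le]
        congr 2
        field_simp
    _ ≤ M ^ (1 - r⁻¹) * ((4 * Real.pi) ^ d) ^ (1 : ℝ) := by
        gcongr
        exact inv_le_one_of_one_le₀ hr
    _ = (4 * Real.pi) ^ d * M ^ (1 - r⁻¹) := by rw [Real.rpow_one, mul_comm]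

/-! ### Testing the means on the de la Vallée Poussin kernels -/

theorem norm_integral_mul_le {q q' : ℝ≥0∞} [ENNReal.HolderConjugate q q'] {f g : Torus d → ℂ}
    (hf : Continuous f) (hg : Continuous g) :
    ‖∫ x, f x * g x‖ ≤ (eLpNorm f q volume).toReal * (eLpNorm g q' volume).toReal := by
  have hmem : ∀ (r : ℝ≥0∞) (h : Torus d → ℂ), Continuous h → eLpNorm h r volume ≠ ∞ :=
    fun r h hh => (memLp_of_continuous hh r).2.ne
  have h1 : eLpNorm (f • g) 1 volume ≤ eLpNorm f q volume * eLpNorm g q' volume :=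
    eLpNorm_smul_le_mul_eLpNorm hg.aestronglyMeasurable hf.aestronglyMeasurable
  rw [← ENNReal.toReal_mul, ← toReal_enorm]
  refine ENNReal.toReal_mono (ENNReal.mul_ne_top (hmem q f hf) (hmem q' g hg)) ?_
  refine (enorm_integral_le_lintegral_enorm _).trans ?_
  rw [eLpNorm_one_eq_lintegral_enorm] at h1
  simpa using h1

theorem pairing_toLp (p : ℝ≥0∞) [Fact (1 ≤ p)] (k : Fin d → ℤ) (g : C(Torus d, ℂ)) :
    pairing p k (ContinuousMap.toLp (E := ℂ) p volume ℂ g) = ∫ x, g x * character k x := by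
  rw [pairing_apply]
  refine integral_congr_ae ?_
  filter_upwards [ContinuousMap.coeFn_toLp (p := p) (𝕜 := ℂ) (volume : Measure (Torus d)) g]
    with x hx
  rw [hx]

theorem norm_toLp_eq (p : ℝ≥0∞) [Fact (1 ≤ p)] (g : C(Torus d, ℂ)) :
    ‖ContinuousMap.toLp (E := ℂ) p (volume : Measure (Torus d)) ℂ g‖ =
      (eLpNorm g p volume).toReal := by
  rw [Lp.norm_def]
  exact congrArg _ (eLpNorm_congr_ae (ContinuousMap.coeFn_toLp _ g))

theorem norm_meanOp_toLp_le (p : ℝ≥0∞) [Fact (1 ≤ p)] {C β δ : ℝ} (hβ : 0 < β) (hδ : 0 < δ) {n : ℕ}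
    (hn : 1 ≤ n) (h : MultBdd (characterLp p (d := d)) C fun k => (weight β δ n k : ℂ))
    (g : C(Torus d, ℂ)) :
    (eLpNorm (fun x : Torus d => ∑ k ∈ cube d n, ((((2 * Real.pi) ^ d : ℝ) : ℂ)⁻¹ *
      (weight β δ n k : ℂ) * ∫ y, g y * character (-k) y) * character k x) p volume).toReal ≤
      C * (eLpNorm g p volume).toReal := by
  have h1 := h.norm_le_of_mem_closure _ (meanOp_sum p hβ hδ hn) (toLp_mem_trigClosure p g)
  rw [norm_toLp_eq, meanOp, multOp_apply] at h1
  simp only [pairing_toLp] at h1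
  rw [← sum_cube_neg] at h1
  simp only [neg_neg, weight_neg] at h1
  rwa [norm_sum_characterLp] at h1

/-- The mean of the de la Vallée Poussin kernel is the Bochner–Riesz kernel itself. If `q = p` the
mean is applied to that kernel; if `q' = p` it is moved onto `g`, the weights being even. One
inequality thus serves an exponent and its conjugate. -/
theorem norm_integral_kernel_mul_le (p : ℝ≥0∞) [Fact (1 ≤ p)] {C β δ : ℝ} (hβ : 0 < β)
    (hδ : 0 < δ) {n : ℕ} (hn : 1 ≤ n)
    (h : MultBdd (characterLp p (d := d)) C fun k => (weight β δ n k : ℂ))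
    {q q' : ℝ≥0∞} [ENNReal.HolderConjugate q q'] (hqp : q = p ∨ q' = p) {g : Torus d → ℂ}
    (hg : Continuous g) :
    ‖∫ x, (∑ k ∈ cube d n, (weight β δ n k : ℂ) * character k x) * g x‖ ≤
      C * (eLpNorm (vallee d n) q volume).toReal * (eLpNorm g q' volume).toReal := by
  have hpi : (((2 * Real.pi) ^ d : ℝ) : ℂ) ≠ 0 := by
    exact_mod_cast (pow_pos Real.two_pi_pos d).ne'
  have hcont : ∀ c : (Fin d → ℤ) → ℂ, Continuous fun x : Torus d =>
      ∑ k ∈ cube d n, c k * character k x := fun c =>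
    continuous_finsetSum _ fun k _ => continuous_const.mul (continuous_character k)
  rcases hqp with rfl | rfl
  · refine (norm_integral_mul_le (q := q) (q' := q') (hcont _) hg).trans ?_
    gcongr
    have h1 := norm_meanOp_toLp_le q hβ hδ hn h ⟨vallee d n, continuous_vallee n⟩
    refine le_trans (le_of_eq ?_) h1
    congr 2
    ext x
    refine Finset.sum_congr rfl fun k hk => ?_
    simp only [ContinuousMap.coe_mk]
    rw [integral_vallee_mul_character (neg_mem_cube.2 hk), mul_right_comm _ _ (((2 * Real.pi) ^ d : ℝ) : ℂ),
      inv_mul_cancel₀ hpi, one_mul]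
  · have h1 := norm_meanOp_toLp_le q' hβ hδ hn h ⟨g, hg⟩
    have h2 := norm_integral_mul_le (q := q) (q' := q') (continuous_vallee (d := d) n)
      (hcont fun k => (((2 * Real.pi) ^ d : ℝ) : ℂ)⁻¹ *
      (weight β δ n k : ℂ) * ∫ y, g y * character (-k) y)
    have h3 : ∫ x, vallee d n x * ∑ k ∈ cube d n, ((((2 * Real.pi) ^ d : ℝ) : ℂ)⁻¹ *
        (weight β δ n k : ℂ) * ∫ y, g y * character (-k) y) * character k x =
        ∫ x, (∑ k ∈ cube d n, (weight β δ n k : ℂ) * character k x) * g x := by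
      have e1 : ∀ x, vallee d n x * ∑ k ∈ cube d n, ((((2 * Real.pi) ^ d : ℝ) : ℂ)⁻¹ *
          (weight β δ n k : ℂ) * ∫ y, g y * character (-k) y) * character k x =
          ∑ k ∈ cube d n, ((((2 * Real.pi) ^ d : ℝ) : ℂ)⁻¹ *
          (weight β δ n k : ℂ) * ∫ y, g y * character (-k) y) *
            (vallee d n x * character k x) := by
        intro x
        rw [Finset.mul_sum]
        exact Finset.sum_congr rfl fun k _ => by ring
      have e2 : ∀ x, (∑ k ∈ cube d n, (weight β δ n k : ℂ) * character k x) * g x =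
          ∑ k ∈ cube d n, (weight β δ n k : ℂ) * (g x * character k x) := by
        intro x
        rw [Finset.sum_mul]
        exact Finset.sum_congr rfl fun k _ => by ring
      simp only [e1, e2]
      rw [integral_sum_mul_character (continuous_vallee n), integral_sum_mul_character hg,
        ← sum_cube_neg]
      refine Finset.sum_congr rfl fun k hk => ?_
      rw [integral_vallee_mul_character (neg_mem_cube.2 hk), neg_neg, weight_neg]
      field_simp
    rw [← h3]
    refine h2.trans ?_
    rw [mul_comm C, mul_assoc]
    gcongr
    exact h1

end BochnerRiesz

end

noncomputable section

namespace BochnerRiesz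

open scoped Pointwise

variable {d : ℕ}

/-! ### From the torus to the Euclidean space -/

/-- The Euclidean distance of `(e^{i x_j})_j` to `(1, …, 1)`. -/
def chord (x : Torus d) : ℝ := Real.sqrt (∑ j, ‖(fourier 1 (x j) : ℂ) - 1‖ ^ 2)

theorem continuous_chord : Continuous (chord : Torus d → ℝ) := by
  unfold chord
  fun_prop

theorem norm_fourier_one_sub_one (y : ℝ) :
    ‖(fourier 1 (y : AddCircle (2 * Real.pi)) : ℂ) - 1‖ = 2 * |Real.sin (y / 2)| := by
  have h : (fourier 1 (y : AddCircle (2 * Real.pi)) : ℂ) = Complex.exp (Complex.I * y) := by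
    rw [fourier_coe_apply]
    congr 1
    have : (Real.pi : ℂ) ≠ 0 := by exact_mod_cast Real.pi_ne_zero
    push_cast
    field_simp
  rw [h, Complex.norm_exp_I_mul_ofReal_sub_one, norm_mul]
  simp

/-- Jordan's inequality for the sine. It confines a function of `n * chord` with bounded support to
a ball of radius proportional to `1 / n` in the fundamental cube. -/
theorem abs_le_chord {y : Fin d → ℝ} (hy : ∀ j, |y j| ≤ Real.pi) (j : Fin d) :
    2 / Real.pi * |y j| ≤ chord (toTorus y) := by
  have h1 : 2 / Real.pi * |y j / 2| ≤ |Real.sin (y j / 2)| := by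
    refine Real.mul_abs_le_abs_sin ?_
    rw [abs_div, abs_two]
    linarith [hy j]
  rw [abs_div, abs_two] at h1
  unfold chord
  refine Real.le_sqrt_of_sq_le ?_
  have h2 := Finset.single_le_sum (f := fun j => ‖(fourier 1 (toTorus y j) : ℂ) - 1‖ ^ 2)
    (fun i _ => sq_nonneg _) (Finset.mem_univ j)
  refine le_trans ?_ h2
  simp only [toTorus]
  rw [norm_fourier_one_sub_one]
  have : 0 ≤ 2 / Real.pi * |y j| := by positivity
  exact pow_le_pow_left₀ this (by linarith) 2

theorem tendsto_mul_abs_sin (t : ℝ) :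
    Tendsto (fun n : ℕ => (n : ℝ) * (2 * |Real.sin ((n : ℝ)⁻¹ * t / 2)|)) atTop (𝓝 |t|) := by
  have h1 : HasDerivAt (fun u : ℝ => 2 * Real.sin (u * t / 2)) t 0 := by
    have h2 : HasDerivAt (fun u : ℝ => u * t / 2) (t / 2) 0 := by
      simpa using ((hasDerivAt_id (0 : ℝ)).mul_const t).div_const 2
    exact (h2.sin.const_mul 2).congr_deriv (by simp; ring)
  have h3 : Tendsto (fun n : ℕ => ((n : ℝ))⁻¹) atTop (𝓝[≠] 0) := by
    refine tendsto_nhdsWithin_iff.2 ⟨tendsto_inv_atTop_zero.comp tendsto_natCast_atTop_atTop, ?_⟩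
    filter_upwards [eventually_ge_atTop 1] with n hn
    have : (n : ℝ) ≠ 0 := by positivity
    simpa using this
  have h4 := (h1.tendsto_slope_zero.comp h3).abs
  refine h4.congr fun n => ?_
  simp [abs_mul]

theorem tendsto_mul_chord (z : Fin d → ℝ) :
    Tendsto (fun n : ℕ => (n : ℝ) * chord (toTorus ((n : ℝ)⁻¹ • z))) atTop
      (𝓝 (Real.sqrt (∑ j, z j ^ 2))) := by
  have h1 : ∀ n : ℕ, (n : ℝ) * chord (toTorus ((n : ℝ)⁻¹ • z)) =
      Real.sqrt (∑ j, ((n : ℝ) * (2 * |Real.sin ((n : ℝ)⁻¹ * z j / 2)|)) ^ 2) := by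
    intro n
    simp only [chord, toTorus, norm_fourier_one_sub_one, Pi.smul_apply, smul_eq_mul, mul_pow (n : ℝ),
      ← Finset.mul_sum]
    rw [Real.sqrt_mul (by positivity), Real.sqrt_sq (by positivity)]
  simp only [h1]
  have h2 : Tendsto (fun n : ℕ => ∑ j, ((n : ℝ) * (2 * |Real.sin ((n : ℝ)⁻¹ * z j / 2)|)) ^ 2)
      atTop (𝓝 (∑ j, |z j| ^ 2)) :=
    tendsto_finsetSum _ fun j _ => (tendsto_mul_abs_sin (z j)).pow 2
  simp only [sq_abs] at h2
  exact (Real.continuous_sqrt.tendsto _).comp h2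

/-- The fundamental cube `(-π, π]^d`. -/
def fundCube (d : ℕ) : Set (Fin d → ℝ) := Set.univ.pi fun _ => Set.Ioc (-Real.pi) Real.pi

theorem measurePreserving_toTorus :
    MeasurePreserving (toTorus : (Fin d → ℝ) → Torus d) (volume.restrict (fundCube d)) volume := by
  have h1 := AddCircle.measurePreserving_mk (2 * Real.pi) (-Real.pi)
  rw [show -Real.pi + 2 * Real.pi = Real.pi by ring] at h1
  have h2 := measurePreserving_pi (fun _ : Fin d => volume.restrict (Set.Ioc (-Real.pi) Real.pi))
    (fun _ : Fin d => (volume : Measure (AddCircle (2 * Real.pi)))) fun _ => h1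
  rw [← Measure.restrict_pi_pi] at h2
  exact h2

theorem measurableSet_fundCube : MeasurableSet (fundCube d) :=
  MeasurableSet.univ_pi fun _ => measurableSet_Ioc

theorem integral_torus_eq {φ : Torus d → ℝ} (hφ : Continuous φ) {n : ℕ} (hn : 1 ≤ n) :
    (n : ℝ) ^ d * ∫ x, φ x =
      ∫ z : Fin d → ℝ, (fundCube d).indicator (fun y => φ (toTorus y)) ((n : ℝ)⁻¹ • z) := by
  have hn' : (0 : ℝ) < n := by exact_mod_cast hn
  rw [Measure.integral_comp_smul, integral_indicator measurableSet_fundCube,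
    Module.finrank_fin_fun, inv_pow, inv_inv, abs_of_pos (by positivity), smul_eq_mul,
    ← (measurePreserving_toTorus (d := d)).map_eq,
    integral_map (measurePreserving_toTorus (d := d)).aemeasurable hφ.aestronglyMeasurable]

/-- Integrals over the torus of functions concentrating at `0` at scale `1/n`. -/
theorem tendsto_pow_mul_integral {φ : ℕ → Torus d → ℝ} {Φ : (Fin d → ℝ) → ℝ} {M A : ℝ}
    (hA0 : 0 ≤ A) (hφ : ∀ n, Continuous (φ n)) (hM : ∀ n, 1 ≤ n → ∀ x, |φ n x| ≤ M)
    (hA : ∀ n : ℕ, 1 ≤ n → ∀ x, A ≤ n * chord x → φ n x = 0)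
    (hlim : ∀ z, Tendsto (fun n : ℕ => φ n (toTorus ((n : ℝ)⁻¹ • z))) atTop (𝓝 (Φ z))) :
    Tendsto (fun n : ℕ => (n : ℝ) ^ d * ∫ x, φ n x) atTop (𝓝 (∫ z, Φ z)) := by
  have hev : (fun n : ℕ => ∫ z : Fin d → ℝ,
      (fundCube d).indicator (fun y => φ n (toTorus y)) ((n : ℝ)⁻¹ • z)) =ᶠ[atTop]
      fun n : ℕ => (n : ℝ) ^ d * ∫ x, φ n x := by
    filter_upwards [eventually_ge_atTop 1] with n hn
    exact (integral_torus_eq (hφ n) hn).symm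
  refine Tendsto.congr' hev ?_
  have hM0 : 0 ≤ M := (abs_nonneg _).trans (hM 1 le_rfl 0)
  -- The radius `π/2 * A` comes from `abs_le_chord`: outside that ball, a rescaled point of the
  -- fundamental cube has `n * chord ≥ A`.
  refine tendsto_integral_filter_of_dominated_convergence
    ((Metric.closedBall (0 : Fin d → ℝ) (Real.pi / 2 * A)).indicator fun _ => M) ?_ ?_ ?_ ?_
  · refine .of_forall fun n => ?_
    have h1 : Measurable fun y : Fin d → ℝ => φ n (toTorus y) :=
      (hφ n).measurable.comp (measurable_pi_iff.2 fun j =>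
        AddCircle.measurable_mk'.comp (measurable_pi_apply j))
    exact ((h1.indicator measurableSet_fundCube).comp
      (measurable_const_smul (n : ℝ)⁻¹)).aestronglyMeasurable
  · filter_upwards [eventually_ge_atTop 1] with n hn
    refine ae_of_all _ fun z => ?_
    have hn' : (0 : ℝ) < n := by exact_mod_cast hn
    by_cases hz : (n : ℝ)⁻¹ • z ∈ fundCube d
    · rw [Set.indicator_of_mem hz]
      by_cases hzA : z ∈ Metric.closedBall (0 : Fin d → ℝ) (Real.pi / 2 * A)
      · rw [Set.indicator_of_mem hzA]
        exact hM n hn _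
      · rw [Set.indicator_of_notMem hzA]
        rw [hA n hn, norm_zero]
        by_contra! hlt
        apply hzA
        rw [mem_closedBall_zero_iff, pi_norm_le_iff_of_nonneg (by positivity)]
        intro j
        have h2 := abs_le_chord (y := (n : ℝ)⁻¹ • z) (fun j => by
          have := hz j (Set.mem_univ j)
          exact abs_le.2 ⟨this.1.le, this.2⟩) j
        rw [Pi.smul_apply, smul_eq_mul, abs_mul, abs_of_pos (inv_pos.2 hn')] at h2
        have h3 : (n : ℝ) * (2 / Real.pi * ((n : ℝ)⁻¹ * |z j|)) ≤ A :=
          (mul_le_mul_of_nonneg_left h2 hn'.le).trans hlt.le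
        have h4 : (n : ℝ) * (2 / Real.pi * ((n : ℝ)⁻¹ * |z j|)) = 2 / Real.pi * |z j| := by
          field_simp
        rw [h4, div_mul_eq_mul_div, div_le_iff₀ Real.pi_pos] at h3
        rw [Real.norm_eq_abs]
        linarith
    · rw [Set.indicator_of_notMem hz, norm_zero]
      exact Set.indicator_nonneg (fun _ _ => hM0) _
  · rw [integrable_indicator_iff Metric.isClosed_closedBall.measurableSet]
    exact integrableOn_const (measure_closedBall_lt_top).ne
  · refine ae_of_all _ fun z => ?_
    refine (hlim z).congr' ?_
    have h5 : ∀ᶠ n : ℕ in atTop, ∀ j, (n : ℝ)⁻¹ * z j ∈ Set.Ioc (-Real.pi) Real.pi := by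
      rw [eventually_all]
      intro j
      have h6 : Tendsto (fun n : ℕ => (n : ℝ)⁻¹ * z j) atTop (𝓝 (0 * z j)) :=
        (tendsto_inv_atTop_zero.comp tendsto_natCast_atTop_atTop).mul_const _
      rw [zero_mul] at h6
      exact h6.eventually (Ioc_mem_nhds (by linarith [Real.pi_pos]) Real.pi_pos)
    filter_upwards [h5] with n hn
    rw [Set.indicator_of_mem]
    exact fun j _ => hn j

/-! ### Riemann sums for the kernel -/

theorem inter_smul_lattice_eq {n : ℕ} (hn : 1 ≤ n) :
    Metric.closedBall (0 : Fin d → ℝ) 1 ∩ (n : ℝ)⁻¹ •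
      (Submodule.span ℤ (Set.range (Pi.basisFun ℝ (Fin d))) : Set (Fin d → ℝ)) =
      ((cube d n).image fun k j => (k j : ℝ) / n : Finset (Fin d → ℝ)) := by
  have hn' : (0 : ℝ) < n := by exact_mod_cast hn
  ext x
  simp only [Set.mem_inter_iff, mem_closedBall_zero_iff, Finset.coe_image, Set.mem_image,
    Set.mem_smul_set, SetLike.mem_coe]
  rw [pi_norm_le_iff_of_nonneg zero_le_one]
  constructor
  · rintro ⟨hx, y, hy, rfl⟩
    rw [Module.Basis.mem_span_iff_repr_mem] at hy
    choose k hk using hy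
    have hk' : ∀ j, (k j : ℝ) = y j := by simpa using hk
    refine ⟨k, mem_cube.2 fun j => ?_, funext fun j => ?_⟩
    · have h1 := hx j
      rw [Pi.smul_apply, smul_eq_mul, ← hk', Real.norm_eq_abs, abs_mul,
        abs_of_pos (inv_pos.2 hn'), inv_mul_le_iff₀ hn', mul_one, abs_le] at h1
      exact ⟨by exact_mod_cast h1.1, by exact_mod_cast h1.2⟩
    · rw [Pi.smul_apply, smul_eq_mul, hk', div_eq_inv_mul]
  · rintro ⟨k, hk, rfl⟩
    rw [mem_cube] at hk
    refine ⟨fun j => ?_, fun j => (k j : ℝ), ?_, funext fun j => ?_⟩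
    · rw [Real.norm_eq_abs, abs_div, abs_of_pos hn', div_le_one hn', abs_le]
      exact ⟨by exact_mod_cast (hk j).1, by exact_mod_cast (hk j).2⟩
    · rw [Module.Basis.mem_span_iff_repr_mem]
      intro j
      exact ⟨k j, by simp⟩
    · simp [div_eq_inv_mul]

theorem tendsto_riemann_sum {F : (Fin d → ℝ) → ℝ} (hF : Continuous F) :
    Tendsto (fun n : ℕ => (∑ k ∈ cube d n, F fun j => (k j : ℝ) / n) / (n : ℝ) ^ d) atTop
      (𝓝 (∫ x in Metric.closedBall (0 : Fin d → ℝ) 1, F x)) := by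
  have h := tendsto_tsum_div_pow_atTop_integral (Metric.closedBall (0 : Fin d → ℝ) 1) F hF
    Metric.isBounded_closedBall Metric.isClosed_closedBall.measurableSet
    ((convex_closedBall _ _).addHaar_frontier _)
  refine h.congr' ?_
  filter_upwards [eventually_ge_atTop 1] with n hn
  have hn' : (n : ℝ) ≠ 0 := by positivity
  rw [inter_smul_lattice_eq hn, Fintype.card_fin]
  congr 1
  rw [Finset.tsum_subtype' ((cube d n).image fun k j => (k j : ℝ) / n) F, Finset.sum_image]
  intro k _ l _ hkl
  ext j
  have := congrFun hkl j
  simp only at this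
  field_simp at this
  exact_mod_cast this

/-- The real part of the Bochner–Riesz kernel on the torus, divided by `n^d`. -/
def scaledKernel (d : ℕ) (δ : ℝ) (n : ℕ) (x : Torus d) : ℝ :=
  (∑ k ∈ cube d n, weight 2 δ n k * (character k x).re) / (n : ℝ) ^ d

theorem continuous_scaledKernel (δ : ℝ) (n : ℕ) : Continuous (scaledKernel d δ n) := by
  have h := fun k : Fin d → ℤ => Complex.continuous_re.comp (continuous_character k)
  exact (continuous_finsetSum _ fun k _ => continuous_const.mul (h k)).div_const _

theorem weight_two_eq_ballPow (δ : ℝ) {n : ℕ} (hn : 1 ≤ n) (k : Fin d → ℤ) :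
    weight 2 δ n k = ballPow δ fun j => (k j : ℝ) / n := by
  rw [weight_eq 2 δ hn, ballPow, eucl, Real.sq_sqrt (Finset.sum_nonneg fun j _ => sq_nonneg _)]
  simp only [div_pow, Finset.sum_div]
  norm_num

theorem abs_scaledKernel_le {δ : ℝ} (hδ : 0 < δ) {n : ℕ} (hn : 1 ≤ n) (x : Torus d) :
    |scaledKernel d δ n x| ≤ 3 ^ d := by
  have hn' : (1 : ℝ) ≤ n := by exact_mod_cast hn
  rw [scaledKernel, abs_div, abs_of_pos (by positivity : (0 : ℝ) < (n : ℝ) ^ d),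
    div_le_iff₀ (by positivity)]
  have h1 : ∀ k ∈ cube d n, |weight 2 δ n k * (character k x).re| ≤ 1 := by
    intro k _
    rw [abs_mul, weight_two_eq_ballPow δ hn, abs_of_nonneg (ballPow_nonneg _ _)]
    refine mul_le_one₀ (ballPow_le_one hδ _) (abs_nonneg _) ?_
    exact (Complex.abs_re_le_norm _).trans (norm_character k x).le
  refine (Finset.abs_sum_le_sum_abs _ _).trans ((Finset.sum_le_sum h1).trans ?_)
  simp only [Finset.sum_const, card_cube, nsmul_eq_mul, mul_one]
  push_cast
  rw [← mul_pow]
  gcongr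
  linarith

/-- At the point `z / n` the normalized kernel is a Riemann sum, of mesh `1 / n`, for the Fourier
integral of `ballPow δ`. -/
theorem tendsto_scaledKernel {δ : ℝ} (hδ : 0 < δ) (z : Fin d → ℝ) :
    Tendsto (fun n : ℕ => scaledKernel d δ n (toTorus ((n : ℝ)⁻¹ • z))) atTop
      (𝓝 (rieszKernel δ (WithLp.toLp 2 z))) := by
  have hF : Continuous fun x : Fin d → ℝ => ballPow δ x * Real.cos (∑ j, x j * z j) :=
    (continuous_ballPow hδ).mul (by fun_prop)
  have h1 := tendsto_riemann_sum hF
  have h2 : ∫ x in Metric.closedBall (0 : Fin d → ℝ) 1, ballPow δ x * Real.cos (∑ j, x j * z j) =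
      rieszKernel δ (WithLp.toLp 2 z) := by
    rw [setIntegral_eq_integral_of_forall_compl_eq_zero, rieszKernel,
      ← (PiLp.volume_preserving_toLp (Fin d)).integral_comp
      (MeasurableEquiv.toLp 2 _).measurableEmbedding]
    · refine integral_congr_ae (ae_of_all _ fun x => ?_)
      simp [PiLp.inner_apply, mul_comm]
    · intro x hx
      rw [ballPow_eq_zero_of_one_lt_norm hδ (by simpa using hx), zero_mul]
  rw [h2] at h1
  refine h1.congr' ?_
  filter_upwards [eventually_ge_atTop 1] with n hn
  rw [scaledKernel]
  congr 1
  refine Finset.sum_congr rfl fun k _ => ?_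
  rw [weight_two_eq_ballPow δ hn, character_toTorus, mul_comm Complex.I, Complex.exp_ofReal_mul_I_re]
  congr 2
  refine Finset.sum_congr rfl fun j _ => ?_
  simp only [Pi.smul_apply, smul_eq_mul]
  ring

end BochnerRiesz

end

noncomputable section

namespace BochnerRiesz

variable {d : ℕ}

/-! ### Divergence up to the critical line -/

theorem norm_integral_scaledKernel_mul_le (p : ℝ≥0∞) [Fact (1 ≤ p)] {C δ : ℝ} (hC : 0 ≤ C)
    (hδ : 0 < δ) {n : ℕ} (hn : 1 ≤ n)
    (h : MultBdd (characterLp p (d := d)) C fun k => (weight 2 δ n k : ℂ))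
    {q q' : ℝ≥0∞} [ENNReal.HolderConjugate q q'] (hq : q ≠ ∞) (hqp : q = p ∨ q' = p)
    {g : Torus d → ℝ} (hg : Continuous g) :
    |(n : ℝ) ^ d * ∫ x, scaledKernel d δ n x * g x| ≤
      C * (4 * Real.pi) ^ d * ((5 : ℝ) ^ d) ^ (1 - (q⁻¹).toReal) *
        (((n : ℝ) ^ d) ^ (1 - (q⁻¹).toReal) * (eLpNorm g q' volume).toReal) := by
  have hq1 : 1 ≤ q := ENNReal.HolderConjugate.one_le q q'
  have hn' : (1 : ℝ) ≤ n := by exact_mod_cast hn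
  have h1 := norm_integral_kernel_mul_le p two_pos hδ hn h hqp
    (g := fun x => (g x : ℂ)) (Complex.continuous_ofReal.comp hg)
  have hgn : eLpNorm (fun x => (g x : ℂ)) q' volume = eLpNorm g q' volume :=
    eLpNorm_congr_norm_ae (ae_of_all _ fun x => by simp)
  rw [hgn] at h1
  have hcont : Continuous fun x : Torus d =>
      (∑ k ∈ cube d n, (weight 2 δ n k : ℂ) * character k x) * (g x : ℂ) :=
    (continuous_finsetSum _ fun k _ => continuous_const.mul (continuous_character k)).mul
      (Complex.continuous_ofReal.comp hg)
  have h2 : (n : ℝ) ^ d * ∫ x, scaledKernel d δ n x * g x =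
      (∫ x, (∑ k ∈ cube d n, (weight 2 δ n k : ℂ) * character k x) * (g x : ℂ)).re := by
    have h3 := integral_re (𝕜 := ℂ) (integrable_of_continuous hcont)
    simp only [RCLike.re_to_complex] at h3
    rw [← h3, ← integral_const_mul]
    refine integral_congr_ae (ae_of_all _ fun x => ?_)
    simp only [Complex.re_mul_ofReal, Complex.re_sum, Complex.re_ofReal_mul]
    rw [scaledKernel, ← mul_assoc, mul_div_cancel₀ _ (by positivity)]
  rw [h2]
  refine (Complex.abs_re_le_norm _).trans (h1.trans ?_)
  have hs : 0 ≤ 1 - (q⁻¹).toReal := by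
    have : (q⁻¹).toReal ≤ (1 : ℝ≥0∞).toReal :=
      ENNReal.toReal_mono ENNReal.one_ne_top (ENNReal.inv_le_one.2 hq1)
    simpa using this
  -- The constant `5` comes from `4n + 1 ≤ 5n`.
  have h4 : ((4 * n + 1 : ℝ) ^ d) ^ (1 - (q⁻¹).toReal) ≤
      ((5 : ℝ) ^ d) ^ (1 - (q⁻¹).toReal) * ((n : ℝ) ^ d) ^ (1 - (q⁻¹).toReal) := by
    rw [← Real.mul_rpow (by positivity) (by positivity), ← mul_pow]
    refine Real.rpow_le_rpow (by positivity) (pow_le_pow_left₀ (by positivity) (by linarith) _) hs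
  calc C * (eLpNorm (vallee d n) q volume).toReal * (eLpNorm g q' volume).toReal
      ≤ C * ((4 * Real.pi) ^ d * (((5 : ℝ) ^ d) ^ (1 - (q⁻¹).toReal) *
        ((n : ℝ) ^ d) ^ (1 - (q⁻¹).toReal))) * (eLpNorm g q' volume).toReal := by
        gcongr
        exact (eLpNorm_vallee_le hq1 hq n).trans (by gcongr)
    _ = _ := by ring

/-- The Euclidean length of a vector of `ℝ^d`. -/
def len (z : Fin d → ℝ) : ℝ := Real.sqrt (∑ j, z j ^ 2)

theorem tendsto_test_function {Γ : ℝ → ℝ} (hΓ : Continuous Γ) (z : Fin d → ℝ) :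
    Tendsto (fun n : ℕ => Γ (n * chord (toTorus ((n : ℝ)⁻¹ • z)))) atTop (𝓝 (Γ (len z))) :=
  (hΓ.tendsto _).comp (tendsto_mul_chord z)

theorem continuous_test_function {Γ : ℝ → ℝ} (hΓ : Continuous Γ) (n : ℕ) :
    Continuous fun x : Torus d => Γ (n * chord x) :=
  hΓ.comp (continuous_const.mul continuous_chord)

theorem chord_nonneg (x : Torus d) : 0 ≤ chord x := Real.sqrt_nonneg _

theorem exists_bound_of_eq_zero {Γ : ℝ → ℝ} (hΓ : Continuous Γ) {A : ℝ}
    (hA : ∀ r, A ≤ r → Γ r = 0) : ∃ M, 0 ≤ M ∧ ∀ r, 0 ≤ r → |Γ r| ≤ M := by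
  obtain ⟨M, hM⟩ := (isCompact_Icc (a := (0 : ℝ)) (b := A)).exists_bound_of_continuousOn
    hΓ.continuousOn
  refine ⟨max M 0, le_max_right _ _, fun r hr => ?_⟩
  rcases le_or_gt A r with h | h
  · rw [hA r h, abs_zero]; exact le_max_right _ _
  · exact (hM r ⟨hr, h.le⟩).trans (le_max_left _ _)

/-- If the means are bounded on `L_p`, the kernel on `ℝ^d` acts boundedly on radial functions. -/
theorem exists_abs_integral_rieszKernel_le (p : ℝ≥0∞) [Fact (1 ≤ p)] {C δ : ℝ} (hC : 0 ≤ C)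
    (hδ : 0 < δ)
    (h : ∀ n, 1 ≤ n → MultBdd (characterLp p (d := d)) C fun k => (weight 2 δ n k : ℂ))
    {q q' : ℝ≥0∞} [ENNReal.HolderConjugate q q'] (hq : q ≠ ∞) (hqp : q = p ∨ q' = p) :
    ∃ K, 0 ≤ K ∧ ∀ (Γ : ℝ → ℝ) (A N : ℝ), Continuous Γ → 0 ≤ A → (∀ r, A ≤ r → Γ r = 0) →
      (q' = ∞ → ∀ r, 0 ≤ r → |Γ r| ≤ N) →
      (q' ≠ ∞ → (∫ z : Fin d → ℝ, |Γ (len z)| ^ q'.toReal) ^ (q'.toReal)⁻¹ ≤ N) →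
      |∫ z : Fin d → ℝ, rieszKernel δ (WithLp.toLp 2 z) * Γ (len z)| ≤ K * N := by
  set s : ℝ := 1 - (q⁻¹).toReal with hs
  have hq1' : 1 ≤ q' := ENNReal.HolderConjugate.one_le q' q
  have hsq : s = (q'⁻¹).toReal := by
    have h1 := ENNReal.HolderConjugate.inv_add_inv_eq_one q q'
    have h2 := congrArg ENNReal.toReal h1
    have hq1 : 1 ≤ q := ENNReal.HolderConjugate.one_le q q'
    rw [ENNReal.toReal_add (by simpa using (zero_lt_one.trans_le hq1).ne')
      (by simpa using (zero_lt_one.trans_le hq1').ne'), ENNReal.toReal_one] at h2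
    rw [hs]; linarith
  refine ⟨C * (4 * Real.pi) ^ d * ((5 : ℝ) ^ d) ^ s, by positivity,
    fun Γ A N hΓ hA0 hA htop hfin => ?_⟩
  obtain ⟨M, hM0, hM⟩ := exists_bound_of_eq_zero hΓ hA
  have hlim : Tendsto (fun n : ℕ => |(n : ℝ) ^ d * ∫ x : Torus d,
      scaledKernel d δ n x * Γ (n * chord x)|) atTop
      (𝓝 |∫ z : Fin d → ℝ, rieszKernel δ (WithLp.toLp 2 z) * Γ (len z)|) := by
    refine (tendsto_pow_mul_integral (φ := fun n x => scaledKernel d δ n x * Γ (n * chord x))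
      (M := 3 ^ d * M) hA0 (fun n =>
      (continuous_scaledKernel δ n).mul (continuous_test_function hΓ n)) ?_ ?_ ?_).abs
    · intro n hn x
      rw [abs_mul]
      exact mul_le_mul (abs_scaledKernel_le hδ hn x)
        (hM _ (mul_nonneg (Nat.cast_nonneg n) (chord_nonneg x))) (abs_nonneg _) (by positivity)
    · intro n _ x hx
      rw [hA _ hx, mul_zero]
    · exact fun z => (tendsto_scaledKernel hδ z).mul (tendsto_test_function hΓ z)
  have hle : ∀ n : ℕ, 1 ≤ n → |(n : ℝ) ^ d * ∫ x : Torus d,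
      scaledKernel d δ n x * Γ (n * chord x)| ≤ C * (4 * Real.pi) ^ d * ((5 : ℝ) ^ d) ^ s *
        (((n : ℝ) ^ d) ^ s * (eLpNorm (fun x : Torus d => Γ (n * chord x)) q' volume).toReal) :=
    fun n hn => norm_integral_scaledKernel_mul_le p hC hδ hn (h n hn) hq hqp
      (continuous_test_function hΓ n)
  by_cases hq' : q' = ∞
  · have hs0 : s = 0 := by rw [hsq, hq']; simp
    refine le_of_tendsto hlim ?_
    filter_upwards [eventually_ge_atTop 1] with n hn
    refine (hle n hn).trans ?_
    gcongr
    rw [hs0, Real.rpow_zero, one_mul, hq', eLpNorm_exponent_top]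
    have hN : 0 ≤ N := (abs_nonneg _).trans (htop hq' 0 le_rfl)
    refine ENNReal.toReal_le_of_le_ofReal hN ?_
    refine eLpNormEssSup_le_of_ae_bound (ae_of_all _ fun x => ?_)
    exact htop hq' _ (mul_nonneg (Nat.cast_nonneg n) (chord_nonneg x))
  · set t := q'.toReal with ht
    have hq0 : q' ≠ 0 := (zero_lt_one.trans_le hq1').ne'
    have ht0 : 0 < t := ENNReal.toReal_pos hq0 hq'
    have hst : s = t⁻¹ := by rw [hsq, ENNReal.toReal_inv]
    -- Since `s = 1/q'`, the factor `(n^d)^s` is exactly what normalizes the `L_q'` norm of a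
    -- function concentrated at scale `1/n`; the limit is the Euclidean norm.
    have hlim2 : Tendsto (fun n : ℕ => ((n : ℝ) ^ d * ∫ x : Torus d,
        |Γ (n * chord x)| ^ t) ^ t⁻¹) atTop (𝓝 ((∫ z : Fin d → ℝ, |Γ (len z)| ^ t) ^ t⁻¹)) := by
      refine (tendsto_pow_mul_integral (M := M ^ t) hA0 (fun n =>
        (continuous_test_function hΓ n).abs.rpow_const fun _ => Or.inr ht0.le) ?_ ?_ ?_).rpow_const
          (Or.inr (by positivity))
      · intro n hn x
        rw [abs_of_nonneg (by positivity)]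
        exact Real.rpow_le_rpow (abs_nonneg _)
          (hM _ (mul_nonneg (Nat.cast_nonneg n) (chord_nonneg x))) ht0.le
      · intro n _ x hx
        rw [hA _ hx, abs_zero, Real.zero_rpow ht0.ne']
      · exact fun z => (tendsto_test_function hΓ z).abs.rpow_const (Or.inr ht0.le)
    have hK : 0 ≤ C * (4 * Real.pi) ^ d * ((5 : ℝ) ^ d) ^ s := by positivity
    refine le_trans (le_of_tendsto_of_tendsto hlim
      (hlim2.const_mul (C * (4 * Real.pi) ^ d * ((5 : ℝ) ^ d) ^ s)) ?_)
      (mul_le_mul_of_nonneg_left (hfin hq') hK)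
    filter_upwards [eventually_ge_atTop 1] with n hn
    refine (hle n hn).trans (le_of_eq ?_)
    congr 1
    rw [Real.mul_rpow (by positivity) (integral_nonneg fun x => by positivity), hst,
      (memLp_of_continuous (continuous_test_function hΓ n) q').eLpNorm_eq_integral_rpow_norm
        hq0 hq', ENNReal.toReal_ofReal (by positivity)]
    rfl

/-! ### The extremal radial functions -/

/-- A continuous cutoff to `[1, A]`. -/
def plateau (A r : ℝ) : ℝ := max 0 (min 1 (min (r - 1) (A - r)))

theorem continuous_plateau (A : ℝ) : Continuous (plateau A) := by
  unfold plateau; fun_prop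

theorem plateau_nonneg (A r : ℝ) : 0 ≤ plateau A r := le_max_left _ _

theorem plateau_le_one (A r : ℝ) : plateau A r ≤ 1 := max_le zero_le_one (min_le_left _ _)

theorem plateau_eq_zero_of_le_one {A r : ℝ} (h : r ≤ 1) : plateau A r = 0 :=
  max_eq_left ((min_le_right _ _).trans ((min_le_left _ _).trans (by linarith)))

theorem plateau_eq_zero_of_ge {A r : ℝ} (h : A ≤ r) : plateau A r = 0 :=
  max_eq_left ((min_le_right _ _).trans ((min_le_right _ _).trans (by linarith)))

theorem plateau_eq_one {A r : ℝ} (h : 2 ≤ r) (h' : r ≤ A - 1) : plateau A r = 1 := by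
  rw [plateau, min_eq_left (le_min (by linarith) (by linarith)), max_eq_right zero_le_one]

/-- The radial profile on which the kernel of order `δ` is tested; `ν = δ + d/2`. -/
def extremal (d : ℕ) (δ A r : ℝ) : ℝ := bessel (δ + d / 2) r * r ^ (2 * δ + 1) * plateau A r

theorem continuous_extremal {δ : ℝ} (hδ : 0 < δ) (A : ℝ) : Continuous (extremal d δ A) :=
  ((continuous_bessel (by positivity)).mul
    (Real.continuous_rpow_const (by positivity))).mul (continuous_plateau A)

/-- The power `2δ + 1` in `extremal` is chosen so that, with the radial density `r^d`, the pairing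
becomes `w² / r` for the energy-normalized `w = r^(ν+1) bessel ν r`, since `d + 2δ + 1 = 2(ν + 1) -
1`. -/
theorem pow_mul_bessel_mul_extremal (δ A : ℝ) {r : ℝ} (hr : 0 < r) :
    r ^ d * (bessel (δ + d / 2) r * extremal d δ A r) =
      (r ^ (δ + d / 2 + 1) * bessel (δ + d / 2) r) ^ 2 / r * plateau A r := by
  have h : r ^ d * r ^ (2 * δ + 1) = (r ^ (δ + d / 2 + 1)) ^ 2 / r := by
    rw [eq_div_iff hr.ne', ← Real.rpow_natCast, ← Real.rpow_natCast, ← Real.rpow_mul hr.le,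
      ← Real.rpow_add hr, ← Real.rpow_add_one hr.ne']
    congr 1
    push_cast
    ring
  rw [extremal, mul_pow]
  calc _ = r ^ d * r ^ (2 * δ + 1) * bessel (δ + d / 2) r ^ 2 * plateau A r := by ring
    _ = _ := by rw [h]; ring

theorem exists_le_integral_extremal {δ : ℝ} (hδ : 0 < δ) :
    ∃ a C, 0 < a ∧ ∀ L, 1 ≤ L → a * L - C ≤ ∫ r in Set.Ioi (0 : ℝ),
      r ^ d * (bessel (δ + d / 2) r * extremal d δ (1 + Real.exp L) r) := by
  obtain ⟨a, C, ha, hlog⟩ := exists_log_le_integral_bessel (ν := δ + d / 2) (by positivity)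
  set w2 : ℝ → ℝ := fun r => (r ^ (δ + d / 2 + 1) * bessel (δ + d / 2) r) ^ 2 / r with hw2
  -- With `A = 1 + exp L` the plateau is `1` on `[2, exp L]`; the loss on `[1, 2]` is a constant
  -- independent of `L`.
  refine ⟨a, C + ∫ r in (1 : ℝ)..2, w2 r, ha, fun L hL => ?_⟩
  have hexp : 2 ≤ Real.exp L := by linarith [Real.add_one_le_exp L]
  have h1 := hlog (Real.exp L) (by linarith)
  rw [Real.log_exp] at h1
  have hcont : ContinuousOn w2 (Set.Ioi 0) := by
    have h2 : Continuous fun r : ℝ => (r ^ (δ + d / 2 + 1) * bessel (δ + d / 2) r) ^ 2 :=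
      ((Real.continuous_rpow_const (by positivity)).mul
        (continuous_bessel (by positivity))).pow 2
    exact h2.continuousOn.div continuousOn_id fun r hr => ne_of_gt hr
  have hint : ∀ u v : ℝ, 0 < u → 0 < v → IntervalIntegrable w2 volume u v := fun u v hu hv =>
    (hcont.mono fun r hr => lt_of_lt_of_le (lt_min hu hv) hr.1).intervalIntegrable
  have h3 := intervalIntegral.integral_add_adjacent_intervals
    (hint 1 2 one_pos two_pos) (hint 2 (Real.exp L) two_pos (by positivity))
  have hF : Continuous fun r => r ^ d * (bessel (δ + d / 2) r * extremal d δ (1 + Real.exp L) r) :=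
    (continuous_pow d).mul ((continuous_bessel (by positivity)).mul (continuous_extremal hδ _))
  have h4 : ∫ r in (2 : ℝ)..Real.exp L, w2 r ≤ ∫ r in Set.Ioi (0 : ℝ),
      r ^ d * (bessel (δ + d / 2) r * extremal d δ (1 + Real.exp L) r) := by
    have h5 : ∫ r in (2 : ℝ)..Real.exp L, w2 r = ∫ r in Set.Ioc (2 : ℝ) (Real.exp L),
        r ^ d * (bessel (δ + d / 2) r * extremal d δ (1 + Real.exp L) r) := by
      rw [intervalIntegral.integral_of_le hexp]
      refine setIntegral_congr_fun measurableSet_Ioc fun r hr => ?_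
      rw [pow_mul_bessel_mul_extremal _ _ (by linarith [hr.1]),
        plateau_eq_one hr.1.le (by linarith [hr.2]), mul_one]
    rw [h5]
    refine setIntegral_mono_set ?_ ?_ ?_
    · refine IntegrableOn.of_forall_sdiff_eq_zero
        (s := Set.Icc 0 (1 + Real.exp L)) hF.continuousOn.integrableOn_Icc measurableSet_Ioi ?_
      intro r hr
      have : 1 + Real.exp L ≤ r := by
        by_contra! hlt
        exact hr.2 ⟨le_of_lt hr.1, hlt.le⟩
      rw [extremal, plateau_eq_zero_of_ge this]
      ring
    · filter_upwards [ae_restrict_mem measurableSet_Ioi] with r hr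
      have hr : 0 < r := hr
      rw [pow_mul_bessel_mul_extremal _ _ hr]
      exact mul_nonneg (by positivity) (plateau_nonneg _ _)
    · refine LE.le.eventuallyLE fun r hr => ?_
      exact lt_trans two_pos hr.1
  linarith

theorem exists_abs_extremal_le {δ : ℝ} (hδ : 0 < δ) :
    ∃ B, 0 ≤ B ∧ ∀ A r, 1 ≤ r → |extremal d δ A r| ≤ B * r ^ (δ - d / 2) := by
  obtain ⟨B, hB⟩ := exists_abs_bessel_le (ν := δ + d / 2) (by positivity)
  refine ⟨B, (abs_nonneg _).trans (hB 1 le_rfl), fun A r hr => ?_⟩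
  have hr0 : 0 < r := by linarith
  have h1 : bessel (δ + d / 2) r * r ^ (2 * δ + 1) =
      (r ^ (δ + d / 2 + 1) * bessel (δ + d / 2) r) * r ^ (δ - d / 2) := by
    have : r ^ (2 * δ + 1) = r ^ (δ + d / 2 + 1) * r ^ (δ - d / 2) := by
      rw [← Real.rpow_add hr0]; congr 1; ring
    rw [this]; ring
  rw [extremal, h1, abs_mul, abs_mul, abs_of_nonneg (plateau_nonneg A r),
    abs_of_pos (Real.rpow_pos_of_pos hr0 _)]
  have h2 : 0 ≤ r ^ (δ - d / 2) := by positivity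
  calc _ ≤ |r ^ (δ + d / 2 + 1) * bessel (δ + d / 2) r| * r ^ (δ - d / 2) * 1 := by
        gcongr
        exact plateau_le_one A r
    _ ≤ B * r ^ (δ - d / 2) := by
        rw [mul_one]
        gcongr
        exact hB r hr

theorem integral_radial (f : ℝ → ℝ) :
    ∫ z : Fin (d + 1) → ℝ, f (len z) = ((d + 1 : ℕ) *
      (volume : Measure (EuclideanSpace ℝ (Fin (d + 1)))).real (Metric.ball 0 1)) *
        ∫ r in Set.Ioi (0 : ℝ), r ^ d * f r := by
  have h1 := integral_fun_norm_addHaar (volume : Measure (EuclideanSpace ℝ (Fin (d + 1)))) f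
  rw [finrank_euclideanSpace_fin] at h1
  have h2 : ∫ z : Fin (d + 1) → ℝ, f (len z) = ∫ y : EuclideanSpace ℝ (Fin (d + 1)), f ‖y‖ := by
    rw [← (PiLp.volume_preserving_toLp (Fin (d + 1))).integral_comp
      (MeasurableEquiv.toLp 2 _).measurableEmbedding]
    refine integral_congr_ae (ae_of_all _ fun z => ?_)
    simp [len, EuclideanSpace.norm_eq]
  rw [h2, h1]
  simp [mul_assoc]

/-- The condition `hcrit` makes the integrand at most a multiple of `r^d r^(-(d+1)) = 1/r` on `[1,
A]`. Equality is the critical line, where the logarithm remains. -/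
theorem integral_abs_extremal_rpow_le {δ : ℝ} (hδ : 0 < δ) {B : ℝ} (hB0 : 0 ≤ B)
    (hB : ∀ A r, 1 ≤ r → |extremal d δ A r| ≤ B * r ^ (δ - d / 2)) {t : ℝ} (ht : 0 < t)
    (hcrit : (δ - d / 2) * t ≤ -(d + 1)) {A : ℝ} (hA : 1 ≤ A) :
    ∫ r in Set.Ioi (0 : ℝ), r ^ d * |extremal d δ A r| ^ t ≤ B ^ t * Real.log A := by
  have hF : Continuous fun r => r ^ d * |extremal d δ A r| ^ t :=
    (continuous_pow d).mul ((continuous_extremal hδ A).abs.rpow_const fun _ => Or.inr ht.le)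
  have h1 : ∫ r in Set.Ioi (0 : ℝ), r ^ d * |extremal d δ A r| ^ t =
      ∫ r in (1 : ℝ)..A, r ^ d * |extremal d δ A r| ^ t := by
    rw [intervalIntegral.integral_of_le hA]
    refine setIntegral_eq_of_subset_of_forall_sdiff_eq_zero measurableSet_Ioi
      (fun r hr => lt_trans one_pos hr.1) fun r hr => ?_
    have h0 : plateau A r = 0 := by
      rcases le_or_gt r 1 with h | h
      · exact plateau_eq_zero_of_le_one h
      · refine plateau_eq_zero_of_ge ?_
        by_contra! hlt
        exact hr.2 ⟨h, hlt.le⟩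
    rw [extremal, h0, mul_zero, abs_zero, Real.zero_rpow ht.ne', mul_zero]
  have h2 : ∫ r in (1 : ℝ)..A, B ^ t * r⁻¹ = B ^ t * Real.log A := by
    rw [intervalIntegral.integral_const_mul, integral_inv_of_pos one_pos (by linarith), div_one]
  rw [h1, ← h2]
  refine intervalIntegral.integral_mono_on hA (hF.intervalIntegrable _ _) ?_ fun r hr => ?_
  · refine ContinuousOn.intervalIntegrable ?_
    refine continuousOn_const.mul (continuousOn_id.inv₀ fun r hr => ?_)
    rw [Set.uIcc_of_le hA] at hr
    simp only [id]
    linarith [hr.1]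
  · have hr0 : 0 < r := by linarith [hr.1]
    calc r ^ d * |extremal d δ A r| ^ t ≤ r ^ d * (B * r ^ (δ - d / 2)) ^ t := by
          gcongr
          exact hB A r hr.1
      _ = B ^ t * (r ^ d * r ^ ((δ - d / 2) * t)) := by
          rw [Real.mul_rpow hB0 (by positivity), ← Real.rpow_mul hr0.le]; ring
      _ ≤ B ^ t * (r ^ d * r ^ (-(d + 1) : ℝ)) := by
          gcongr
          exact hr.1
      _ = B ^ t * r⁻¹ := by
          rw [← Real.rpow_natCast, ← Real.rpow_add hr0, ← Real.rpow_neg_one]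
          congr 2
          ring

/-- On and below the critical line the multipliers are not uniformly bounded. -/
theorem not_exists_multBdd (p : ℝ≥0∞) [Fact (1 ≤ p)] {δ : ℝ} (hδ : 0 < δ) {q q' : ℝ≥0∞}
    [ENNReal.HolderConjugate q q'] (hqp : q = p ∨ q' = p)
    (hcrit : δ + d / 2 + 1 ≤ (d + 1) * (q⁻¹).toReal) :
    ¬ ∃ C, ∀ n, 1 ≤ n →
      MultBdd (characterLp p (d := d + 1)) C fun k => (weight 2 δ n k : ℂ) := by
  rintro ⟨C, hC⟩
  have hC' : ∀ n, 1 ≤ n →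
      MultBdd (characterLp p (d := d + 1)) |C| fun k => (weight 2 δ n k : ℂ) := fun n hn s c =>
    (hC n hn s c).trans (mul_le_mul_of_nonneg_right (le_abs_self C) (norm_nonneg _))
  -- As `δ > 0`, the critical condition forces `1/q > 1/2`, hence `1/q' < 1/2`: the norms of the
  -- test functions grow at most like `√L`, against a pairing of order `L`.
  have hu : 1 / 2 < (q⁻¹).toReal := by
    by_contra! h
    have : ((d : ℝ) + 1) * (q⁻¹).toReal ≤ (d + 1) * (1 / 2) := by gcongr
    linarith
  have hq : q ≠ ∞ := by
    rintro rfl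
    norm_num at hu
  have hq1 : 1 ≤ q := ENNReal.HolderConjugate.one_le q q'
  have hq1' : 1 ≤ q' := ENNReal.HolderConjugate.one_le q' q
  have hconj : (q⁻¹).toReal + (q'⁻¹).toReal = 1 := by
    have h2 := congrArg ENNReal.toReal (ENNReal.HolderConjugate.inv_add_inv_eq_one q q')
    rwa [ENNReal.toReal_add (by simpa using (zero_lt_one.trans_le hq1).ne')
      (by simpa using (zero_lt_one.trans_le hq1').ne'), ENNReal.toReal_one] at h2
  obtain ⟨K, hK, hbound⟩ := exists_abs_integral_rieszKernel_le p (abs_nonneg C) hδ hC' hq hqp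
  obtain ⟨B, hB0, hB⟩ := exists_abs_extremal_le (d := d) hδ
  obtain ⟨a, C₁, ha, hlow⟩ := exists_le_integral_extremal (d := d) hδ
  set I := ∫ x : Fin d → ℝ, ballPow δ x with hI
  have hI0 : 0 < I := integral_ballPow_pos hδ
  obtain ⟨S, hS⟩ : ∃ S : ℝ, (d + 1 : ℕ) *
    (volume : Measure (EuclideanSpace ℝ (Fin (d + 1)))).real (Metric.ball 0 1) = S := ⟨_, rfl⟩
  have hS0 : 0 < S := by
    have : 0 < (volume : Measure (EuclideanSpace ℝ (Fin (d + 1)))).real (Metric.ball 0 1) :=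
      ENNReal.toReal_pos (Metric.measure_ball_pos _ _ one_pos).ne' measure_ball_lt_top.ne
    rw [← hS]
    positivity
  -- upper bound for the norms of the test functions
  obtain ⟨B', hB'⟩ : ∃ B', ∀ L, 1 ≤ L →
      (q' = ∞ → ∀ r, 0 ≤ r → |extremal d δ (1 + Real.exp L) r| ≤ B' * Real.sqrt L) ∧
      (q' ≠ ∞ → (∫ z : Fin (d + 1) → ℝ, |extremal d δ (1 + Real.exp L) (len z)| ^ q'.toReal) ^
        (q'.toReal)⁻¹ ≤ B' * Real.sqrt L) := by
    by_cases hq' : q' = ∞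
    · refine ⟨B, fun L hL => ⟨fun _ r hr => ?_, fun h => absurd hq' h⟩⟩
      have h1 : 1 ≤ Real.sqrt L := Real.one_le_sqrt.2 hL
      have h2 : B ≤ B * Real.sqrt L := le_mul_of_one_le_right hB0 h1
      refine le_trans ?_ h2
      rcases le_or_gt r 1 with h | h
      · rw [extremal, plateau_eq_zero_of_le_one h, mul_zero, abs_zero]
        exact hB0
      -- For `q' = ∞` the critical condition reads `δ ≤ d / 2`, so the power of `r` is at most `1`.
      · refine (hB _ r h.le).trans (mul_le_of_le_one_right hB0 ?_)
        refine Real.rpow_le_one_of_one_le_of_nonpos h.le ?_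
        rw [hq'] at hconj
        simp only [ENNReal.inv_top, ENNReal.toReal_zero, add_zero] at hconj
        rw [hconj] at hcrit
        linarith
    · set t := q'.toReal with ht
      have ht0 : 0 < t := ENNReal.toReal_pos (zero_lt_one.trans_le hq1').ne' hq'
      have htinv : (q'⁻¹).toReal = t⁻¹ := ENNReal.toReal_inv _
      rw [htinv] at hconj
      have ht2 : t⁻¹ ≤ 1 / 2 := by linarith
      have hct : (δ - d / 2) * t ≤ -(d + 1) := by
        have h1 : δ - d / 2 ≤ -((d + 1) * t⁻¹) := by
          have : (q⁻¹).toReal = 1 - t⁻¹ := by linarith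
          rw [this] at hcrit
          linarith
        calc (δ - d / 2) * t ≤ -((d + 1) * t⁻¹) * t := by gcongr
          _ = -(d + 1) := by field_simp
      refine ⟨S ^ t⁻¹ * B * (2 : ℝ) ^ (1 / 2 : ℝ), fun L hL => ⟨fun h => absurd h hq', fun _ => ?_⟩⟩
      have hexp : 1 ≤ Real.exp L := Real.one_le_exp (by linarith)
      have hlogA : Real.log (1 + Real.exp L) ≤ 2 * L := by
        rw [Real.log_le_iff_le_exp (by positivity), two_mul, Real.exp_add]
        have : 2 ≤ Real.exp L := by linarith [Real.add_one_le_exp L]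
        nlinarith
      rw [integral_radial fun r => |extremal d δ (1 + Real.exp L) r| ^ t, hS]
      have h1 : S * ∫ r in Set.Ioi (0 : ℝ), r ^ d * |extremal d δ (1 + Real.exp L) r| ^ t ≤
          S * (B ^ t * (2 * L)) := by
        gcongr
        refine (integral_abs_extremal_rpow_le hδ hB0 hB ht0 hct (by linarith)).trans ?_
        gcongr
      have h0 : 0 ≤ ∫ r in Set.Ioi (0 : ℝ), r ^ d * |extremal d δ (1 + Real.exp L) r| ^ t :=
        setIntegral_nonneg measurableSet_Ioi fun r hr => by
          have : 0 < r := hr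
          positivity
      calc (S * ∫ r in Set.Ioi (0 : ℝ), r ^ d * |extremal d δ (1 + Real.exp L) r| ^ t) ^ t⁻¹
          ≤ (S * (B ^ t * (2 * L))) ^ t⁻¹ :=
            Real.rpow_le_rpow (by positivity) h1 (by positivity)
        _ = S ^ t⁻¹ * B * (2 * L) ^ t⁻¹ := by
            rw [Real.mul_rpow hS0.le (by positivity), Real.mul_rpow (by positivity) (by positivity),
              ← Real.rpow_mul hB0, mul_inv_cancel₀ ht0.ne', Real.rpow_one]
            ring
        _ ≤ S ^ t⁻¹ * B * (2 * L) ^ (1 / 2 : ℝ) := by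
            gcongr
            linarith
        _ = S ^ t⁻¹ * B * (2 : ℝ) ^ (1 / 2 : ℝ) * Real.sqrt L := by
            rw [Real.mul_rpow (by norm_num) (by linarith), Real.sqrt_eq_rpow]
            ring
  have hmain : ∀ L, 1 ≤ L → I * S * (a * L - C₁) ≤ K * (B' * Real.sqrt L) := by
    intro L hL
    have h1 := hbound (extremal d δ (1 + Real.exp L)) (1 + Real.exp L) (B' * Real.sqrt L)
      (continuous_extremal hδ _) (by positivity)
      (fun r hr => by rw [extremal, plateau_eq_zero_of_ge hr, mul_zero]) (hB' L hL).1 (hB' L hL).2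
    refine le_trans ?_ ((le_abs_self _).trans h1)
    have h2 : ∀ z : Fin (d + 1) → ℝ, rieszKernel δ (WithLp.toLp 2 z) *
        extremal d δ (1 + Real.exp L) (len z) =
        I * (bessel (δ + d / 2) (len z) * extremal d δ (1 + Real.exp L) (len z)) := by
      intro z
      rw [rieszKernel_eq_bessel hδ, mul_assoc]
      simp [len, EuclideanSpace.norm_eq, hI]
    simp only [h2]
    rw [integral_const_mul, integral_radial fun r =>
      bessel (δ + d / 2) r * extremal d δ (1 + Real.exp L) r, hS, mul_assoc]
    gcongr
    exact hlow L hL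
  -- quadratic growth against linear growth
  set c := I * S * a with hc
  have hc0 : 0 < c := by positivity
  -- With `L = M²` and this `M`, `c * M` exceeds the sum of both error constants by `c`, which
  -- contradicts `hmain`.
  set M : ℝ := (|K * B'| + |I * S * C₁|) / c + 1 with hM
  have hM1 : 1 ≤ M := le_add_of_nonneg_left (by positivity)
  have h3 := hmain (M ^ 2) (one_le_pow₀ hM1)
  rw [Real.sqrt_sq (by linarith)] at h3
  have h4 : c * M = |K * B'| + |I * S * C₁| + c := by rw [hM]; field_simp
  have h5 : c * M ^ 2 - I * S * C₁ ≤ K * B' * M := by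
    calc c * M ^ 2 - I * S * C₁ = I * S * (a * M ^ 2 - C₁) := by rw [hc]; ring
      _ ≤ K * (B' * M) := h3
      _ = K * B' * M := by ring
  have h6 : K * B' * M ≤ |K * B'| * M := by gcongr; exact le_abs_self _
  have h7 := le_abs_self (I * S * C₁)
  have h8 : c * M ^ 2 = (|K * B'| + |I * S * C₁| + c) * M := by rw [← h4]; ring
  have h9 : |I * S * C₁| ≤ |I * S * C₁| * M := le_mul_of_one_le_right (abs_nonneg _) hM1
  have h10 : 0 < c * M := by positivity
  nlinarith

/-- On and below the critical line the means diverge in `L_p`. -/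
theorem not_convergesInLp (p : ℝ≥0∞) [hp : Fact (1 ≤ p)] {β δ : ℝ} (hβ : 0 < β) (hδ : 0 < δ)
    (hcrit : δ ≤ (d + 1) * |(p⁻¹).toReal - 1 / 2| - 1 / 2) :
    ¬ ConvergesInLp p (mean (d + 1) β δ) := by
  intro hconv
  have h2 := ConvergesInLp.of_exponent p two_pos hβ hδ hconv
  rw [convergesInLp_iff p two_pos hδ] at h2
  have hpc := ENNReal.HolderConjugate.inv_one_sub_inv' hp.out
  -- Duality: `q` is whichever of `p` and its conjugate is at most `2`, which accounts for the
  -- absolute value in the critical condition.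
  rcases le_or_gt (1 / 2) (p⁻¹).toReal with h | h
  · rw [abs_of_nonneg (by linarith)] at hcrit
    exact not_exists_multBdd p hδ (q := p) (q' := (1 - p⁻¹)⁻¹) (Or.inl rfl) (by linarith) h2
  · rw [abs_of_neg (by linarith)] at hcrit
    have hsymm : ENNReal.HolderConjugate (1 - p⁻¹)⁻¹ p := hpc.symm
    refine not_exists_multBdd p hδ (q := (1 - p⁻¹)⁻¹) (q' := p) (Or.inr rfl) ?_ h2
    rw [inv_inv, ENNReal.toReal_sub_of_le (ENNReal.inv_le_one.2 hp.out) ENNReal.one_ne_top,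
      ENNReal.toReal_one]
    linarith

end BochnerRiesz

end
/-- Here `(p⁻¹).toReal` is `1/p`, with `1/∞ = 0`; to diverge in `L_p` is not to converge there. -/
theorem theorem2p1 (d : ℕ) (hd : 1 ≤ d) (p : ℝ≥0∞) (hp : 1 ≤ p) (β δ : ℝ)
    (hβ : 0 < β) (hδ : 0 < δ) :
    (BochnerRiesz.ConvergesInLp p (BochnerRiesz.mean d β δ) ↔
      BochnerRiesz.ConvergesInLp p (BochnerRiesz.classicalMean d δ)) ∧
    (((p⁻¹).toReal, δ) ∈ BochnerRiesz.SigmaRegion d →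
      BochnerRiesz.ConvergesInLp p (BochnerRiesz.mean d β δ)) ∧
    (((p⁻¹).toReal, δ) ∈ BochnerRiesz.GammaRegion d →
      ¬ BochnerRiesz.ConvergesInLp p (BochnerRiesz.mean d β δ)) := by
  have : Fact (1 ≤ p) := ⟨hp⟩
  -- One coordinate is split off for the slicing formula; the critical index `(d - 1)/2` becomes `e
  -- / 2`.
  obtain ⟨d, rfl⟩ : ∃ e, d = e + 1 := ⟨d - 1, by omega⟩
  refine ⟨⟨fun h => h.of_exponent p two_pos hβ hδ, fun h => ?_⟩, fun h => ?_, fun h hconv => ?_⟩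
  · exact BochnerRiesz.ConvergesInLp.of_exponent p hβ two_pos hδ h
  · obtain ⟨_, _, h⟩ := h
    -- The first entry of the maximum suffices: `1/p ≤ 1` makes the second at most `(d - 1)/2`.
    have h1 := (le_max_left _ _).trans_lt h
    push_cast at h1
    exact BochnerRiesz.convergesInLp_of_critical_lt p hβ hδ (by linarith)
  · obtain ⟨_, _, h⟩ := h
    push_cast at h
    exact BochnerRiesz.not_convergesInLp p hβ hδ h hconv
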